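/- **Setting.** Let $L_2(\mathbb R_+,V)$, $V\in\{\mathbb C,\mathbb C^2\}$, carry its usual scalar product $(\cdot,\cdot)$, linear in the first argument. Let $\mathcal B=i\frac{d}{dx}$ in $L_2(\mathbb R_+,V)$ with $\mathcal D(\mathcal B)=\{u\in W_2^1(\mathbb R_+,V):u(0)=0\}$, and let $T=(\mathcal B-iI)(\mathcal B+iI)^{-1}$ be its Cayley transform (the forward shift). A function $q\in L_2(\mathbb R_+,V)$ is *non-cyclic* for the backward shift $T^*$ if the closed linear span of $\{T^{*n}q:n\ge 0\}$ is not all of $L_2(\mathbb R_+,V)$. For $\mathbf q=(q_1,q_2)\in L_2(\mathbb R_+,\mathbb C^2)$ and $a\in\mathbb C$, let $\mathbf H_{a\mathbf q}$ be the operator in $L_2(\mathbb R_+,\mathbb C^2)$ $$\mathbf H_{a\mathbf q}\mathbf f=-\mathbf f''+[\mathbf f]_r\,\mathbf q,\qquad \mathcal D(\mathbf H_{a\mathbf q})=\{\mathbf f\in W_2^2(\mathbb R_+,\mathbb C^2):[\mathbf f]_s=0,\ 2[\mathbf f']_r=a[\mathbf f]_r+(\mathbf f,\mathbf q)\},$$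 where $[\mathbf f]_r=\frac12(f_1(0)+f_2(0))$ and $[\mathbf f]_s=f_1(0)-f_2(0)$. Let $F\mathbf f(z)=\frac1{\sqrt{2\pi}}\int_0^\infty e^{izs}\mathbf f(s)\,ds$ for $z\in\mathbb C_+=\{\operatorname{Im}z>0\}$. A *matrix inner function* is a bounded holomorphic $\psi:\mathbb C_+\to\mathbb C^{2\times2}$ for which there is a fixed orthogonal projection $P$ of $\mathbb C^2$ such that, for a.e. $\delta\in\mathbb R$, the boundary value $\psi(\delta)=\lim_{y\to0+}\psi(\delta+iy)$ exists and $\psi(\delta)^*\psi(\delta)=P$. The operator $\psi(\mathcal B)=F^{-1}\psi F$ is defined by $F(\psi(\mathcal B)\mathbf f)=\psi\cdot F\mathbf f$ on $\mathbb C_+$. A scalar inner function is a bounded holomorphic function on $\mathbb C_+$ whose boundary values exist and have modulus $1$ a.e. on $\mathbb R$. A densely defined symmetric operator is *maximal* if it has no proper symmetric extension, and *simple* if its part in every nonzero closed reducing subspace is not self-adjoint. **Theorem.** Suppose that $\mathbf q\in L_2(\mathbb R_+,\mathbb C^2)$ is non-cyclic for $T^*$ in $L_2(\mathbb R_+,\mathbb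 C^2)$. Then there are a matrix inner function $\psi$ such that $\mathfrak H_0=\psi(\mathcal B)L_2(\mathbb R_+,\mathbb C^2)$ is a nonzero closed subspace, and an operator $B$ in the Hilbert space $\mathfrak H_0$, the restriction of $\mathcal B$ with $\mathcal D(B)=\mathcal D(\mathcal B)\cap\mathfrak H_0$ and $B\mathbf u=\mathcal B\mathbf u\in\mathfrak H_0$, such that $B$ is simple maximal symmetric with $\ker(B^*-iI)=\{0\}$, the operator $B^2$ is (densely defined and) symmetric in $\mathfrak H_0$, and for every $a\in\mathbb C$ the operator $\mathbf H_{a\mathbf q}$ is an extension of $B^2$, that is, $\mathcal D(B^2)\subset\mathcal D(\mathbf H_{a\mathbf q})$ and $\mathbf H_{a\mathbf q}\mathbf u=B^2\mathbf u$ for all $\mathbf u\in\mathcal D(B^2)$. If, moreover, at least one of $q_1,q_2$ is non-cyclic for the scalar backward shift in $L_2(\mathbb R_+)$, then $\psi$ can be chosen diagonal, $\psi=\operatorname{diag}(\psi_1,\psi_2)$, with $\psi_i$ a scalar inner function if $q_i$ is non-cyclic and $\psi_i=0$ otherwise. -/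

import Mathlib

open MeasureTheory Set Filter Topology

set_option linter.unusedSectionVars false

noncomputable section

/-! ### Unbounded operators in complex Hilbert spaces -/

namespace UnboundedOp

variable {E F G : Type*} [NormedAddCommGroup E] [InnerProductSpace ℂ E]
  [NormedAddCommGroup F] [InnerProductSpace ℂ F] [NormedAddCommGroup G] [InnerProductSpace ℂ G]

/-- The composition `A B` on its natural domain `{x ∈ D(B) : B x ∈ D(A)}`. -/
def comp (A : F →ₗ.[ℂ] G) (B : E →ₗ.[ℂ] F) : E →ₗ.[ℂ] G :=
  A.comp (B.domRestrict ((A.domain.comap B.toFun).map B.domain.subtype)) (by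
    rintro ⟨x, hx⟩
    obtain ⟨⟨y, hy, hyx⟩, hB⟩ := hx
    have h : B.domRestrict ((A.domain.comap B.toFun).map B.domain.subtype)
        ⟨x, ⟨⟨y, hy, hyx⟩, hB⟩⟩ = B y :=
      LinearPMap.domRestrict_apply (by simpa using hyx.symm)
    rw [h]
    exact hy)

theorem mem_graph_comp {A : F →ₗ.[ℂ] G} {B : E →ₗ.[ℂ] F} {x : E} {z : G} :
    (x, z) ∈ (comp A B).graph ↔ ∃ y, (x, y) ∈ B.graph ∧ (y, z) ∈ A.graph := by
  constructor
  · intro h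
    obtain ⟨⟨u, hu⟩, h1, h2⟩ := LinearPMap.mem_graph_iff _ |>.1 h
    obtain ⟨⟨y, hy, hyx⟩, hB⟩ := id hu
    simp only at h1
    subst h1
    refine ⟨B ⟨u, hB⟩, LinearPMap.mem_graph B ⟨u, hB⟩, ?_⟩
    simp only at h2
    subst hyx
    rw [← h2]
    exact LinearPMap.mem_graph A ⟨B y, hy⟩
  · rintro ⟨y, h1, h2⟩
    obtain ⟨u, rfl, rfl⟩ := LinearPMap.mem_graph_iff _ |>.1 h1
    obtain ⟨v, hv, rfl⟩ := LinearPMap.mem_graph_iff _ |>.1 h2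
    have hmem : (u : E) ∈ (comp A B).domain := by
      refine ⟨⟨u, ?_, rfl⟩, u.2⟩
      change B u ∈ A.domain
      simp only at hv
      rw [← hv]
      exact v.2
    refine LinearPMap.mem_graph_iff _ |>.2 ⟨⟨u, hmem⟩, rfl, ?_⟩
    change A _ = A v
    congr 1
    exact Subtype.ext hv.symm

/-- The powers `A ^ n` on their natural domains. -/
def pow (A : E →ₗ.[ℂ] E) : ℕ → E →ₗ.[ℂ] E
  | 0 => LinearMap.id.toPMap ⊤
  | n + 1 => comp A (pow A n)

/-- The part of `A` in the subspace `M`: the operator in the space `M` with domain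
`{x ∈ M ∩ D(A) : A x ∈ M}` that acts as `A`. -/
def part (M : Submodule ℂ E) (A : E →ₗ.[ℂ] E) : M →ₗ.[ℂ] M :=
  (A.graph.comap (M.subtype.prodMap M.subtype)).toLinearPMap

theorem mem_graph_part {M : Submodule ℂ E} {A : E →ₗ.[ℂ] E} {x y : M} :
    (x, y) ∈ (part M A).graph ↔ ((x : E), (y : E)) ∈ A.graph := by
  unfold part
  rw [Submodule.toLinearPMap_graph_eq]
  · rfl
  · rintro ⟨u, v⟩ h hu
    simp only at hu
    subst hu
    exact Subtype.ext (LinearPMap.graph_fst_eq_zero_snd A h rfl)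

/-- A symmetric operator is densely defined and satisfies `(A x, y) = (x, A y)` on its domain. -/
def IsSymmetric (A : E →ₗ.[ℂ] E) : Prop :=
  Dense (A.domain : Set E) ∧ A.IsFormalAdjoint A

/-- A symmetric operator without proper symmetric extensions. -/
def IsMaximalSymmetric (A : E →ₗ.[ℂ] E) : Prop :=
  IsSymmetric A ∧ ∀ A' : E →ₗ.[ℂ] E, IsSymmetric A' → A ≤ A' → A' = A

/-- The subspace `M` reduces `A`, that is `P A ⊆ A P` for the orthogonal projection `P` on `M`. -/
def Reduces (M : Submodule ℂ E) [M.HasOrthogonalProjection] (A : E →ₗ.[ℂ] E) : Prop :=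
  ∀ x y : E, (x, y) ∈ A.graph → (M.starProjection x, M.starProjection y) ∈ A.graph

/-- `A` is simple: its part in any nonzero (closed) reducing subspace fails to be self-adjoint. -/
def IsSimple (A : E →ₗ.[ℂ] E) : Prop :=
  ∀ (M : Submodule ℂ E) [CompleteSpace M], Reduces M A → M ≠ ⊥ → ¬ IsSelfAdjoint (part M A)

/-- The defect number of `A` in the upper half-plane vanishes: `ker (A* - i I) = {0}`. -/
def ZeroUpperDefect [CompleteSpace E] (A : E →ₗ.[ℂ] E) : Prop :=
  ∀ h : E, (h, Complex.I • h) ∈ A.adjoint.graph → h = 0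

end UnboundedOp

/-! ### The half-line: Sobolev functions, the momentum operator, shifts -/

namespace HalfLine

/-- `L_2(ℝ₊, V)`. -/
abbrev L2 (V : Type*) [NormedAddCommGroup V] : Type _ :=
  Lp V 2 (volume.restrict (Ioi (0 : ℝ)))

/-- `ℂ²` with its Euclidean inner product. -/
abbrev C2 : Type := EuclideanSpace ℂ (Fin 2)

variable {V : Type*} [NormedAddCommGroup V] [InnerProductSpace ℂ V]

/-- `u` is (a.e. equal to) a function that is absolutely continuous on bounded subintervals of
`[0, ∞)`, with boundary value `u(0+) = c` and derivative `v`. As `u` and `v` lie in `L_2`, this says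
that `u ∈ W_2^1(ℝ₊, V)`, `u(0) = c` and `u' = v`. -/
def HasDeriv (u v : L2 V) (c : V) : Prop :=
  ∀ᵐ x ∂(volume.restrict (Ioi (0 : ℝ))), u x = c + ∫ s in (0 : ℝ)..x, v s

theorem intervalIntegrable (v : L2 V) {x : ℝ} (hx : 0 < x) :
    IntervalIntegrable v volume 0 x := by
  rw [intervalIntegrable_iff_integrableOn_Ioc_of_le hx.le]
  have h : MemLp v 2 (volume.restrict (Ioc 0 x)) :=
    (Lp.memLp v).mono_measure (Measure.restrict_mono Ioc_subset_Ioi_self le_rfl)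
  exact h.integrable (by norm_num)

theorem intervalIntegral_congr {v w : ℝ → V}
    (h : v =ᵐ[volume.restrict (Ioi (0 : ℝ))] w) {x : ℝ} (hx : 0 < x) :
    ∫ s in (0 : ℝ)..x, v s = ∫ s in (0 : ℝ)..x, w s := by
  rw [intervalIntegral.integral_of_le hx.le, intervalIntegral.integral_of_le hx.le]
  exact integral_congr_ae (ae_restrict_of_ae_restrict_of_subset Ioc_subset_Ioi_self h)

theorem HasDeriv.zero : HasDeriv (0 : L2 V) 0 0 := by
  have h0 := Lp.coeFn_zero V 2 (volume.restrict (Ioi (0 : ℝ)))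
  filter_upwards [h0, ae_restrict_mem measurableSet_Ioi] with x hx hx0
  rw [hx, intervalIntegral_congr h0 hx0]
  simp

theorem HasDeriv.add {u v u' v' : L2 V} {c c' : V} (h : HasDeriv u v c) (h' : HasDeriv u' v' c') :
    HasDeriv (u + u') (v + v') (c + c') := by
  filter_upwards [h, h', Lp.coeFn_add u u', ae_restrict_mem measurableSet_Ioi] with x h1 h2 h3 hx
  rw [h3, intervalIntegral_congr (Lp.coeFn_add v v') hx, Pi.add_apply, h1, h2]
  simp only [Pi.add_apply]
  rw [intervalIntegral.integral_add (intervalIntegrable v hx) (intervalIntegrable v' hx)]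
  abel

theorem HasDeriv.smul (a : ℂ) {u v : L2 V} {c : V} (h : HasDeriv u v c) :
    HasDeriv (a • u) (a • v) (a • c) := by
  filter_upwards [h, Lp.coeFn_smul a u, ae_restrict_mem measurableSet_Ioi] with x h1 h3 hx
  rw [h3, intervalIntegral_congr (Lp.coeFn_smul a v) hx, Pi.smul_apply, h1]
  simp only [Pi.smul_apply]
  rw [intervalIntegral.integral_smul, smul_add]

/-- The boundary value and the derivative of a Sobolev function are unique. -/
theorem HasDeriv.eq_zero [CompleteSpace V] {v : L2 V} {c : V} (h : HasDeriv 0 v c) :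
    c = 0 ∧ v = 0 := by
  set w : ℝ → V := (Ioi (0 : ℝ)).indicator v with hw
  have hvw : v =ᵐ[volume.restrict (Ioi (0 : ℝ))] w :=
    (indicator_ae_eq_restrict measurableSet_Ioi).symm
  have hwL : MemLp w 2 volume := by
    rw [hw, memLp_indicator_iff_restrict measurableSet_Ioi]
    exact Lp.memLp v
  have hloc : LocallyIntegrable w volume := hwL.locallyIntegrable (by norm_num)
  have hii : ∀ a b : ℝ, IntervalIntegrable w volume a b := fun a b =>
    (hloc.integrableOn_isCompact isCompact_uIcc).intervalIntegrable
  set F : ℝ → V := fun x => c + ∫ s in (0 : ℝ)..x, w s with hF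
  have hFc : Continuous F := continuous_const.add (intervalIntegral.continuous_primitive hii 0)
  have hF0 : F =ᵐ[volume.restrict (Ioi (0 : ℝ))] fun _ => (0 : V) := by
    filter_upwards [h, Lp.coeFn_zero V 2 (volume.restrict (Ioi (0 : ℝ))),
      ae_restrict_mem measurableSet_Ioi] with x h1 h2 hx
    rw [h2, intervalIntegral_congr hvw hx] at h1
    exact h1.symm
  have hEq : EqOn F (fun _ => (0 : V)) (Ioi 0) :=
    Measure.eqOn_open_of_ae_eq hF0 isOpen_Ioi hFc.continuousOn continuousOn_const
  have hc : F 0 = 0 := by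
    have h1 : Tendsto F (𝓝[>] 0) (𝓝 (F 0)) := hFc.continuousAt.tendsto.mono_left inf_le_left
    have h2 : Tendsto F (𝓝[>] 0) (𝓝 0) := by
      refine tendsto_const_nhds.congr' ?_
      filter_upwards [self_mem_nhdsWithin] with x hx
      exact (hEq hx).symm
    exact tendsto_nhds_unique h1 h2
  refine ⟨by simpa [hF] using hc, ?_⟩
  rw [Lp.eq_zero_iff_ae_eq_zero]
  have hd := LocallyIntegrable.ae_hasDerivAt_integral hloc
  filter_upwards [ae_restrict_of_ae hd, hvw, ae_restrict_mem measurableSet_Ioi] with x h1 h2 hx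
  rw [h2]
  have h3 : HasDerivAt F (w x) x := (h1 0).const_add c
  have h4 : HasDerivAt F 0 x := by
    refine (hasDerivAt_const x (0 : V)).congr_of_eventuallyEq ?_
    filter_upwards [isOpen_Ioi.mem_nhds hx] with y hy
    exact hEq hy
  exact h3.unique h4

/-- The graph of the momentum operator: pairs `(u, i u')` with `u ∈ W_2^1(ℝ₊, V)`, `u(0) = 0`. -/
def momentumGraph (V : Type*) [NormedAddCommGroup V] [InnerProductSpace ℂ V] :
    Submodule ℂ (L2 V × L2 V) where
  carrier := {p | ∃ v : L2 V, HasDeriv p.1 v 0 ∧ p.2 = Complex.I • v}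
  zero_mem' := ⟨0, HasDeriv.zero, by simp⟩
  add_mem' := by
    rintro p p' ⟨v, h, e⟩ ⟨v', h', e'⟩
    exact ⟨v + v', by simpa using h.add h', by simp [e, e']⟩
  smul_mem' := by
    rintro a p ⟨v, h, e⟩
    exact ⟨a • v, by simpa using h.smul a, by rw [Prod.smul_snd, e, smul_comm]⟩

/-- The operator `i d/dx` in `L_2(ℝ₊, V)` with domain `{u ∈ W_2^1(ℝ₊, V) : u(0) = 0}`. -/
def momentum (V : Type*) [NormedAddCommGroup V] [InnerProductSpace ℂ V] : L2 V →ₗ.[ℂ] L2 V :=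
  (momentumGraph V).toLinearPMap

theorem mem_graph_momentum [CompleteSpace V] {u w : L2 V} :
    (u, w) ∈ (momentum V).graph ↔ ∃ v : L2 V, HasDeriv u v 0 ∧ w = Complex.I • v := by
  unfold momentum
  rw [Submodule.toLinearPMap_graph_eq]
  · rfl
  · rintro ⟨x, y⟩ ⟨v, h, e⟩ hx
    simp only at hx h e
    subst hx
    rw [e, h.eq_zero.2, smul_zero]

/-- The forward shift `T = (𝓑 - i I) (𝓑 + i I)⁻¹`, the Cayley transform of `𝓑 = i d/dx`. -/
def forwardShift (V : Type*) [NormedAddCommGroup V] [InnerProductSpace ℂ V] : L2 V →ₗ.[ℂ] L2 V :=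
  UnboundedOp.comp ((-Complex.I • LinearMap.id : L2 V →ₗ[ℂ] L2 V) +ᵥ momentum V)
    ((Complex.I • LinearMap.id : L2 V →ₗ[ℂ] L2 V) +ᵥ momentum V).inverse

/-- The backward shift `T*`. -/
def backwardShift (V : Type*) [NormedAddCommGroup V] [InnerProductSpace ℂ V] [CompleteSpace V] :
    L2 V →ₗ.[ℂ] L2 V :=
  (forwardShift V).adjoint

/-- The closed linear span of the vectors `(T*)ⁿ q`, `n ≥ 0`. -/
def cyclicSubspace [CompleteSpace V] (q : L2 V) : Submodule ℂ (L2 V) :=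
  (Submodule.span ℂ
    {f | ∃ n : ℕ, (q, f) ∈ (UnboundedOp.pow (backwardShift V) n).graph}).topologicalClosure

/-- `q` is non-cyclic for the backward shift `T*`. -/
def IsNonCyclic [CompleteSpace V] (q : L2 V) : Prop :=
  cyclicSubspace q ≠ ⊤

/-- The `i`-th component `q_i ∈ L_2(ℝ₊)` of `q ∈ L_2(ℝ₊, ℂ²)`. -/
def component (q : L2 C2) (i : Fin 2) : L2 ℂ :=
  (EuclideanSpace.proj i : C2 →L[ℂ] ℂ).compLp q

/-! ### The operators `H_{a q}` -/

/-- The graph of `H_{a q}`. For `f ∈ W_2^2(ℝ₊, ℂ²)`, with `f(0) = c`, `f' = f₁`, `f'(0) = d` and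
`f'' = f₂`, the boundary conditions are `[f]_s = c₀ - c₁ = 0` and `2 [f']_r = a [f]_r + (f, q)`,
where `[f]_r = (c₀ + c₁) / 2` and `2 [f']_r = d₀ + d₁`; the scalar product `(f, q)` is linear in `f`.
The value is `-f'' + [f]_r q`. -/
def nonlocalGraph (a : ℂ) (q : L2 C2) : Submodule ℂ (L2 C2 × L2 C2) where
  carrier := {p | ∃ (f₁ f₂ : L2 C2) (c d : C2), HasDeriv p.1 f₁ c ∧ HasDeriv f₁ f₂ d ∧
    c 0 - c 1 = 0 ∧ d 0 + d 1 = a * ((c 0 + c 1) / 2) + inner ℂ q p.1 ∧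
    p.2 = -f₂ + ((c 0 + c 1) / 2) • q}
  zero_mem' := ⟨0, 0, 0, 0, HasDeriv.zero, HasDeriv.zero, by simp, by simp, by simp⟩
  add_mem' := by
    rintro p p' ⟨f₁, f₂, c, d, h1, h2, h3, h4, h5⟩ ⟨f₁', f₂', c', d', h1', h2', h3', h4', h5'⟩
    refine ⟨f₁ + f₁', f₂ + f₂', c + c', d + d', h1.add h1', h2.add h2', ?_, ?_, ?_⟩
    · simp only [PiLp.add_apply]
      linear_combination h3 + h3'
    · simp only [PiLp.add_apply, Prod.fst_add, inner_add_right]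
      linear_combination h4 + h4'
    · simp only [PiLp.add_apply, Prod.snd_add, h5, h5']
      module
  smul_mem' := by
    rintro b p ⟨f₁, f₂, c, d, h1, h2, h3, h4, h5⟩
    refine ⟨b • f₁, b • f₂, b • c, b • d, h1.smul b, h2.smul b, ?_, ?_, ?_⟩
    · simp only [PiLp.smul_apply, smul_eq_mul]
      linear_combination b * h3
    · simp only [PiLp.smul_apply, smul_eq_mul, Prod.smul_fst, inner_smul_right]
      linear_combination b * h4
    · simp only [PiLp.smul_apply, smul_eq_mul, Prod.smul_snd, h5]
      module

/-- The operator `H_{a q}` in `L_2(ℝ₊, ℂ²)`. -/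
def nonlocalOp (a : ℂ) (q : L2 C2) : L2 C2 →ₗ.[ℂ] L2 C2 :=
  (nonlocalGraph a q).toLinearPMap

theorem graph_nonlocalOp (a : ℂ) (q : L2 C2) : (nonlocalOp a q).graph = nonlocalGraph a q := by
  refine Submodule.toLinearPMap_graph_eq _ ?_
  rintro ⟨x, y⟩ ⟨f₁, f₂, c, d, h1, h2, h3, h4, h5⟩ hx
  simp only at hx h1 h5
  subst hx
  obtain ⟨rfl, rfl⟩ := h1.eq_zero
  obtain ⟨rfl, rfl⟩ := h2.eq_zero
  simp [h5]

/-! ### Hardy space and inner functions -/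

/-- The open upper half-plane `ℂ₊`. -/
def upper : Set ℂ := {z | 0 < z.im}

/-- The Fourier transform `F f (z) = (2π)^{-1/2} ∫₀^∞ e^{i z s} f(s) ds` of `f ∈ L_2(ℝ₊, V)`, as a
function on `ℂ₊`; `F` maps `L_2(ℝ₊, V)` onto the Hardy space `H²(ℂ₊, V)`. -/
def hardyTransform (f : L2 V) (z : ℂ) : V :=
  ((Real.sqrt (2 * Real.pi) : ℂ))⁻¹ •
    ∫ s in Ioi (0 : ℝ), Complex.exp (Complex.I * z * s) • f s

theorem integrable_hardy (f : L2 V) {z : ℂ} (hz : z ∈ upper) :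
    IntegrableOn (fun s : ℝ => Complex.exp (Complex.I * z * s) • f s) (Ioi 0) := by
  have he : MemLp (fun s : ℝ => Complex.exp (Complex.I * z * s)) 2
      (volume.restrict (Ioi (0 : ℝ))) := by
    have hc : Continuous fun s : ℝ => Complex.exp (Complex.I * z * s) := by fun_prop
    rw [memLp_two_iff_integrable_sq_norm hc.aestronglyMeasurable]
    have h2 : (fun s : ℝ => ‖Complex.exp (Complex.I * z * s)‖ ^ 2)
        = fun s : ℝ => Real.exp (-(2 * z.im) * s) := by
      funext s
      rw [Complex.norm_exp, ← Real.exp_nat_mul]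
      congr 1
      simp
      ring
    rw [h2]
    have hpos : 0 < 2 * z.im := by
      have : 0 < z.im := hz
      linarith
    exact exp_neg_integrableOn_Ioi 0 hpos
  have h := (Lp.memLp f).smul (r := 1) he
  exact memLp_one_iff_integrable.1 h

theorem hardyTransform_add (f g : L2 V) {z : ℂ} (hz : z ∈ upper) :
    hardyTransform (f + g) z = hardyTransform f z + hardyTransform g z := by
  unfold hardyTransform
  rw [← smul_add, ← integral_add (integrable_hardy f hz) (integrable_hardy g hz)]
  congr 1
  refine integral_congr_ae ?_
  filter_upwards [Lp.coeFn_add f g] with s hs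
  rw [hs, Pi.add_apply, smul_add]

theorem hardyTransform_smul (a : ℂ) (f : L2 V) (z : ℂ) :
    hardyTransform (a • f) z = a • hardyTransform f z := by
  unfold hardyTransform
  rw [smul_comm a, ← integral_smul a (fun s : ℝ => Complex.exp (Complex.I * z * s) • f s)]
  congr 1
  refine integral_congr_ae ?_
  filter_upwards [Lp.coeFn_smul a f] with s hs
  rw [hs, Pi.smul_apply, smul_comm]

/-- An inner function: holomorphic and bounded on `ℂ₊`, with boundary values of modulus `1` almost
everywhere on `ℝ`. -/
def IsInner (φ : ℂ → ℂ) : Prop :=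
  DifferentiableOn ℂ φ upper ∧ (∃ C : ℝ, ∀ z ∈ upper, ‖φ z‖ ≤ C) ∧
  ∀ᵐ δ : ℝ, ∃ m : ℂ, ‖m‖ = 1 ∧
    Tendsto (fun y : ℝ => φ (δ + y * Complex.I)) (𝓝[>] 0) (𝓝 m)

/-- A `2 × 2` matrix inner function, in the sense of partial isometries: holomorphic and bounded
on `ℂ₊`, with boundary values `M` that satisfy `M* M = P` almost everywhere on `ℝ`, for a fixed
orthogonal projection `P` of `ℂ²`. -/
def IsMatrixInner (ψ : ℂ → Matrix (Fin 2) (Fin 2) ℂ) : Prop :=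
  (∀ i j, DifferentiableOn ℂ (fun z => ψ z i j) upper) ∧
  (∃ C : ℝ, ∀ z ∈ upper, ∀ i j, ‖ψ z i j‖ ≤ C) ∧
  ∃ P : Matrix (Fin 2) (Fin 2) ℂ, P.IsHermitian ∧ P * P = P ∧
    ∀ᵐ δ : ℝ, ∃ M : Matrix (Fin 2) (Fin 2) ℂ, M.conjTranspose * M = P ∧
      Tendsto (fun y : ℝ => ψ (δ + y * Complex.I)) (𝓝[>] 0) (𝓝 M)

/-- The graph of the operator `ψ(𝓑) = F⁻¹ ψ F` in `L_2(ℝ₊, ℂ²)`: the pairs `(f, g)` with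
`F g = ψ · F f` in the Hardy space. -/
def multiplierGraph (ψ : ℂ → Matrix (Fin 2) (Fin 2) ℂ) : Submodule ℂ (L2 C2 × L2 C2) where
  carrier := {p | ∀ z ∈ upper,
    hardyTransform p.2 z = (ψ z).toEuclideanLin (hardyTransform p.1 z)}
  zero_mem' := by
    intro z _
    have h : hardyTransform (0 : L2 C2) z = 0 := by
      simpa using hardyTransform_smul 0 (0 : L2 C2) z
    simp [h]
  add_mem' := by
    intro p p' h h' z hz
    simp only [Prod.fst_add, Prod.snd_add]
    rw [hardyTransform_add _ _ hz, hardyTransform_add _ _ hz, map_add, h z hz, h' z hz]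
  smul_mem' := by
    intro a p h z hz
    simp only [Prod.smul_fst, Prod.smul_snd]
    rw [hardyTransform_smul, hardyTransform_smul, map_smul, h z hz]

/-- The subspace `ψ(𝓑) L_2(ℝ₊, ℂ²)`. -/
def multiplierRange (ψ : ℂ → Matrix (Fin 2) (Fin 2) ℂ) : Submodule ℂ (L2 C2) :=
  (multiplierGraph ψ).map (LinearMap.snd ℂ (L2 C2) (L2 C2))

end HalfLine

end

/-!
The forward shift `T` is a pure isometry of `L_2(ℝ₊, ℂ²)`: on the Fourier side it is multiplication
by `(z - i) / (z + i)`, whose modulus is less than one on the upper half-plane and tends to one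
at the real axis. The momentum operator is its inverse Cayley transform `i (1 + T) (1 - T)⁻¹`.

Let `N` be a closed `T`-invariant subspace. If `(1 - T) g ∈ N` then `g ∈ N`, so the part of the
momentum operator in `N` is the inverse Cayley transform of the pure isometry `T|N`, and it has the
full domain `D(𝓑) ∩ N`. Everything about `B` follows from this: `B + i` maps onto `N`, which gives
maximality and the vanishing of the upper defect number; a reducing subspace in which `B` were
self-adjoint would be mapped onto itself by `T`; and `D(B²)` is the range of `(1 - T)²`, which is
dense. If moreover `N` is orthogonal to `q`, then the functions in `D(B²)` have vanishing boundary
values and vanishing scalar product with `q`, hence `H_{a q}` extends `B²`. The choice of `N` is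
the orthogonal complement of the cyclic subspace of `q` or, when some component of `q` is
non-cyclic, the direct sum of the corresponding complements for the two components.

It remains to write `N` as the range of a matrix inner function, which is the Beurling-Lax theorem.
Let `W = N ⊖ T N` be the wandering subspace; by the Wold decomposition the spaces `Tⁿ W` span `N`.
For `e ∈ W` the function `ψ_e = F e / F φ`, where `φ` is the wandering unit vector of `L_2(ℝ₊)`, is
bounded by `‖e‖` (`norm_wanderingSymbol_le`), so it has vertical limits almost everywhere by
Fatou's theorem (`ae_exists_tendsto`). Plancherel's theorem on the lines `Im z = y` gives, as
`y → 0`, that the mean of the squared norm of the limit with respect to the probability density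
`π⁻¹ (1 + δ²)⁻¹` is `‖e‖²`, so this norm equals `‖e‖` almost everywhere
(`ae_tendsto_wanderingSymbol`). By polarization, the limits of orthonormal wandering vectors are
orthonormal. In particular `W` has dimension at most two, and the matrix whose columns are `ψ_e` for
an orthonormal basis of `W`, padded with zeros, is inner; its range is `N`
(`multiplierRange_columnSymbol`).
-/

noncomputable section

/-! ### The Fourier transform of `L_2(ℝ₊, V)` on the upper half-plane -/

namespace HalfLine
open FourierTransform SchwartzMap

variable {V : Type*} [NormedAddCommGroup V] [InnerProductSpace ℂ V] [CompleteSpace V]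

/-- On `L_1 ∩ L_2` the `L_2` Fourier transform is the classical one: both have the same pairings with
test functions. -/
theorem fourier_toLp_ae_eq {g : ℝ → V} (h1 : Integrable g) (h2 : MemLp g 2) :
    (𝓕 (h2.toLp g) : Lp V 2 (volume : Measure ℝ)) =ᵐ[volume] 𝓕 g := by
  have hc : Continuous (𝓕 g) :=
    VectorFourier.fourierIntegral_continuous Real.continuous_fourierChar
      (by exact continuous_inner) h1
  refine ae_eq_of_integral_contDiff_smul_eq
    ((Lp.memLp _).locallyIntegrable (by norm_num)) hc.locallyIntegrable fun h hh hs => ?_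
  have hs' : HasCompactSupport (fun x => (h x : ℂ)) := hs.comp_left Complex.ofReal_zero
  have hh' : ContDiff ℝ ((⊤ : ℕ∞) : WithTop ℕ∞) (fun x => (h x : ℂ)) :=
    Complex.ofRealCLM.contDiff.comp hh
  set k : 𝓢(ℝ, ℂ) := hs'.toSchwartzMap hh' with hk
  have e1 := congrArg (fun d => d k) (Lp.fourier_toTemperedDistribution_eq (h2.toLp g))
  simp only [TemperedDistribution.fourier_apply, Lp.toTemperedDistribution_apply] at e1
  have e2 : ∫ x, (𝓕 k) x • g x = ∫ x, k x • 𝓕 g x := by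
    have := VectorFourier.integral_fourierIntegral_smul_eq_flip (L := innerₗ ℝ)
      Real.continuous_fourierChar continuous_inner (k.integrable (μ := volume)) h1
    simpa [SchwartzMap.fourier_coe] using! this
  have e3 : ∫ x, (𝓕 k) x • (h2.toLp g) x = ∫ x, (𝓕 k) x • g x := by
    refine integral_congr_ae ?_
    filter_upwards [h2.coeFn_toLp] with x hx
    rw [hx]
  rw [e3, e2] at e1
  have hkx : ∀ x, k x = (h x : ℂ) := fun x => rfl
  simp only [hkx] at e1
  simpa using e1.symm

theorem integral_norm_sq_fourier {g : ℝ → V} (h1 : Integrable g) (h2 : MemLp g 2) :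
    ∫ x, ‖𝓕 g x‖ ^ 2 = ∫ x, ‖g x‖ ^ 2 := by
  have key : ∀ f : Lp V 2 (volume : Measure ℝ), ∫ x, ‖f x‖ ^ 2 = ‖f‖ ^ 2 := by
    intro f
    have := L2.inner_def (𝕜 := ℂ) f f
    rw [inner_self_eq_norm_sq_to_K] at this
    have h3 : ((‖f‖ ^ 2 : ℝ) : ℂ) = ((∫ x, ‖f x‖ ^ 2 : ℝ) : ℂ) := by
      rw [← integral_complex_ofReal]
      simp only [Complex.ofReal_pow]
      refine this.trans (integral_congr_ae (.of_forall fun x => ?_))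
      exact inner_self_eq_norm_sq_to_K _
    exact_mod_cast h3.symm
  have a := key (h2.toLp g)
  have b := key (𝓕 (h2.toLp g))
  rw [Lp.norm_fourier_eq, ← a] at b
  calc _ = ∫ x, ‖(𝓕 (h2.toLp g) : Lp V 2 (volume : Measure ℝ)) x‖ ^ 2 := by
        refine integral_congr_ae ?_
        filter_upwards [fourier_toLp_ae_eq h1 h2] with x hx
        rw [hx]
    _ = _ := b
    _ = _ := by
        refine integral_congr_ae ?_
        filter_upwards [h2.coeFn_toLp] with x hx
        rw [hx]

theorem L2_norm_sq (f : L2 V) : ‖f‖ ^ 2 = ∫ s in Ioi (0 : ℝ), ‖f s‖ ^ 2 := by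
  have := L2.inner_def (𝕜 := ℂ) f f
  rw [inner_self_eq_norm_sq_to_K] at this
  have h3 : ((‖f‖ ^ 2 : ℝ) : ℂ) = ((∫ s in Ioi (0 : ℝ), ‖f s‖ ^ 2 : ℝ) : ℂ) := by
    rw [← integral_complex_ofReal]
    simp only [Complex.ofReal_pow]
    refine this.trans (integral_congr_ae (.of_forall fun x => ?_))
    exact inner_self_eq_norm_sq_to_K _
  exact_mod_cast h3

theorem L2_integrable_norm_sq (f : L2 V) : IntegrableOn (fun s => ‖f s‖ ^ 2) (Ioi (0 : ℝ)) :=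
  (memLp_two_iff_integrable_sq_norm (Lp.aestronglyMeasurable f)).1 (Lp.memLp f)

/-- On the horizontal line `Im z = y`, the function `F f` is a rescaled classical Fourier transform
of a function in `L_1 ∩ L_2`. -/
theorem exists_hardyTransform_eq_fourier (f : L2 V) {y : ℝ} (hy : 0 < y) :
    ∃ g : ℝ → V, Integrable g ∧ MemLp g 2 ∧
      (∀ δ : ℝ, hardyTransform f (δ + y * Complex.I)
        = ((Real.sqrt (2 * Real.pi) : ℂ))⁻¹ • 𝓕 g ((-(2 * Real.pi)⁻¹) * δ)) ∧
      ∫ x, ‖g x‖ ^ 2 = ∫ s in Ioi (0 : ℝ), Real.exp (-(2 * y * s)) * ‖f s‖ ^ 2 := by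
  set g : ℝ → V := (Ioi (0 : ℝ)).indicator (fun s => Real.exp (-(y * s)) • f s) with hg
  have h1 : Integrable g := by
    rw [hg, integrable_indicator_iff measurableSet_Ioi]
    have := integrable_hardy f (z := y * Complex.I) (by simpa [upper] using hy)
    refine this.congr (.of_forall fun s => ?_)
    simp only
    rw [show Complex.I * (y * Complex.I) * s = ((-(y * s) : ℝ) : ℂ) by
      push_cast; linear_combination (y * s : ℂ) * Complex.I_sq, ← Complex.ofReal_exp]
    exact Complex.coe_smul _ _
  have h2 : MemLp g 2 := by
    rw [hg, memLp_indicator_iff_restrict measurableSet_Ioi]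
    refine (Lp.memLp f).mono ?_ ?_
    · have he : AEStronglyMeasurable (fun s : ℝ => Real.exp (-(y * s)))
          (volume.restrict (Ioi (0 : ℝ))) := by fun_prop
      exact he.smul (Lp.aestronglyMeasurable f)
    · filter_upwards [ae_restrict_mem measurableSet_Ioi] with s hs
      rw [norm_smul, Real.norm_eq_abs, Real.abs_exp]
      refine mul_le_of_le_one_left (norm_nonneg _) ?_
      rw [Real.exp_le_one_iff]
      have : 0 < y * s := mul_pos hy hs
      linarith
  have h3 : ∀ δ : ℝ, hardyTransform f (δ + y * Complex.I)
      = ((Real.sqrt (2 * Real.pi) : ℂ))⁻¹ • 𝓕 g ((-(2 * Real.pi)⁻¹) * δ) := by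
    intro δ
    unfold hardyTransform
    congr 1
    rw [Real.fourier_real_eq_integral_exp_smul, ← integral_indicator measurableSet_Ioi]
    refine integral_congr_ae (.of_forall fun s => ?_)
    simp only [hg, indicator_apply]
    split_ifs with hs
    · rw [← Complex.coe_smul (Real.exp _) (f s), smul_smul, Complex.ofReal_exp, ← Complex.exp_add]
      congr 2
      push_cast
      have : (Real.pi : ℂ) ≠ 0 := by exact_mod_cast Real.pi_ne_zero
      field_simp
      linear_combination (y * s : ℂ) * Complex.I_sq
    · simp
  refine ⟨g, h1, h2, h3, ?_⟩
  rw [← integral_indicator measurableSet_Ioi]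
  refine integral_congr_ae (.of_forall fun s => ?_)
  simp only [hg, indicator_apply]
  split_ifs with hs
  · rw [norm_smul, mul_pow, Real.norm_eq_abs, Real.abs_exp, ← Real.exp_nat_mul]
    congr 2
    push_cast
    ring
  · simp

theorem integrable_norm_sq_hardyTransform (f : L2 V) {y : ℝ} (hy : 0 < y) :
    Integrable fun δ : ℝ => ‖hardyTransform f (δ + y * Complex.I)‖ ^ 2 := by
  obtain ⟨g, h1, h2, h3, -⟩ := exists_hardyTransform_eq_fourier f hy
  have h4 : MemLp (𝓕 g) 2 volume :=
    (memLp_congr_ae (fourier_toLp_ae_eq h1 h2)).1 (Lp.memLp _)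
  have h5 : Integrable fun x => ‖𝓕 g x‖ ^ 2 :=
    (memLp_two_iff_integrable_sq_norm h4.aestronglyMeasurable).1 h4
  simp only [h3, norm_smul, mul_pow]
  refine Integrable.const_mul (h5.comp_mul_left' ?_) _
  simp [Real.pi_ne_zero]

/-- **Plancherel's theorem** on the horizontal line `Im z = y`. -/
theorem integral_norm_sq_hardyTransform (f : L2 V) {y : ℝ} (hy : 0 < y) :
    ∫ δ : ℝ, ‖hardyTransform f (δ + y * Complex.I)‖ ^ 2
      = ∫ s in Ioi (0 : ℝ), Real.exp (-(2 * y * s)) * ‖f s‖ ^ 2 := by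
  obtain ⟨g, h1, h2, h3, h4⟩ := exists_hardyTransform_eq_fourier f hy
  simp only [h3, norm_smul, mul_pow]
  rw [integral_const_mul, Measure.integral_comp_mul_left (fun x => ‖𝓕 g x‖ ^ 2),
    integral_norm_sq_fourier h1 h2]
  have hpi : 0 < 2 * Real.pi := by positivity
  rw [h4, norm_inv, Complex.norm_real, Real.norm_eq_abs, abs_of_nonneg (Real.sqrt_nonneg _),
    inv_pow, Real.sq_sqrt hpi.le, inv_neg, inv_inv, abs_neg, abs_of_pos hpi, smul_eq_mul,
    ← mul_assoc, inv_mul_cancel₀ hpi.ne', one_mul]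

/-- The line integrals of `‖F f‖²` recover the norm of `f` at the boundary. -/
theorem tendsto_integral_norm_sq_hardyTransform (f : L2 V) :
    Tendsto (fun y : ℝ => ∫ δ : ℝ, ‖hardyTransform f (δ + y * Complex.I)‖ ^ 2) (𝓝[>] 0)
      (𝓝 (‖f‖ ^ 2)) := by
  have h : Tendsto (fun y : ℝ => ∫ s in Ioi (0 : ℝ), Real.exp (-(2 * y * s)) * ‖f s‖ ^ 2) (𝓝[>] 0)
      (𝓝 (∫ s in Ioi (0 : ℝ), ‖f s‖ ^ 2)) := by
    refine tendsto_integral_filter_of_dominated_convergence (fun s => ‖f s‖ ^ 2) ?_ ?_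
      (L2_integrable_norm_sq f) ?_
    · refine .of_forall fun y => ?_
      exact AEStronglyMeasurable.mul (by fun_prop) (L2_integrable_norm_sq f).aestronglyMeasurable
    · filter_upwards [self_mem_nhdsWithin] with y hy
      have hy : 0 < y := hy
      filter_upwards [ae_restrict_mem measurableSet_Ioi] with s hs
      have hs : 0 < s := hs
      rw [norm_mul, Real.norm_eq_abs, Real.abs_exp, norm_pow, norm_norm]
      refine mul_le_of_le_one_left (by positivity) ?_
      rw [Real.exp_le_one_iff]
      have := mul_pos hy hs
      linarith
    · refine .of_forall fun s => ?_
      refine Tendsto.mono_left ?_ nhdsWithin_le_nhds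
      exact Continuous.tendsto' (by fun_prop) _ _ (by simp)
  rw [L2_norm_sq]
  refine h.congr' ?_
  filter_upwards [self_mem_nhdsWithin] with y hy
  exact (integral_norm_sq_hardyTransform f hy).symm

theorem hardyTransform_zero (z : ℂ) : hardyTransform (0 : L2 V) z = 0 := by
  simpa using hardyTransform_smul 0 (0 : L2 V) z

theorem hardyTransform_sub (f g : L2 V) {z : ℂ} (hz : z ∈ upper) :
    hardyTransform (f - g) z = hardyTransform f z - hardyTransform g z := by
  have := hardyTransform_add (f - g) g hz
  rw [sub_add_cancel] at this
  rw [this, add_sub_cancel_right]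

/-- The Fourier transform is injective on `L_2(ℝ₊, V)`. -/
theorem eq_zero_of_hardyTransform {f : L2 V} (h : ∀ z ∈ upper, hardyTransform f z = 0) : f = 0 := by
  have h1 := integral_norm_sq_hardyTransform f one_pos
  have h2 : ∫ δ : ℝ, ‖hardyTransform f (δ + (1 : ℝ) * Complex.I)‖ ^ 2 = 0 := by
    rw [← integral_zero ℝ ℝ]
    refine integral_congr_ae (.of_forall fun δ => ?_)
    simp only [h (δ + (1 : ℝ) * Complex.I) (by simp [upper])]
    simp
  rw [h2, eq_comm, integral_eq_zero_iff_of_nonneg_ae] at h1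
  · rw [Lp.eq_zero_iff_ae_eq_zero]
    filter_upwards [h1] with s hs
    simpa [Real.exp_ne_zero] using hs
  · exact .of_forall fun s => by positivity
  · refine (L2_integrable_norm_sq f).mono' ?_ ?_
    · exact AEStronglyMeasurable.mul (by fun_prop) (L2_integrable_norm_sq f).aestronglyMeasurable
    · filter_upwards [ae_restrict_mem measurableSet_Ioi] with s hs
      have hs : 0 < s := hs
      rw [norm_mul, Real.norm_eq_abs, Real.abs_exp, norm_pow, norm_norm]
      refine mul_le_of_le_one_left (by positivity) ?_
      rw [Real.exp_le_one_iff]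
      linarith

theorem hardyTransform_injective {f g : L2 V}
    (h : ∀ z ∈ upper, hardyTransform f z = hardyTransform g z) : f = g := by
  rw [← sub_eq_zero]
  exact eq_zero_of_hardyTransform fun z hz => by rw [hardyTransform_sub _ _ hz, h z hz, sub_self]

theorem norm_exp_I_mul (z : ℂ) (s : ℝ) :
    ‖Complex.exp (Complex.I * z * s)‖ = Real.exp (-(z.im * s)) := by
  rw [Complex.norm_exp]
  congr 1
  simp

theorem integrable_exp_mul_norm (f : L2 V) {y : ℝ} (hy : 0 < y) :
    IntegrableOn (fun s => Real.exp (-(y * s)) * ‖f s‖) (Ioi (0 : ℝ)) := by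
  refine (integrable_hardy f (z := y * Complex.I) (by simpa [upper] using hy)).norm.congr
    (.of_forall fun s => ?_)
  simp [norm_smul, norm_exp_I_mul]

theorem differentiableOn_hardyTransform (f : L2 V) :
    DifferentiableOn ℂ (hardyTransform f) upper := by
  intro z₀ hz₀
  have hy : 0 < z₀.im := hz₀
  set y := z₀.im with hy0
  refine DifferentiableAt.differentiableWithinAt ?_
  unfold hardyTransform
  refine DifferentiableAt.const_smul ?_ _
  have hms : ∀ z : ℂ, AEStronglyMeasurable
      (fun s : ℝ => Complex.exp (Complex.I * z * s) • f s) (volume.restrict (Ioi (0 : ℝ))) := by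
    intro z
    have he : AEStronglyMeasurable (fun s : ℝ => Complex.exp (Complex.I * z * s))
        (volume.restrict (Ioi (0 : ℝ))) := by fun_prop
    exact he.smul (Lp.aestronglyMeasurable f)
  have h := hasDerivAt_integral_of_dominated_loc_of_deriv_le
    (μ := volume.restrict (Ioi (0 : ℝ))) (x₀ := z₀) (s := Metric.ball z₀ (y / 2))
    (F := fun z s => Complex.exp (Complex.I * z * s) • f s)
    (F' := fun z s => (Complex.exp (Complex.I * z * s) * (Complex.I * s)) • f s)
    (bound := fun s => (4 / y) * (Real.exp (-((y / 4) * s)) * ‖f s‖))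
    (Metric.ball_mem_nhds _ (by positivity)) (.of_forall hms) (integrable_hardy f hz₀) ?_ ?_ ?_ ?_
  · exact h.2.differentiableAt
  · have he : AEStronglyMeasurable (fun s : ℝ =>
        Complex.exp (Complex.I * z₀ * s) * (Complex.I * s))
        (volume.restrict (Ioi (0 : ℝ))) := by fun_prop
    exact he.smul (Lp.aestronglyMeasurable f)
  · filter_upwards [ae_restrict_mem measurableSet_Ioi] with s hs z hz
    have hs : 0 < s := hs
    have hzy : y / 2 ≤ z.im := by
      have h1 : |(z - z₀).im| < y / 2 :=
        (Complex.abs_im_le_norm _).trans_lt (by simpa [dist_eq_norm] using hz)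
      have h2 := (abs_lt.1 h1).1
      rw [Complex.sub_im] at h2
      linarith
    rw [norm_smul, norm_mul, norm_exp_I_mul, norm_mul, Complex.norm_I, one_mul, Complex.norm_real,
      Real.norm_eq_abs, abs_of_pos hs, ← mul_assoc]
    refine mul_le_mul_of_nonneg_right ?_ (norm_nonneg _)
    have h3 : y / 4 * s ≤ Real.exp (y / 4 * s) := by
      have := Real.add_one_le_exp (y / 4 * s)
      linarith
    have h4 : Real.exp (-(z.im * s)) ≤ Real.exp (-(y / 2 * s)) := by
      rw [Real.exp_le_exp]
      nlinarith
    have h5 : Real.exp (-(y / 2 * s)) * Real.exp (y / 4 * s) = Real.exp (-(y / 4 * s)) := by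
      rw [← Real.exp_add]
      congr 1
      ring
    calc Real.exp (-(z.im * s)) * s ≤ Real.exp (-(y / 2 * s)) * s := by gcongr
      _ = (4 / y) * (Real.exp (-(y / 2 * s)) * (y / 4 * s)) := by field_simp
      _ ≤ (4 / y) * (Real.exp (-(y / 2 * s)) * Real.exp (y / 4 * s)) := by gcongr
      _ = _ := by rw [h5]
  · exact (integrable_exp_mul_norm f (by positivity)).const_mul _
  · refine .of_forall fun s z _ => ?_
    refine HasDerivAt.smul_const ?_ _
    have h1 : HasDerivAt (fun z : ℂ => Complex.I * z * s) (Complex.I * s) z := by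
      simpa using ((hasDerivAt_id z).const_mul Complex.I).mul_const (s : ℂ)
    exact h1.cexp

/-- Point evaluations are bounded on the Hardy space. -/
theorem norm_hardyTransform_sq_le (f : L2 V) {z : ℂ} (hz : z ∈ upper) :
    ‖hardyTransform f z‖ ^ 2 ≤ ‖f‖ ^ 2 / (4 * Real.pi * z.im) := by
  have hy : 0 < z.im := hz
  set y := z.im with hy0
  have he2 : IntegrableOn (fun s : ℝ => Real.exp (-(2 * y) * s)) (Ioi 0) :=
    exp_neg_integrableOn_Ioi 0 (by positivity)
  have hsq : ∀ s : ℝ, Real.exp (-(y * s)) ^ 2 = Real.exp (-(2 * y) * s) := by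
    intro s
    rw [← Real.exp_nat_mul]
    congr 1
    push_cast
    ring
  have hmem : MemLp (fun s : ℝ => Real.exp (-(y * s))) 2 (volume.restrict (Ioi (0 : ℝ))) := by
    rw [memLp_two_iff_integrable_sq (by fun_prop)]
    simp only [hsq]
    exact he2
  have h1 : ‖∫ s in Ioi (0 : ℝ), Complex.exp (Complex.I * z * s) • f s‖
      ≤ ∫ s in Ioi (0 : ℝ), ‖Real.exp (-(y * s))‖ * ‖f s‖ := by
    refine (norm_integral_le_integral_norm _).trans_eq ?_
    refine integral_congr_ae (.of_forall fun s => ?_)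
    simp [norm_smul, norm_exp_I_mul, hy0]
  have h2 := integral_mul_norm_le_Lp_mul_Lq (μ := volume.restrict (Ioi (0 : ℝ)))
    (f := fun s : ℝ => Real.exp (-(y * s))) (g := fun s => ‖f s‖) Real.HolderConjugate.two_two
    (by simpa using hmem) (by simpa using (Lp.memLp f).norm)
  simp only [norm_norm, Real.rpow_two] at h2
  have h3 : ∫ s in Ioi (0 : ℝ), ‖Real.exp (-(y * s))‖ ^ 2 = (2 * y)⁻¹ := by
    have : ∀ s : ℝ, ‖Real.exp (-(y * s))‖ ^ 2 = Real.exp (-(2 * y) * s) := fun s => by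
      rw [Real.norm_eq_abs, Real.abs_exp, hsq]
    simp only [this]
    rw [integral_exp_mul_Ioi (by linarith) 0]
    simp
  rw [h3, ← L2_norm_sq, ← Real.sqrt_eq_rpow, ← Real.sqrt_eq_rpow, Real.sqrt_sq (norm_nonneg _)] at h2
  unfold hardyTransform
  rw [norm_smul, mul_pow, norm_inv, Complex.norm_real, Real.norm_eq_abs,
    abs_of_nonneg (Real.sqrt_nonneg _), inv_pow, Real.sq_sqrt (by positivity)]
  have h4 := pow_le_pow_left₀ (norm_nonneg _) (h1.trans h2) 2
  rw [mul_pow, Real.sq_sqrt (by positivity)] at h4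
  calc _ ≤ (2 * Real.pi)⁻¹ * ((2 * y)⁻¹ * ‖f‖ ^ 2) := by gcongr
    _ = _ := by field_simp; ring

/-- The evaluation functional `f ↦ F f(z)` at a point of the upper half-plane. -/
def hardyEval (V : Type*) [NormedAddCommGroup V] [InnerProductSpace ℂ V] [CompleteSpace V]
    {z : ℂ} (hz : z ∈ upper) : L2 V →L[ℂ] V :=
  LinearMap.mkContinuous
    { toFun := fun f => hardyTransform f z
      map_add' := fun f g => hardyTransform_add f g hz
      map_smul' := fun a f => hardyTransform_smul a f z }
    (Real.sqrt (4 * Real.pi * z.im)⁻¹) fun f => by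
      have hy : 0 < z.im := hz
      refine (sq_le_sq₀ (norm_nonneg _) (by positivity)).1 ?_
      rw [mul_pow, Real.sq_sqrt (by positivity)]
      refine (norm_hardyTransform_sq_le f hz).trans_eq ?_
      rw [div_eq_inv_mul]

@[simp] theorem hardyEval_apply {z : ℂ} (hz : z ∈ upper) (f : L2 V) :
    hardyEval V hz f = hardyTransform f z := rfl

theorem hardyTransform_compLp {W : Type*} [NormedAddCommGroup W] [InnerProductSpace ℂ W]
    [CompleteSpace W] (A : V →L[ℂ] W) (f : L2 V) {z : ℂ} (hz : z ∈ upper) :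
    hardyTransform (A.compLp f) z = A (hardyTransform f z) := by
  unfold hardyTransform
  rw [map_smul, ← ContinuousLinearMap.integral_comp_comm A (integrable_hardy f hz)]
  congr 1
  refine integral_congr_ae ?_
  filter_upwards [A.coeFn_compLp f] with s hs
  rw [hs, map_smul]

end HalfLine

/-! ### Fatou's theorem for the upper half-plane -/

namespace HalfLine
open Asymptotics

theorem isOpen_upper : IsOpen upper := isOpen_lt continuous_const Complex.continuous_im

theorem convex_upper : Convex ℝ upper := convex_halfSpace_im_gt 0

/-- A holomorphic function on the right half-plane with `Ψ w = O(w)` that is `o(w)` along the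
imaginary axis is `o(w)` at the origin. -/
theorem isLittleO_of_imaginary_axis {E : Type*} [NormedAddCommGroup E] [NormedSpace ℂ E]
    {Ψ : ℂ → E} {L : ℝ} (hL : ∀ w, ‖Ψ w‖ ≤ L * ‖w‖) (hc : Continuous Ψ)
    (hd : DifferentiableOn ℂ Ψ {w | 0 < w.re})
    (ho : (fun t : ℝ => Ψ (t * Complex.I)) =o[𝓝 0] fun t : ℝ => t) :
    Ψ =o[𝓝[{w | 0 < w.re}] 0] fun w => w := by
  have hL0 : 0 ≤ L := by simpa using (norm_nonneg _).trans (hL 1)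
  rw [isLittleO_iff]
  intro c hcpos
  set ε := c / 2 with hε
  have hεpos : 0 < ε := by positivity
  obtain ⟨r, hr, hr'⟩ := Metric.eventually_nhds_iff.1 (isLittleO_iff.1 ho hεpos)
  obtain ⟨N, hN⟩ := exists_nat_gt (L / ε)
  have hN2 : L ≤ ε * 2 ^ N := by
    have h1 : (N : ℝ) ≤ 2 ^ N := by exact_mod_cast Nat.lt_two_pow_self.le
    have h2 : L < N * ε := (div_lt_iff₀ hεpos).1 hN
    nlinarith
  have hone : ∀ w : ℂ, 0 ≤ w.re → 1 ≤ ‖1 + w / r‖ := by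
    intro w hw
    refine le_trans ?_ (Complex.re_le_norm _)
    rw [Complex.add_re, Complex.div_ofReal_re, Complex.one_re]
    have : 0 ≤ w.re / r := by positivity
    linarith
  -- the comparison factor `(1 + w / r)^(-2N)` is small on the imaginary axis away from `0`
  have key : ∀ η : ℝ, 0 < η → ∀ w : ℂ, 0 < w.re →
      ‖Ψ w‖ ≤ ε * (‖1 + w / r‖ ^ (2 * N) * ‖w + η‖) := by
    intro η hη w hw
    have hne : ∀ w : ℂ, 0 ≤ w.re → w + η ≠ 0 := by
      intro w hw h
      have := congrArg Complex.re h
      simp at this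
      linarith
    have hne' : ∀ w : ℂ, 0 ≤ w.re → (1 + w / r) ^ (2 * N) ≠ 0 := by
      intro w hw
      exact pow_ne_zero _ (norm_pos_iff.1 (one_pos.trans_le (hone w hw)))
    have hle : ∀ w : ℂ, 0 ≤ w.re → ‖w‖ ≤ ‖w + η‖ := by
      intro w hw
      rw [← sq_le_sq₀ (norm_nonneg _) (norm_nonneg _), Complex.sq_norm, Complex.sq_norm,
        Complex.normSq_apply, Complex.normSq_apply]
      simp
      nlinarith
    set G : ℂ → E := fun w => ((1 + w / r) ^ (2 * N))⁻¹ • ((w + η)⁻¹ • Ψ w) with hG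
    have hGn : ∀ w, ‖G w‖ = (‖1 + w / r‖ ^ (2 * N))⁻¹ * (‖w + η‖⁻¹ * ‖Ψ w‖) := by
      intro w
      simp [hG, norm_smul]
    have hq : ∀ w : ℂ, 0 ≤ w.re → ‖w + η‖⁻¹ * ‖Ψ w‖ ≤ L := by
      intro w hw
      rw [inv_mul_le_iff₀ (norm_pos_iff.2 (hne w hw)), mul_comm]
      exact (hL w).trans (mul_le_mul_of_nonneg_left (hle w hw) hL0)
    have hGb : ∀ w : ℂ, 0 ≤ w.re → ‖G w‖ ≤ L := by
      intro w hw
      rw [hGn]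
      refine (mul_le_of_le_one_left (by positivity) ?_).trans (hq w hw)
      exact inv_le_one_of_one_le₀ (one_le_pow₀ (hone w hw))
    have hmain : ‖G w‖ ≤ ε := by
      refine PhragmenLindelof.right_half_plane_of_bounded_on_real (f := G) ⟨?_, ?_⟩
        ⟨0, by norm_num, 0, ?_⟩ ?_ ?_ hw.le
      · intro w hw
        have hw' : 0 < w.re := hw
        refine DifferentiableWithinAt.smul ?_ (DifferentiableWithinAt.smul ?_ (hd w hw))
        · exact DifferentiableWithinAt.inv (by fun_prop) (hne' w hw'.le)
        · exact DifferentiableWithinAt.inv (by fun_prop) (hne w hw'.le)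
      · have hcl : closure {w : ℂ | 0 < w.re} ⊆ {w | 0 ≤ w.re} :=
          closure_minimal (fun w (hw : 0 < w.re) => hw.le)
            (isClosed_le continuous_const Complex.continuous_re)
        refine ContinuousOn.smul ?_ (ContinuousOn.smul ?_ hc.continuousOn)
        · exact ContinuousOn.inv₀ (by fun_prop) fun w hw => hne' w (hcl hw)
        · exact ContinuousOn.inv₀ (by fun_prop) fun w hw => hne w (hcl hw)
      · refine IsBigO.of_bound L ?_
        refine eventually_inf_principal.2 (.of_forall fun w (hw : 0 < w.re) => ?_)
        simpa using hGb w hw.le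
      · refine isBoundedUnder_of_eventually_le (a := L) ?_
        filter_upwards [eventually_ge_atTop 0] with x hx
        exact hGb x (by simpa using hx)
      · intro t
        have hre : (0 : ℝ) ≤ (t * Complex.I : ℂ).re := by simp
        rw [hGn]
        by_cases ht : |t| < r
        · have h1 : ‖Ψ (t * Complex.I)‖ ≤ ε * |t| := by
            simpa using hr' (y := t) (by simpa using ht)
          have h2 : |t| ≤ ‖(t * Complex.I : ℂ) + η‖ := by simpa using hle _ hre
          refine (mul_le_of_le_one_left (by positivity) ?_).trans
            (b := ‖(t * Complex.I : ℂ) + η‖⁻¹ * ‖Ψ (t * Complex.I)‖) ?_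
          · exact inv_le_one_of_one_le₀ (one_le_pow₀ (hone _ hre))
          · rw [inv_mul_le_iff₀ (norm_pos_iff.2 (hne _ hre))]
            refine h1.trans ?_
            rw [mul_comm ε]
            gcongr
        · rw [not_lt] at ht
          have h1 : (2 : ℝ) ^ N ≤ ‖1 + (t * Complex.I : ℂ) / r‖ ^ (2 * N) := by
            rw [pow_mul]
            refine pow_le_pow_left₀ (by norm_num) ?_ N
            rw [Complex.sq_norm, Complex.normSq_apply]
            simp only [Complex.add_re, Complex.div_ofReal_re, Complex.add_im,
              Complex.div_ofReal_im]
            simp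
            have : 1 ≤ |t| / r := (one_le_div hr).2 ht
            have h3 : t / r * (t / r) = (|t| / r) ^ 2 := by
              rw [div_pow, sq_abs]; ring
            rw [h3]
            nlinarith
          rw [inv_mul_le_iff₀ (lt_of_lt_of_le (by positivity) h1)]
          calc _ ≤ L := hq _ hre
            _ ≤ ε * 2 ^ N := hN2
            _ ≤ _ := by rw [mul_comm]; gcongr
    have hp1 : 0 < ‖1 + w / r‖ ^ (2 * N) := pow_pos (one_pos.trans_le (hone w hw.le)) _
    have hp2 : 0 < ‖w + η‖ := norm_pos_iff.2 (hne w hw.le)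
    rw [hGn, inv_mul_le_iff₀ hp1, inv_mul_le_iff₀ hp2] at hmain
    linarith
  have key' : ∀ w : ℂ, 0 < w.re → ‖Ψ w‖ ≤ ε * (‖1 + w / r‖ ^ (2 * N) * ‖w‖) := by
    intro w hw
    have hT : Tendsto (fun η : ℝ => ε * (‖1 + w / r‖ ^ (2 * N) * ‖w + η‖)) (𝓝[>] 0)
        (𝓝 (ε * (‖1 + w / r‖ ^ (2 * N) * ‖w‖))) := by
      refine Tendsto.mono_left ?_ nhdsWithin_le_nhds
      exact Continuous.tendsto' (by fun_prop) _ _ (by simp)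
    refine ge_of_tendsto hT ?_
    filter_upwards [self_mem_nhdsWithin] with η hη
    exact key η hη w hw
  have hT : Tendsto (fun w : ℂ => ‖1 + w / r‖ ^ (2 * N)) (𝓝 0) (𝓝 1) :=
    Continuous.tendsto' (by fun_prop) _ _ (by simp)
  filter_upwards [self_mem_nhdsWithin,
    nhdsWithin_le_nhds (hT.eventually (ge_mem_nhds (by norm_num : (1 : ℝ) < 2)))] with w hw hw2
  calc _ ≤ ε * (‖1 + w / r‖ ^ (2 * N) * ‖w‖) := key' w hw
    _ ≤ ε * (2 * ‖w‖) := by gcongr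
    _ = c * ‖w‖ := by rw [hε]; ring

/-- If `Φ` is Lipschitz and holomorphic on the upper half-plane, then `Φ'` has a vertical limit at
every point of the real axis where the restriction of `Φ` to the axis is differentiable. -/
theorem tendsto_deriv_of_hasDerivAt {E : Type*} [NormedAddCommGroup E] [NormedSpace ℂ E]
    {Φ : ℂ → E} {K : NNReal} (hK : LipschitzWith K Φ) (hd : DifferentiableOn ℂ Φ upper)
    {x : ℝ} {m : E} (hm : HasDerivAt (fun t : ℝ => Φ t) m x) :
    Tendsto (fun y : ℝ => deriv Φ (x + y * Complex.I)) (𝓝[>] 0) (𝓝 m) := by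
  set Ψ : ℂ → E := fun w => Φ (x + w * Complex.I) - Φ x - (w * Complex.I) • m with hΨ
  have hmaps : MapsTo (fun w : ℂ => (x : ℂ) + w * Complex.I) {w | 0 < w.re} upper := by
    intro w hw
    simpa [upper] using hw
  have hdΨ : DifferentiableOn ℂ Ψ {w | 0 < w.re} := by
    refine DifferentiableOn.sub (DifferentiableOn.sub_const ?_ _) ?_
    · exact hd.comp (by fun_prop) hmaps
    · fun_prop
  have hlo := isLittleO_of_imaginary_axis (Ψ := Ψ) (L := K + ‖m‖) ?_ ?_ hdΨ ?_
  · have hopen : IsOpen {w : ℂ | 0 < w.re} := isOpen_lt continuous_const Complex.continuous_re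
    have hderiv : ∀ y : ℝ, 0 < y →
        deriv Ψ y = Complex.I • (deriv Φ (x + y * Complex.I) - m) := by
      intro y hy
      have h1 : HasDerivAt Φ (deriv Φ (x + y * Complex.I)) (x + y * Complex.I) :=
        (hd.differentiableAt (isOpen_upper.mem_nhds (by simpa [upper] using hy))).hasDerivAt
      have h2 : HasDerivAt (fun w : ℂ => (x : ℂ) + w * Complex.I) Complex.I (y : ℂ) := by
        simpa using ((hasDerivAt_id (y : ℂ)).mul_const Complex.I).const_add (x : ℂ)
      have h3 : HasDerivAt (fun w : ℂ => (w * Complex.I) • m) (Complex.I • m) (y : ℂ) := by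
        simpa using ((hasDerivAt_id (y : ℂ)).mul_const Complex.I).smul_const m
      have h4 := ((h1.scomp (y : ℂ) h2).sub_const (Φ x)).sub h3
      rw [smul_sub]
      exact h4.deriv
    have hz : Tendsto (fun y : ℝ => deriv Ψ y) (𝓝[>] 0) (𝓝 0) := by
      rw [Metric.tendsto_nhds]
      intro ε hε
      obtain ⟨ρ, hρ, hb⟩ := Metric.mem_nhdsWithin_iff.1
        (isLittleO_iff.1 hlo (show 0 < ε / 4 by positivity))
      filter_upwards [Ioo_mem_nhdsGT (show (0 : ℝ) < ρ / 2 by positivity)] with y hy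
      have hy0 : 0 < y := hy.1
      have hre : ∀ w ∈ Metric.closedBall (y : ℂ) (y / 2), 0 < w.re := by
        intro w hw
        have h1 : |(w - y).re| ≤ y / 2 :=
          (Complex.abs_re_le_norm _).trans (by simpa [dist_eq_norm] using hw)
        have h2 := (abs_le.1 h1).1
        simp at h2
        linarith
      have h := Complex.norm_deriv_le_of_forall_mem_sphere_norm_le (f := Ψ) (c := (y : ℂ))
        (R := y / 2) (C := ε / 4 * (3 / 2 * y)) (by positivity) ?_ ?_
      · rw [dist_zero_right]
        refine h.trans_lt ?_
        rw [show ε / 4 * (3 / 2 * y) / (y / 2) = ε * (3 / 4) by field_simp]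
        linarith
      · refine (hdΨ.mono ?_).diffContOnCl
        rw [closure_ball _ (by positivity)]
        exact hre
      · intro w hw
        have hw' : ‖w - y‖ = y / 2 := by simpa [dist_eq_norm] using hw
        have hwn : ‖w‖ ≤ 3 / 2 * y := by
          calc ‖w‖ = ‖(w - y) + y‖ := by rw [sub_add_cancel]
            _ ≤ ‖w - y‖ + ‖(y : ℂ)‖ := norm_add_le _ _
            _ = 3 / 2 * y := by
              rw [hw', Complex.norm_real, Real.norm_eq_abs, abs_of_pos hy0]; ring
        have hlt : 3 / 2 * y < ρ := by
          have := hy.2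
          linarith
        refine (hb (⟨by simpa using hwn.trans_lt hlt, hre w (Metric.sphere_subset_closedBall hw)⟩ :
          w ∈ Metric.ball 0 ρ ∩ {w : ℂ | 0 < w.re})).trans ?_
        gcongr
    have h5 : Tendsto (fun y : ℝ => m + (-Complex.I) • deriv Ψ y) (𝓝[>] 0) (𝓝 m) := by
      simpa using (hz.const_smul (-Complex.I)).const_add m
    refine h5.congr' ?_
    filter_upwards [self_mem_nhdsWithin] with y hy
    rw [hderiv y hy, smul_smul]
    simp
  · intro w
    have h1 := hK.dist_le_mul (x + w * Complex.I) x
    rw [dist_eq_norm, dist_eq_norm] at h1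
    calc _ ≤ ‖Φ (x + w * Complex.I) - Φ x‖ + ‖(w * Complex.I) • m‖ := norm_sub_le _ _
      _ ≤ K * ‖w‖ + ‖w‖ * ‖m‖ := by
        gcongr
        · simpa using h1
        · simp [norm_smul]
      _ = _ := by ring
  · have := hK.continuous
    fun_prop
  · have h1 := (hasDerivAt_iff_isLittleO_nhds_zero.1 hm).comp_tendsto
      (show Tendsto (fun t : ℝ => -t) (𝓝 0) (𝓝 0) by
        simpa using (continuous_neg (G := ℝ)).tendsto 0)
    refine (h1.congr (fun t => ?_) fun t => rfl).trans_isBigO ?_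
    · simp only [hΨ, Function.comp]
      have : (t : ℂ) * Complex.I * Complex.I = ((-t : ℝ) : ℂ) := by
        push_cast
        linear_combination (t : ℂ) * Complex.I_mul_I
      rw [this, Complex.coe_smul]
      push_cast
      rfl
    · exact (isBigO_refl _ _).neg_left

/-- **Fatou's theorem**: a bounded holomorphic function on the upper half-plane has vertical limits
at almost all points of the real axis. -/
theorem ae_exists_tendsto {E : Type*} [NormedAddCommGroup E] [NormedSpace ℂ E]
    [FiniteDimensional ℂ E] {f : ℂ → E} (hf : DifferentiableOn ℂ f upper) {C : ℝ}
    (hC : ∀ z ∈ upper, ‖f z‖ ≤ C) :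
    ∀ᵐ δ : ℝ, ∃ m, Tendsto (fun y : ℝ => f (δ + y * Complex.I)) (𝓝[>] 0) (𝓝 m) := by
  have : CompleteSpace E := FiniteDimensional.complete ℂ E
  have : FiniteDimensional ℝ E := FiniteDimensional.trans ℝ ℂ E
  obtain ⟨Φ₀, hΦ₀⟩ := convex_upper.exists_forall_hasDerivWithinAt hf
  have hlip : LipschitzOnWith C.toNNReal Φ₀ upper := by
    refine convex_upper.lipschitzOnWith_of_nnnorm_hasDerivWithin_le (f' := f) hΦ₀ fun z hz => ?_
    rw [← norm_toNNReal]
    exact Real.toNNReal_le_toNNReal (hC z hz)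
  obtain ⟨Φ, hΦ, heq⟩ := hlip.extend_finite_dimension
  have hΦd : ∀ z ∈ upper, HasDerivAt Φ (f z) z := fun z hz =>
    (((hΦ₀ z hz).congr (fun w hw => (heq hw).symm) (heq hz).symm)).hasDerivAt
      (isOpen_upper.mem_nhds hz)
  have hre : LipschitzWith _ (fun t : ℝ => Φ t) :=
    hΦ.comp (LipschitzWith.of_dist_le_mul (K := 1) fun s t => by simp [dist_eq_norm, ← Complex.ofReal_sub])
  filter_upwards [hre.ae_differentiableAt_real] with x hx
  refine ⟨_, (tendsto_deriv_of_hasDerivAt hΦ (fun z hz =>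
    (hΦd z hz).differentiableAt.differentiableWithinAt) hx.hasDerivAt).congr' ?_⟩
  filter_upwards [self_mem_nhdsWithin] with y hy
  exact (hΦd _ (by simpa [upper] using hy)).deriv

end HalfLine

/-! ### The Fourier transform of a derivative and the equation `w' + w = h` -/

namespace HalfLine

variable {V : Type*} [NormedAddCommGroup V] [InnerProductSpace ℂ V] [CompleteSpace V]

/-- Fubini's theorem on the triangle `0 < s < x`. -/
theorem integrable_and_integral_triangle {𝕜 E : Type*} [RCLike 𝕜] [NormedAddCommGroup E]
    [NormedSpace ℝ E] [NormedSpace 𝕜 E] [SMulCommClass ℝ 𝕜 E] [CompleteSpace E] {a : ℝ → 𝕜}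
    {w : ℝ → E}
    (ha : ∀ s : ℝ, 0 < s → IntegrableOn a (Ioi s))
    (ham : AEStronglyMeasurable a (volume.restrict (Ioi (0 : ℝ))))
    (hwm : AEStronglyMeasurable w (volume.restrict (Ioi (0 : ℝ))))
    (haw : IntegrableOn (fun s => (∫ x in Ioi s, ‖a x‖) * ‖w s‖) (Ioi (0 : ℝ))) :
    IntegrableOn (fun x => a x • ∫ s in (0 : ℝ)..x, w s) (Ioi (0 : ℝ)) ∧
    ∫ x in Ioi (0 : ℝ), a x • ∫ s in (0 : ℝ)..x, w s
      = ∫ s in Ioi (0 : ℝ), (∫ x in Ioi s, a x) • w s := by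
  set μ : Measure ℝ := volume.restrict (Ioi (0 : ℝ)) with hμ
  set K : ℝ → ℝ → E := fun x s => (Ioi s).indicator (fun x => a x • w s) x with hK
  have hrest : ∀ s : ℝ, 0 < s → (volume.restrict (Ioi (0 : ℝ))).restrict (Ioi s)
      = volume.restrict (Ioi s) := by
    intro s hs
    rw [Measure.restrict_restrict measurableSet_Ioi, inter_eq_left.2 (Ioi_subset_Ioi hs.le)]
  have hKx : ∀ s : ℝ, 0 < s → ∫ x, K x s ∂μ = (∫ x in Ioi s, a x) • w s := by
    intro s hs
    simp only [hK]
    rw [integral_indicator measurableSet_Ioi, hμ, hrest s hs, integral_smul_const]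
  have hKn : ∀ s : ℝ, 0 < s → ∫ x, ‖K x s‖ ∂μ = (∫ x in Ioi s, ‖a x‖) * ‖w s‖ := by
    intro s hs
    simp only [hK, norm_indicator_eq_indicator_norm]
    rw [integral_indicator measurableSet_Ioi, hμ, hrest s hs]
    simp only [norm_smul]
    rw [integral_mul_const]
  have hKs : ∀ x : ℝ, 0 < x → ∫ s, K x s ∂μ = a x • ∫ s in (0 : ℝ)..x, w s := by
    intro x hx
    have h1 : ∀ s, K x s = (Iio x).indicator (fun s => a x • w s) s := by
      intro s
      simp only [hK, indicator_apply, mem_Ioi, mem_Iio]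
    simp only [h1]
    rw [integral_indicator measurableSet_Iio, hμ, Measure.restrict_restrict measurableSet_Iio,
      integral_smul, intervalIntegral.integral_of_le hx.le, inter_comm, Ioi_inter_Iio,
      integral_Ioc_eq_integral_Ioo]
  have hmeas : AEStronglyMeasurable (Function.uncurry K) (μ.prod μ) := by
    have h1 : AEStronglyMeasurable (fun p : ℝ × ℝ => a p.1 • w p.2) (μ.prod μ) :=
      ham.comp_fst.smul hwm.comp_snd
    have h2 : MeasurableSet {p : ℝ × ℝ | p.2 < p.1} := measurableSet_lt measurable_snd measurable_fst
    exact h1.indicator h2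
  have hint : Integrable (Function.uncurry K) (μ.prod μ) := by
    rw [integrable_prod_iff' hmeas]
    constructor
    · filter_upwards [ae_restrict_mem measurableSet_Ioi] with s hs
      simp only [Function.uncurry_apply_pair, hK]
      rw [integrable_indicator_iff measurableSet_Ioi, IntegrableOn, hμ, hrest s hs]
      exact (ha s hs).smul_const _
    · refine haw.congr ?_
      filter_upwards [ae_restrict_mem measurableSet_Ioi] with s hs
      exact (hKn s hs).symm
  have hae : (fun x => ∫ s, K x s ∂μ) =ᵐ[μ] fun x => a x • ∫ s in (0 : ℝ)..x, w s := by
    filter_upwards [ae_restrict_mem measurableSet_Ioi] with x hx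
    exact hKs x hx
  refine ⟨hint.integral_prod_left.congr hae, ?_⟩
  rw [← integral_congr_ae hae, integral_integral_swap hint]
  refine integral_congr_ae ?_
  filter_upwards [ae_restrict_mem measurableSet_Ioi] with s hs
  exact hKx s hs

/-- The Fourier transform turns differentiation of functions vanishing at `0` into multiplication
by `-i z`. -/
theorem HasDeriv.hardyTransform_eq {u v : L2 V} (h : HasDeriv u v 0) {z : ℂ} (hz : z ∈ upper) :
    hardyTransform v z = (-(Complex.I * z)) • hardyTransform u z := by
  have hy : 0 < z.im := hz
  have hre : (Complex.I * z).re < 0 := by simpa using hy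
  have hz0 : Complex.I * z ≠ 0 := by
    intro h0
    rw [h0] at hre
    simp at hre
  have hexp : ∀ s : ℝ, ∫ x in Ioi s, ‖Complex.exp (Complex.I * z * x)‖
      = (z.im)⁻¹ * Real.exp (-(z.im * s)) := by
    intro s
    simp only [norm_exp_I_mul]
    have := integral_exp_mul_Ioi (a := -z.im) (by linarith) s
    simp only [neg_mul] at this
    rw [this]
    field_simp
  obtain ⟨-, h2⟩ := integrable_and_integral_triangle (𝕜 := ℂ)
    (a := fun x : ℝ => Complex.exp (Complex.I * z * x)) (w := v)
    (fun s _ => integrableOn_exp_mul_complex_Ioi hre s)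
    (by fun_prop) (Lp.aestronglyMeasurable v) (by
      simp only [hexp]
      simpa only [mul_assoc, IntegrableOn] using
        (integrable_exp_mul_norm v hy).const_mul (z.im)⁻¹)
  have h3 : ∫ x in Ioi (0 : ℝ), Complex.exp (Complex.I * z * x) • u x
      = ∫ x in Ioi (0 : ℝ), Complex.exp (Complex.I * z * x) • ∫ s in (0 : ℝ)..x, v s := by
    refine integral_congr_ae ?_
    filter_upwards [h] with x hx
    rw [hx, zero_add]
  have h4 : ∫ s in Ioi (0 : ℝ), (∫ x in Ioi s, Complex.exp (Complex.I * z * x)) • v s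
      = (-(Complex.I * z)⁻¹) • ∫ s in Ioi (0 : ℝ), Complex.exp (Complex.I * z * s) • v s := by
    rw [← integral_smul (-(Complex.I * z)⁻¹)
      (fun s : ℝ => Complex.exp (Complex.I * z * s) • v s)]
    refine integral_congr_ae (.of_forall fun s => ?_)
    simp only
    rw [integral_exp_mul_complex_Ioi hre, smul_smul]
    congr 1
    field_simp
  unfold hardyTransform
  rw [h3, h2, h4, smul_comm (-(Complex.I * z)) _, smul_smul (-(Complex.I * z)), neg_mul_neg,
    mul_inv_cancel₀ hz0, one_smul]

theorem aestronglyMeasurable_primitive {w : ℝ → V}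
    (hw : ∀ x : ℝ, 0 < x → IntervalIntegrable w volume 0 x) :
    AEStronglyMeasurable (fun x => ∫ s in (0 : ℝ)..x, w s) (volume.restrict (Ioi (0 : ℝ))) := by
  refine ContinuousOn.aestronglyMeasurable (fun x hx => ?_) measurableSet_Ioi
  have hx : 0 < x := hx
  have h1 := intervalIntegral.continuousOn_primitive_interval' (μ := volume) (f := w) (a := 0)
    (b₁ := 0) (b₂ := x + 1) (hw (x + 1) (by linarith)) left_mem_uIcc
  rw [uIcc_of_le (by linarith)] at h1
  exact (h1.continuousAt (Icc_mem_nhds hx (by linarith))).continuousWithinAt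

/-- The solution `w x = ∫₀ˣ e^{s - x} h(s) ds` of `w' + w = h`, `w(0) = 0`, as a function. -/
def expPrimitiveFun (h : ℝ → V) (x : ℝ) : V :=
  Real.exp (-x) • ∫ s in (0 : ℝ)..x, Real.exp s • h s

theorem intervalIntegrable_exp_smul (h : L2 V) {x : ℝ} (hx : 0 < x) :
    IntervalIntegrable (fun s => Real.exp s • h s) volume 0 x :=
  (intervalIntegrable h hx).continuousOn_smul Real.continuous_exp.continuousOn

theorem aestronglyMeasurable_expPrimitiveFun (h : L2 V) :
    AEStronglyMeasurable (expPrimitiveFun h) (volume.restrict (Ioi (0 : ℝ))) := by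
  have he : AEStronglyMeasurable (fun s : ℝ => Real.exp (-s))
      (volume.restrict (Ioi (0 : ℝ))) := by fun_prop
  exact he.smul (aestronglyMeasurable_primitive fun x hx => intervalIntegrable_exp_smul h hx)

theorem integral_exp_neg_Ioi' (s : ℝ) : ∫ x in Ioi s, Real.exp (-x) = Real.exp (-s) := by
  simpa using integral_exp_mul_Ioi (a := -1) (by norm_num) s

theorem integrableOn_exp_neg_Ioi (s : ℝ) : IntegrableOn (fun x : ℝ => Real.exp (-x)) (Ioi s) := by
  simpa using exp_neg_integrableOn_Ioi s one_pos

/-- Schur's test with the Cauchy-Schwarz inequality: `‖w‖² ≤ ∫₀ˣ e^{s - x} ‖h(s)‖² ds`. -/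
theorem norm_sq_expPrimitiveFun_le (h : L2 V) {x : ℝ} (hx : 0 < x) :
    ‖expPrimitiveFun h x‖ ^ 2 ≤ Real.exp (-x) * ∫ s in (0 : ℝ)..x, Real.exp s * ‖h s‖ ^ 2 := by
  have hm : AEStronglyMeasurable h (volume.restrict (Ioc 0 x)) :=
    (Lp.aestronglyMeasurable h).mono_measure (Measure.restrict_mono Ioc_subset_Ioi_self le_rfl)
  have hsq : ∀ s : ℝ, Real.exp (s / 2) ^ 2 = Real.exp s := by
    intro s
    rw [← Real.exp_nat_mul]
    congr 1
    push_cast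
    ring
  have h1 : ‖∫ s in (0 : ℝ)..x, Real.exp s • h s‖
      ≤ ∫ s in Ioc 0 x, ‖Real.exp (s / 2)‖ * ‖Real.exp (s / 2) • h s‖ := by
    rw [intervalIntegral.integral_of_le hx.le]
    refine (norm_integral_le_integral_norm _).trans_eq ?_
    refine integral_congr_ae (.of_forall fun s => ?_)
    simp only [norm_smul, Real.norm_eq_abs, Real.abs_exp]
    rw [← hsq]
    ring
  have hE : Continuous fun s : ℝ => Real.exp (s / 2) := by fun_prop
  have hI : IntegrableOn (fun s => ‖Real.exp (s / 2) • h s‖ ^ 2) (Ioc 0 x) := by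
    have h2 : IntegrableOn (fun s => ‖h s‖ ^ 2) (Ioc 0 x) :=
      (L2_integrable_norm_sq h).mono_set Ioc_subset_Ioi_self
    refine (h2.const_mul (Real.exp x)).mono' ((hE.aestronglyMeasurable.smul hm).norm.pow 2) ?_
    filter_upwards [ae_restrict_mem measurableSet_Ioc] with s hs
    rw [Real.norm_eq_abs, abs_of_nonneg (by positivity), norm_smul, mul_pow, Real.norm_eq_abs,
      Real.abs_exp, hsq]
    gcongr
    exact hs.2
  have h2 := integral_mul_norm_le_Lp_mul_Lq (μ := volume.restrict (Ioc 0 x))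
    (f := fun s : ℝ => Real.exp (s / 2)) (g := fun s => ‖Real.exp (s / 2) • h s‖)
    Real.HolderConjugate.two_two
    (by
      rw [ENNReal.ofReal_ofNat, memLp_two_iff_integrable_sq hE.aestronglyMeasurable]
      exact (hE.pow 2).integrableOn_Ioc)
    (by
      rw [ENNReal.ofReal_ofNat]
      exact ((memLp_two_iff_integrable_sq_norm (hE.aestronglyMeasurable.smul hm)).2 hI).norm)
  simp only [norm_norm, Real.rpow_two, ← Real.sqrt_eq_rpow] at h2
  have h3 : ∫ s in Ioc 0 x, ‖Real.exp (s / 2)‖ ^ 2 ≤ Real.exp x := by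
    simp only [Real.norm_eq_abs, Real.abs_exp, hsq]
    rw [← intervalIntegral.integral_of_le hx.le, integral_exp]
    simp
  have h4 : ∫ s in Ioc 0 x, ‖Real.exp (s / 2) • h s‖ ^ 2
      = ∫ s in (0 : ℝ)..x, Real.exp s * ‖h s‖ ^ 2 := by
    rw [intervalIntegral.integral_of_le hx.le]
    refine integral_congr_ae (.of_forall fun s => ?_)
    simp only [norm_smul, mul_pow, Real.norm_eq_abs, Real.abs_exp, hsq]
  have h5 := pow_le_pow_left₀ (norm_nonneg _) (h1.trans h2) 2
  rw [mul_pow, Real.sq_sqrt (by positivity), Real.sq_sqrt (by positivity), h4] at h5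
  have h6 : 0 ≤ ∫ s in (0 : ℝ)..x, Real.exp s * ‖h s‖ ^ 2 :=
    intervalIntegral.integral_nonneg hx.le fun s _ => by positivity
  unfold expPrimitiveFun
  rw [norm_smul, mul_pow, Real.norm_eq_abs, Real.abs_exp]
  calc _ ≤ Real.exp (-x) ^ 2 * (Real.exp x * ∫ s in (0 : ℝ)..x, Real.exp s * ‖h s‖ ^ 2) := by
        gcongr
        exact h5.trans (by gcongr)
    _ = _ := by
        rw [← mul_assoc, sq, mul_assoc (Real.exp (-x)), ← Real.exp_add]
        simp

theorem memLp_expPrimitiveFun (h : L2 V) :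
    MemLp (expPrimitiveFun h) 2 (volume.restrict (Ioi (0 : ℝ))) := by
  rw [memLp_two_iff_integrable_sq_norm (aestronglyMeasurable_expPrimitiveFun h)]
  have hm : AEStronglyMeasurable (fun s => Real.exp s * ‖h s‖ ^ 2)
      (volume.restrict (Ioi (0 : ℝ))) :=
    AEStronglyMeasurable.mul (by fun_prop) (L2_integrable_norm_sq h).aestronglyMeasurable
  obtain ⟨h1, -⟩ := integrable_and_integral_triangle (𝕜 := ℝ)
    (a := fun x : ℝ => Real.exp (-x)) (w := fun s => Real.exp s * ‖h s‖ ^ 2)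
    (fun s _ => integrableOn_exp_neg_Ioi s) (by fun_prop) hm (by
      refine (L2_integrable_norm_sq h).congr (.of_forall fun s => ?_)
      simp only [Real.norm_eq_abs, Real.abs_exp]
      rw [integral_exp_neg_Ioi', abs_of_nonneg (by positivity), ← mul_assoc, ← Real.exp_add]
      simp)
  refine Integrable.mono' h1 ((aestronglyMeasurable_expPrimitiveFun h).norm.pow 2) ?_
  filter_upwards [ae_restrict_mem measurableSet_Ioi] with x hx
  rw [Real.norm_eq_abs, abs_of_nonneg (by positivity)]
  exact norm_sq_expPrimitiveFun_le h hx

/-- The solution `w x = ∫₀ˣ e^{s - x} h(s) ds` of `w' + w = h`, `w(0) = 0`, in `L_2(ℝ₊, V)`. -/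
def expPrimitive (h : L2 V) : L2 V := (memLp_expPrimitiveFun h).toLp _

theorem hasDeriv_expPrimitive (h : L2 V) : HasDeriv (expPrimitive h) (h - expPrimitive h) 0 := by
  have hcoe := (memLp_expPrimitiveFun h).coeFn_toLp
  filter_upwards [hcoe, ae_restrict_mem measurableSet_Ioi] with x hx hx0
  have hx0 : 0 < x := hx0
  have hint := (intervalIntegrable h hx0)
  have hwm : AEStronglyMeasurable (fun s => Real.exp s • h s) (volume.restrict (Ioi (0 : ℝ))) := by
    have he : AEStronglyMeasurable (fun s : ℝ => Real.exp s)
        (volume.restrict (Ioi (0 : ℝ))) := by fun_prop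
    exact he.smul (Lp.aestronglyMeasurable h)
  set a : ℝ → ℝ := (Iic x).indicator fun t => Real.exp (-t) with ha
  have hai : ∀ s, IntegrableOn a (Ioi s) := fun s =>
    (integrableOn_exp_neg_Ioi s).indicator measurableSet_Iic
  have hzero : ∀ s, x ≤ s → ∫ t in Ioi s, a t = 0 := by
    intro s hs
    rw [← integral_zero ℝ ℝ (μ := volume.restrict (Ioi s))]
    refine setIntegral_congr_fun measurableSet_Ioi fun t (ht : s < t) => ?_
    have : ¬ t ≤ x := by linarith
    simp [ha, this]
  have hval : ∀ s, s ≤ x → ∫ t in Ioi s, a t = Real.exp (-s) - Real.exp (-x) := by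
    intro s hs
    rw [ha, integral_indicator measurableSet_Iic, Measure.restrict_restrict measurableSet_Iic,
      inter_comm, Ioi_inter_Iic, ← intervalIntegral.integral_of_le hs]
    simp
  have hanorm : ∀ t, ‖a t‖ = a t := by
    intro t
    simp only [ha, indicator_apply]
    split_ifs <;> simp
  obtain ⟨-, h2⟩ := integrable_and_integral_triangle (𝕜 := ℝ) (a := a)
    (w := fun s => Real.exp s • h s) (fun s _ => hai s) (hai 0).aestronglyMeasurable hwm (by
      have h3 : IntegrableOn (fun s => ‖h s‖) (Ioc 0 x) :=
        ((intervalIntegrable_iff_integrableOn_Ioc_of_le hx0.le).1 hint).norm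
      have h4 : IntegrableOn ((Ioc 0 x).indicator fun s => (1 - Real.exp (-x) * Real.exp s) * ‖h s‖)
          (Ioi 0) := by
        rw [IntegrableOn, integrable_indicator_iff measurableSet_Ioc, IntegrableOn,
          Measure.restrict_restrict measurableSet_Ioc, inter_eq_left.2 Ioc_subset_Ioi_self]
        refine IntegrableOn.continuousOn_mul_of_subset (K := Icc 0 x) ?_ h3 isCompact_Icc
          measurableSet_Ioc Ioc_subset_Icc_self
        fun_prop
      refine h4.congr ?_
      filter_upwards [ae_restrict_mem measurableSet_Ioi] with s hs
      have hs : 0 < s := hs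
      simp only [hanorm, indicator_apply, mem_Ioc, hs, true_and]
      split_ifs with hsx
      · rw [hval s hsx, norm_smul, Real.norm_eq_abs, Real.abs_exp, ← mul_assoc,
          sub_mul (Real.exp (-s)), ← Real.exp_add (-s), neg_add_cancel, Real.exp_zero]
      · rw [hzero s (not_le.1 hsx).le, zero_mul])
  have hL : ∫ t in Ioi (0 : ℝ), a t • ∫ s in (0 : ℝ)..t, Real.exp s • h s
      = ∫ t in (0 : ℝ)..x, expPrimitive h t := by
    rw [show ∫ t in (0 : ℝ)..x, expPrimitive h t = ∫ t in (0 : ℝ)..x, expPrimitiveFun h t from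
      intervalIntegral_congr hcoe hx0, intervalIntegral.integral_of_le hx0.le]
    have : ∀ t, a t • ∫ s in (0 : ℝ)..t, Real.exp s • h s
        = (Iic x).indicator (expPrimitiveFun h) t := by
      intro t
      simp only [ha, indicator_apply, expPrimitiveFun]
      split_ifs <;> simp
    simp only [this]
    rw [integral_indicator measurableSet_Iic, Measure.restrict_restrict measurableSet_Iic,
      inter_comm, Ioi_inter_Iic]
  have hR : ∫ s in Ioi (0 : ℝ), (∫ t in Ioi s, a t) • Real.exp s • h s
      = (∫ s in (0 : ℝ)..x, h s) - expPrimitiveFun h x := by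
    have h5 : ∀ s ∈ Ioi (0 : ℝ), (∫ t in Ioi s, a t) • Real.exp s • h s
        = (Iic x).indicator (fun s => h s - Real.exp (-x) • Real.exp s • h s) s := by
      intro s _
      simp only [indicator_apply, mem_Iic]
      split_ifs with hsx
      · rw [hval s hsx, sub_smul, smul_smul, ← Real.exp_add, neg_add_cancel, Real.exp_zero,
          one_smul]
      · rw [hzero s (not_le.1 hsx).le, zero_smul]
    rw [setIntegral_congr_fun measurableSet_Ioi h5, integral_indicator measurableSet_Iic,
      Measure.restrict_restrict measurableSet_Iic, inter_comm, Ioi_inter_Iic,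
      ← intervalIntegral.integral_of_le hx0.le]
    have h6 : IntervalIntegrable (fun s => Real.exp (-x) • Real.exp s • h s) volume 0 x :=
      (intervalIntegrable_exp_smul h hx0).smul _
    rw [intervalIntegral.integral_sub hint h6, intervalIntegral.integral_smul]
    rfl
  rw [hL, hR] at h2
  rw [intervalIntegral_congr (Lp.coeFn_sub h (expPrimitive h)) hx0]
  simp only [Pi.sub_apply]
  rw [intervalIntegral.integral_sub hint (intervalIntegrable _ hx0), h2, zero_add, sub_sub_cancel]
  exact hx

end HalfLine

/-! ### The forward shift and the momentum operator -/

namespace UnboundedOp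

variable {E : Type*} [NormedAddCommGroup E] [InnerProductSpace ℂ E]

theorem mem_graph_pow_toPMap (A : E →L[ℂ] E) (n : ℕ) {x y : E} :
    (x, y) ∈ (pow ((A : E →ₗ[ℂ] E).toPMap ⊤) n).graph ↔ y = (A ^ n) x := by
  induction n generalizing y with
  | zero =>
    rw [pow, LinearPMap.mem_graph_iff]
    simp [eq_comm]
  | succ n ih =>
    rw [pow, mem_graph_comp]
    simp only [ih, exists_eq_left]
    rw [LinearPMap.mem_graph_iff, pow_succ']
    simp [eq_comm]

end UnboundedOp

namespace HalfLine

variable {V : Type*} [NormedAddCommGroup V] [InnerProductSpace ℂ V] [CompleteSpace V]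

theorem one_sub_I_mul_ne_zero {z : ℂ} (hz : z ∈ upper) : 1 - Complex.I * z ≠ 0 := by
  have hy : 0 < z.im := hz
  intro h
  have := congrArg Complex.re h
  simp at this
  linarith

theorem add_I_ne_zero {z : ℂ} (hz : z ∈ upper) : z + Complex.I ≠ 0 := by
  have hy : 0 < z.im := hz
  intro h
  have := congrArg Complex.im h
  simp at this
  linarith

/-- On the Fourier side, the equation `w' + w = h`, `w(0) = 0` reads `(1 - i z) F w = F h`. -/
theorem eq_expPrimitive_iff {u h : L2 V} :
    u = expPrimitive h ↔
      ∀ z ∈ upper, (1 - Complex.I * z) • hardyTransform u z = hardyTransform h z := by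
  have key : ∀ z ∈ upper,
      (1 - Complex.I * z) • hardyTransform (expPrimitive h) z = hardyTransform h z := by
    intro z hz
    have := (hasDeriv_expPrimitive h).hardyTransform_eq hz
    rw [hardyTransform_sub _ _ hz, sub_eq_iff_eq_add] at this
    rw [this]
    module
  constructor
  · rintro rfl
    exact key
  · intro h1
    refine hardyTransform_injective fun z hz => ?_
    have := (h1 z hz).trans (key z hz).symm
    exact smul_right_injective V (one_sub_I_mul_ne_zero hz) this

theorem hardyTransform_expPrimitive (h : L2 V) {z : ℂ} (hz : z ∈ upper) :
    (1 - Complex.I * z) • hardyTransform (expPrimitive h) z = hardyTransform h z :=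
  eq_expPrimitive_iff.1 rfl z hz

/-- The symbol `(z - i) / (z + i)` of the forward shift. -/
def shiftSymbol (z : ℂ) : ℂ := (z - Complex.I) / (z + Complex.I)

theorem one_sub_norm_shiftSymbol_sq {z : ℂ} (hz : z ∈ upper) :
    1 - ‖shiftSymbol z‖ ^ 2 = 4 * z.im / ‖z + Complex.I‖ ^ 2 := by
  have h1 : ‖z + Complex.I‖ ^ 2 ≠ 0 := pow_ne_zero _ (norm_ne_zero_iff.2 (add_I_ne_zero hz))
  rw [shiftSymbol, norm_div, div_pow, eq_div_iff h1, sub_mul, div_mul_cancel₀ _ h1, Complex.sq_norm,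
    Complex.sq_norm, Complex.normSq_apply, Complex.normSq_apply]
  simp
  ring

theorem norm_shiftSymbol_lt_one {z : ℂ} (hz : z ∈ upper) : ‖shiftSymbol z‖ < 1 := by
  have hy : 0 < z.im := hz
  have h1 := one_sub_norm_shiftSymbol_sq hz
  have h2 : 0 < ‖z + Complex.I‖ := norm_pos_iff.2 (add_I_ne_zero hz)
  have h3 : 0 < 4 * z.im / ‖z + Complex.I‖ ^ 2 := by positivity
  rw [← sq_lt_one_iff₀ (norm_nonneg _)]
  linarith

theorem hardyTransform_sub_expPrimitive (h : L2 V) {z : ℂ} (hz : z ∈ upper) :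
    hardyTransform (h - (2 : ℂ) • expPrimitive h) z = shiftSymbol z • hardyTransform h z := by
  rw [hardyTransform_sub _ _ hz, hardyTransform_smul, ← hardyTransform_expPrimitive h hz, smul_smul,
    ← sub_smul]
  congr 1
  have := add_I_ne_zero hz
  rw [shiftSymbol]
  field_simp
  linear_combination (-2 * z) * Complex.I_sq

/-- The operator `h ↦ h - 2 w` is isometric, because its symbol `b` satisfies `1 - 4 y ≤ |b|² ≤ 1` on
the line `Im z = y`. -/
theorem norm_sub_expPrimitive (h : L2 V) : ‖h - (2 : ℂ) • expPrimitive h‖ = ‖h‖ := by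
  set k := h - (2 : ℂ) • expPrimitive h with hk
  have hh := tendsto_integral_norm_sq_hardyTransform h
  have hkk := tendsto_integral_norm_sq_hardyTransform k
  have h1 : ‖k‖ ^ 2 ≤ ‖h‖ ^ 2 := by
    refine le_of_tendsto_of_tendsto hkk hh ?_
    filter_upwards [self_mem_nhdsWithin] with y hy
    have hy : 0 < y := hy
    refine integral_mono (integrable_norm_sq_hardyTransform k hy)
      (integrable_norm_sq_hardyTransform h hy) fun δ => ?_
    have hz : (δ + y * Complex.I : ℂ) ∈ upper := by simpa [upper] using hy
    simp only
    rw [hk, hardyTransform_sub_expPrimitive h hz, norm_smul]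
    gcongr
    exact mul_le_of_le_one_left (norm_nonneg _) (norm_shiftSymbol_lt_one hz).le
  have h2 : ‖h‖ ^ 2 ≤ ‖k‖ ^ 2 := by
    have h3 : Tendsto (fun y : ℝ => (1 - 4 * y) *
        ∫ δ : ℝ, ‖hardyTransform h (δ + y * Complex.I)‖ ^ 2) (𝓝[>] 0) (𝓝 (‖h‖ ^ 2)) := by
      have : Tendsto (fun y : ℝ => 1 - 4 * y) (𝓝[>] 0) (𝓝 1) :=
        (Continuous.tendsto' (by fun_prop) _ _ (by simp)).mono_left nhdsWithin_le_nhds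
      simpa using this.mul hh
    refine le_of_tendsto_of_tendsto h3 hkk ?_
    filter_upwards [self_mem_nhdsWithin] with y hy
    have hy : 0 < y := hy
    rw [← integral_const_mul]
    refine integral_mono ((integrable_norm_sq_hardyTransform h hy).const_mul _)
      (integrable_norm_sq_hardyTransform k hy) fun δ => ?_
    have hz : (δ + y * Complex.I : ℂ) ∈ upper := by simpa [upper] using hy
    simp only
    rw [hk, hardyTransform_sub_expPrimitive h hz, norm_smul, mul_pow]
    gcongr
    have h4 := one_sub_norm_shiftSymbol_sq hz
    have h5 : 1 ≤ ‖(δ + y * Complex.I : ℂ) + Complex.I‖ ^ 2 := by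
      rw [Complex.sq_norm, Complex.normSq_apply]
      simp
      nlinarith
    have h6 : 4 * (δ + y * Complex.I : ℂ).im / ‖(δ + y * Complex.I : ℂ) + Complex.I‖ ^ 2
        ≤ 4 * y := by
      have : (δ + y * Complex.I : ℂ).im = y := by simp
      rw [this]
      exact div_le_self (by positivity) h5
    linarith
  exact (sq_eq_sq₀ (norm_nonneg _) (norm_nonneg _)).1 (le_antisymm h1 h2)

/-- The forward shift `h ↦ h - 2 ∫₀ˣ e^{s - x} h(s) ds` as an isometry of `L_2(ℝ₊, V)`. -/
def shift (V : Type*) [NormedAddCommGroup V] [InnerProductSpace ℂ V] [CompleteSpace V] :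
    L2 V →ₗᵢ[ℂ] L2 V where
  toFun h := h - (2 : ℂ) • expPrimitive h
  map_add' f g := hardyTransform_injective fun z hz => by
    simp only [hardyTransform_sub_expPrimitive _ hz, hardyTransform_add _ _ hz, smul_add]
  map_smul' a f := hardyTransform_injective fun z hz => by
    simp only [hardyTransform_sub_expPrimitive _ hz, hardyTransform_smul, RingHom.id_apply]
    rw [smul_comm]
  norm_map' := norm_sub_expPrimitive

theorem shift_apply (h : L2 V) : shift V h = h - (2 : ℂ) • expPrimitive h := rfl

theorem hardyTransform_shift (h : L2 V) {z : ℂ} (hz : z ∈ upper) :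
    hardyTransform (shift V h) z = shiftSymbol z • hardyTransform h z :=
  hardyTransform_sub_expPrimitive h hz

/-- The momentum operator is the inverse Cayley transform of the forward shift. -/
theorem mem_graph_momentum_iff_shift {u w : L2 V} :
    (u, w) ∈ (momentum V).graph ↔
      ∃ g, u = g - shift V g ∧ w = Complex.I • (g + shift V g) := by
  rw [mem_graph_momentum]
  constructor
  · rintro ⟨v, h, rfl⟩
    have hu : u = expPrimitive (u + v) := by
      refine eq_expPrimitive_iff.2 fun z hz => ?_
      rw [hardyTransform_add _ _ hz, h.hardyTransform_eq hz]
      module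
    have hg : u = (2 : ℂ) • expPrimitive ((2 : ℂ)⁻¹ • (u + v)) := by
      have : (2 : ℂ)⁻¹ • u = expPrimitive ((2 : ℂ)⁻¹ • (u + v)) := by
        refine eq_expPrimitive_iff.2 fun z hz => ?_
        rw [hardyTransform_smul, hardyTransform_smul, smul_comm, eq_expPrimitive_iff.1 hu z hz]
      rw [← this, smul_smul]
      norm_num
    refine ⟨(2 : ℂ)⁻¹ • (u + v), ?_, ?_⟩
    · rw [shift_apply, sub_sub_cancel]
      exact hg
    · rw [shift_apply, ← hg]
      congr 1
      module
  · rintro ⟨g, rfl, rfl⟩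
    refine ⟨g + shift V g, ?_, rfl⟩
    have := (hasDeriv_expPrimitive g).smul 2
    rw [smul_zero] at this
    convert this using 1
    · rw [shift_apply, sub_sub_cancel]
    · rw [shift_apply]
      module

theorem eq_zero_of_shift_eq_self {g : L2 V} (h : shift V g = g) : g = 0 := by
  refine eq_zero_of_hardyTransform fun z hz => ?_
  have h1 := hardyTransform_shift g hz
  rw [h] at h1
  by_contra h0
  have h2 : shiftSymbol z = 1 := by
    have h3 : (1 - shiftSymbol z) • hardyTransform g z = 0 := by
      rw [sub_smul, one_smul, ← h1, sub_self]
    have := (smul_eq_zero.1 h3).resolve_right h0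
    exact (sub_eq_zero.1 this).symm
  have := norm_shiftSymbol_lt_one hz
  rw [h2] at this
  simp at this

/-- The Cayley transform of the momentum operator is the everywhere defined operator `shift`. -/
theorem forwardShift_eq : forwardShift V = (shift V).toLinearMap.toPMap ⊤ := by
  have hplus : ∀ (c : ℂ) (x y : L2 V),
      (x, y) ∈ ((c • LinearMap.id : L2 V →ₗ[ℂ] L2 V) +ᵥ momentum V).graph ↔
        ∃ g, x = g - shift V g ∧ y = c • x + Complex.I • (g + shift V g) := by
    intro c x y
    rw [LinearPMap.mem_graph_iff]
    constructor
    · rintro ⟨u, rfl, rfl⟩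
      obtain ⟨g, h1, h2⟩ := mem_graph_momentum_iff_shift.1 (LinearPMap.mem_graph (momentum V) u)
      exact ⟨g, h1, by rw [LinearPMap.vadd_apply, h2]; rfl⟩
    · rintro ⟨g, h1, h2⟩
      obtain ⟨u, hu1, hu2⟩ := (LinearPMap.mem_graph_iff _).1
        (mem_graph_momentum_iff_shift.2 ⟨g, h1, rfl⟩)
      simp only at hu1 hu2
      refine ⟨u, hu1, ?_⟩
      rw [LinearPMap.vadd_apply, hu2, h2, ← hu1]
      rfl
  have hker : LinearMap.ker
      ((Complex.I • LinearMap.id : L2 V →ₗ[ℂ] L2 V) +ᵥ momentum V).toFun = ⊥ := by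
    rw [LinearMap.ker_eq_bot']
    intro u hu
    have h1 : ((u : L2 V), (0 : L2 V)) ∈
        ((Complex.I • LinearMap.id : L2 V →ₗ[ℂ] L2 V) +ᵥ momentum V).graph := by
      rw [← hu]
      exact LinearPMap.mem_graph _ u
    obtain ⟨g, h2, h3⟩ := (hplus _ _ _).1 h1
    have h4 : g = 0 := by
      have h5 : (2 * Complex.I) • g = 0 := by
        rw [h3, h2]
        module
      simpa using h5
    refine Subtype.ext ?_
    rw [h2, h4]
    simp
  refine LinearPMap.eq_of_eq_graph ?_
  ext ⟨x, y⟩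
  rw [forwardShift, UnboundedOp.mem_graph_comp, LinearPMap.inverse_graph hker]
  have hinv : ∀ u : L2 V, (x, u) ∈ (((Complex.I • LinearMap.id : L2 V →ₗ[ℂ] L2 V) +ᵥ
      momentum V).graph.map (LinearEquiv.prodComm ℂ (L2 V) (L2 V) : _ →ₗ[ℂ] _)) ↔
      (u, x) ∈ ((Complex.I • LinearMap.id : L2 V →ₗ[ℂ] L2 V) +ᵥ momentum V).graph := by
    intro u
    rw [Submodule.mem_map]
    constructor
    · rintro ⟨⟨p1, p2⟩, hp, he⟩
      obtain ⟨rfl, rfl⟩ := Prod.mk.inj he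
      exact hp
    · intro hp
      exact ⟨_, hp, rfl⟩
  have hrhs : (x, y) ∈ ((shift V).toLinearMap.toPMap ⊤).graph ↔ y = shift V x := by
    rw [LinearPMap.mem_graph_iff]
    simp [eq_comm]
  have h2I : ((2 : ℂ) * Complex.I) * ((2 : ℂ) * Complex.I)⁻¹ = 1 :=
    mul_inv_cancel₀ (by simp)
  rw [hrhs]
  constructor
  · rintro ⟨u, h1, h2⟩
    obtain ⟨g, h3, h4⟩ := (hplus _ _ _).1 ((hinv u).1 h1)
    obtain ⟨g', h5, h6⟩ := (hplus _ _ _).1 h2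
    have hgg : g - g' = 0 := by
      refine eq_zero_of_shift_eq_self ?_
      have h7 := h3.symm.trans h5
      rw [map_sub, ← sub_eq_zero]
      rw [← sub_eq_zero] at h7
      rw [← neg_eq_zero, ← h7]
      abel
    obtain rfl := sub_eq_zero.1 hgg
    have h8 : x = ((2 : ℂ) * Complex.I) • g := by
      rw [h4, h3]
      module
    rw [h8, map_smul, h6, h3]
    module
  · rintro rfl
    have hx : x = ((2 : ℂ) * Complex.I) • (((2 : ℂ) * Complex.I)⁻¹ • x) := by
      rw [smul_smul, h2I, one_smul]
    set g := ((2 : ℂ) * Complex.I)⁻¹ • x with hg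
    refine ⟨g - shift V g, (hinv _).2 ((hplus _ _ _).2 ⟨g, rfl, ?_⟩), (hplus _ _ _).2 ⟨g, rfl, ?_⟩⟩
    · refine hx.trans ?_
      module
    · rw [hx, map_smul]
      module

theorem mem_cyclicSubspace_set {q f : L2 V} {n : ℕ} :
    (q, f) ∈ (UnboundedOp.pow (backwardShift V) n).graph ↔
      f = ((shift V).toContinuousLinearMap.adjoint ^ n) q := by
  have h : backwardShift V
      = ((shift V).toContinuousLinearMap.adjoint : L2 V →ₗ[ℂ] L2 V).toPMap ⊤ := by
    rw [backwardShift, forwardShift_eq]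
    exact (shift V).toContinuousLinearMap.toPMap_adjoint_eq_adjoint_toPMap_of_dense (p := ⊤)
      (by simp)
  rw [h, UnboundedOp.mem_graph_pow_toPMap]

theorem mem_cyclicSubspace_self (q : L2 V) : q ∈ cyclicSubspace q :=
  Submodule.le_topologicalClosure _
    (Submodule.subset_span ⟨0, mem_cyclicSubspace_set.2 (by simp)⟩)

/-- The orthogonal complement of the cyclic subspace is invariant under the forward shift. -/
theorem shift_mem_cyclicSubspace_orthogonal {q f : L2 V} (hf : f ∈ (cyclicSubspace q)ᗮ) :
    shift V f ∈ (cyclicSubspace q)ᗮ := by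
  rw [cyclicSubspace, Submodule.orthogonal_closure] at hf ⊢
  have h1 : ∀ n : ℕ, inner ℂ (((shift V).toContinuousLinearMap.adjoint ^ n) q) f = 0 := fun n =>
    (Submodule.mem_orthogonal _ _).1 hf _ (Submodule.subset_span ⟨n, mem_cyclicSubspace_set.2 rfl⟩)
  rw [← Submodule.span_singleton_le_iff_mem, ← Submodule.isOrtho_iff_le, Submodule.isOrtho_span]
  rintro u rfl v ⟨n, hv⟩
  obtain rfl := mem_cyclicSubspace_set.1 hv
  have h2 := h1 (n + 1)
  rw [pow_succ', mul_apply_eq_comp, ContinuousLinearMap.adjoint_inner_left] at h2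
  rw [inner_eq_zero_symm]
  exact h2

end HalfLine

/-! ### Inverse Cayley transforms of pure isometries -/

namespace UnboundedOp

variable {E : Type*} [NormedAddCommGroup E] [InnerProductSpace ℂ E]

/-- `B` is the inverse Cayley transform `i (1 + T) (1 - T)⁻¹` of the isometry `T`. -/
def IsInverseCayley (T : E →ₗᵢ[ℂ] E) (B : E →ₗ.[ℂ] E) : Prop :=
  ∀ u w, (u, w) ∈ B.graph ↔ ∃ g, u = g - T g ∧ w = Complex.I • (g + T g)

/-- The isometry `T` has no unitary part: the ranges of its powers have trivial intersection. -/
def IsPureIsometry (T : E →ₗᵢ[ℂ] E) : Prop :=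
  ∀ f, (∀ n : ℕ, ∃ g, T^[n] g = f) → f = 0

variable {T : E →ₗᵢ[ℂ] E} {B : E →ₗ.[ℂ] E}

theorem IsPureIsometry.eq_zero_of_fixed (hT : IsPureIsometry T) {g : E} (h : T g = g) : g = 0 :=
  hT g fun n => ⟨g, Function.iterate_fixed h n⟩

/-- If `f` is orthogonal to `(1 - T) f`, then `‖f - T f‖² = ‖T f‖² - ‖f‖² = 0`. -/
theorem _root_.LinearIsometry.eq_of_inner_sub_eq_zero (T : E →ₗᵢ[ℂ] E) {f : E}
    (h : inner ℂ f (f - T f) = 0) : T f = f := by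
  have h1 : ‖f - T f‖ ^ 2 = 0 := by
    rw [inner_sub_right, sub_eq_zero] at h
    rw [@norm_sub_sq ℂ, ← h, T.norm_map, inner_self_eq_norm_sq]
    ring
  have h2 : f - T f = 0 := by simpa using h1
  exact (sub_eq_zero.1 h2).symm

theorem IsPureIsometry.dense_range_one_sub [CompleteSpace E] (hT : IsPureIsometry T) :
    DenseRange fun g => g - T g := by
  set R : Submodule ℂ E := LinearMap.range (LinearMap.id - T.toLinearMap) with hR
  have hRe : (R : Set E) = range fun g => g - T g := by
    ext x
    simp [hR]
  rw [DenseRange, ← hRe, Submodule.dense_iff_topologicalClosure_eq_top,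
    Submodule.topologicalClosure_eq_top_iff, Submodule.eq_bot_iff]
  intro f hf
  refine hT.eq_zero_of_fixed (T.eq_of_inner_sub_eq_zero ?_)
  rw [inner_eq_zero_symm]
  exact (Submodule.mem_orthogonal _ _).1 hf _ ⟨f, rfl⟩

namespace IsInverseCayley

theorem mem_domain_iff (hB : IsInverseCayley T B) {u : E} :
    u ∈ B.domain ↔ ∃ g, u = g - T g := by
  constructor
  · intro hu
    obtain ⟨g, h1, -⟩ := (hB _ _).1 (LinearPMap.mem_graph B ⟨u, hu⟩)
    exact ⟨g, h1⟩
  · rintro ⟨g, hg⟩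
    obtain ⟨v, hv, -⟩ := (LinearPMap.mem_graph_iff _).1 ((hB u _).2 ⟨g, hg, rfl⟩)
    simp only at hv
    rw [← hv]
    exact v.2

theorem inner_eq (hB : IsInverseCayley T B) {u w u' w' : E} (h : (u, w) ∈ B.graph)
    (h' : (u', w') ∈ B.graph) : inner ℂ w u' = inner ℂ u w' := by
  obtain ⟨g, rfl, rfl⟩ := (hB _ _).1 h
  obtain ⟨k, rfl, rfl⟩ := (hB _ _).1 h'
  simp only [inner_smul_left, inner_smul_right, inner_add_left, inner_sub_left, inner_add_right,
    inner_sub_right, T.inner_map_map, Complex.conj_I]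
  ring

theorem dense_domain [CompleteSpace E] (hB : IsInverseCayley T B) (hT : IsPureIsometry T) :
    Dense (B.domain : Set E) := by
  refine hT.dense_range_one_sub.mono ?_
  rintro _ ⟨g, rfl⟩
  exact hB.mem_domain_iff.2 ⟨g, rfl⟩

theorem isSymmetric [CompleteSpace E] (hB : IsInverseCayley T B) (hT : IsPureIsometry T) :
    IsSymmetric B := by
  refine ⟨hB.dense_domain hT, fun x y => ?_⟩
  exact hB.inner_eq (LinearPMap.mem_graph B x) (LinearPMap.mem_graph B y)

/-- The domain of `B²` is the range of `(1 - T)²`, which is dense like that of `1 - T`. -/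
theorem isSymmetric_comp_self [CompleteSpace E] (hB : IsInverseCayley T B)
    (hT : IsPureIsometry T) : IsSymmetric (comp B B) := by
  constructor
  · have hd := hT.dense_range_one_sub.comp hT.dense_range_one_sub
      (continuous_id.sub T.continuous)
    refine hd.mono ?_
    rintro _ ⟨g, rfl⟩
    have h1 : ((g - T g) - T (g - T g), Complex.I • ((g - T g) + T (g - T g))) ∈ B.graph :=
      (hB _ _).2 ⟨_, rfl, rfl⟩
    have h2 : (Complex.I • ((g - T g) + T (g - T g)),
        Complex.I • (Complex.I • (g + T g) + T (Complex.I • (g + T g)))) ∈ B.graph := by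
      refine (hB _ _).2 ⟨Complex.I • (g + T g), ?_, rfl⟩
      simp only [map_sub, map_smul, map_add]
      module
    obtain ⟨v, hv, -⟩ := (LinearPMap.mem_graph_iff _).1 (mem_graph_comp.2 ⟨_, h1, h2⟩)
    simp only at hv
    have := v.2
    rw [hv] at this
    exact this
  · intro x y
    obtain ⟨p, h1, h2⟩ := mem_graph_comp.1 (LinearPMap.mem_graph (comp B B) x)
    obtain ⟨p', h1', h2'⟩ := mem_graph_comp.1 (LinearPMap.mem_graph (comp B B) y)
    rw [hB.inner_eq h2 h1', hB.inner_eq h1 h2']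

/-- The range of `B + i` is the whole space. -/
theorem exists_add_I_smul_eq (hB : IsInverseCayley T B) (h : E) :
    ∃ u w, (u, w) ∈ B.graph ∧ w + Complex.I • u = h := by
  refine ⟨_, _, (hB _ _).2 ⟨(2 * Complex.I)⁻¹ • h, rfl, rfl⟩, ?_⟩
  rw [← smul_add]
  have : (2 * Complex.I)⁻¹ • h + T ((2 * Complex.I)⁻¹ • h)
      + ((2 * Complex.I)⁻¹ • h - T ((2 * Complex.I)⁻¹ • h))
      = (2 : ℂ) • (2 * Complex.I)⁻¹ • h := by
    module
  rw [this, smul_smul, smul_smul, mul_comm Complex.I, mul_inv_cancel₀ (by simp), one_smul]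

theorem _root_.UnboundedOp.eq_zero_of_eigenvalue {A : E →ₗ.[ℂ] E} (hA : A.IsFormalAdjoint A)
    {x : E} {c : ℂ} (hc : starRingEnd ℂ c ≠ c) (hx : (x, c • x) ∈ A.graph) : x = 0 := by
  obtain ⟨v, hv, hv'⟩ := (LinearPMap.mem_graph_iff _).1 hx
  simp only at hv hv'
  have h := hA v v
  rw [hv', hv, inner_smul_left, inner_smul_right, ← sub_eq_zero, ← sub_mul] at h
  exact inner_self_eq_zero.1 ((mul_eq_zero.1 h).resolve_left (sub_ne_zero.2 hc))

theorem isMaximalSymmetric [CompleteSpace E] (hB : IsInverseCayley T B) (hT : IsPureIsometry T) :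
    IsMaximalSymmetric B := by
  refine ⟨hB.isSymmetric hT, fun A hA hBA => ?_⟩
  refine le_antisymm ?_ hBA
  have hgr := LinearPMap.le_graph_of_le hBA
  refine LinearPMap.le_of_le_graph ?_
  rintro ⟨x, y⟩ hxy
  obtain ⟨u, w, huw, h⟩ := hB.exists_add_I_smul_eq (y + Complex.I • x)
  have h1 : (x - u, y - w) ∈ A.graph := A.graph.sub_mem hxy (hgr huw)
  have h2 : y - w = (-Complex.I) • (x - u) := by
    rw [eq_sub_of_add_eq h.symm]
    module
  have h3 : x - u = 0 := by
    rw [h2] at h1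
    refine eq_zero_of_eigenvalue hA.2 ?_ h1
    simp only [map_neg, Complex.conj_I]
    intro h0
    have := congrArg Complex.im h0
    norm_num at this
  rw [h3, smul_zero] at h2
  rw [sub_eq_zero.1 h3, sub_eq_zero.1 h2]
  exact huw

theorem zeroUpperDefect [CompleteSpace E] (hB : IsInverseCayley T B) (hT : IsPureIsometry T) :
    ZeroUpperDefect B := by
  intro h hh
  obtain ⟨k, hk, hk'⟩ := (LinearPMap.mem_graph_iff _).1 hh
  simp only at hk hk'
  obtain ⟨u, w, huw, he⟩ := hB.exists_add_I_smul_eq h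
  obtain ⟨v, hv, hv'⟩ := (LinearPMap.mem_graph_iff _).1 huw
  simp only at hv hv'
  have h1 := LinearPMap.adjoint_isFormalAdjoint (hB.dense_domain hT) k v
  rw [hk', hk, hv, hv', inner_smul_left, Complex.conj_I] at h1
  rw [← inner_self_eq_zero (𝕜 := ℂ) (x := h)]
  nth_rewrite 2 [← he]
  rw [inner_add_right, inner_smul_right, ← h1]
  ring

/-- A reducing subspace on which `B` were self-adjoint would be mapped onto itself by `T`, hence lie
in the unitary part of `T`. -/
theorem isSimple [CompleteSpace E] (hB : IsInverseCayley T B) (hT : IsPureIsometry T) :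
    IsSimple B := by
  intro M _ hM hM0 hsa
  have hcomm : ∀ g, M.starProjection (T g) = T (M.starProjection g) := by
    intro g
    have h1 := hM _ _ ((hB _ _).2 ⟨g, rfl, rfl⟩)
    obtain ⟨k, h2, h3⟩ := (hB _ _).1 h1
    simp only [map_sub, map_smul, map_add] at h2 h3
    have h3' := smul_right_injective E Complex.I_ne_zero h3
    have h4 : M.starProjection g = k := by
      have : (2 : ℂ) • M.starProjection g = (2 : ℂ) • k := by
        have h5 : (2 : ℂ) • M.starProjection g
            = (M.starProjection g - M.starProjection (T g))
              + (M.starProjection g + M.starProjection (T g)) := by module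
        rw [h5, h2, h3']
        module
      exact smul_right_injective E two_ne_zero this
    rw [h4] at h3' ⊢
    exact add_left_cancel h3'
  have hTM : ∀ g ∈ M, T g ∈ M := by
    intro g hg
    have h1 := hcomm g
    rw [Submodule.starProjection_eq_self_iff.2 hg] at h1
    exact Submodule.starProjection_eq_self_iff.1 h1
  have hsurj : ∀ f ∈ M, ∃ g ∈ M, T g = f := by
    set TM : M →ₗᵢ[ℂ] M := ⟨T.toLinearMap.restrict hTM, fun x => T.norm_map x⟩ with hTMdef
    have hTMc : ∀ x : M, ((TM x : M) : E) = T x := fun x => rfl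
    have hcl : IsClosed (range TM) := TM.isometry.isClosedEmbedding.isClosed_range
    set R : Submodule ℂ M := LinearMap.range TM.toLinearMap with hR
    have hRc : IsClosed (R : Set M) := by
      rw [hR, LinearMap.coe_range]
      exact hcl
    have hcomp : CompleteSpace R := hRc.completeSpace_coe
    suffices h : R = ⊤ by
      intro f hf
      have : (⟨f, hf⟩ : M) ∈ R := by rw [h]; trivial
      obtain ⟨g, hg⟩ := this
      exact ⟨g, g.2, congrArg Subtype.val hg⟩
    rw [← Submodule.orthogonal_eq_bot_iff, Submodule.eq_bot_iff]
    intro g hg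
    have horth : ∀ f : M, inner ℂ g (TM f) = 0 := fun f =>
      inner_eq_zero_symm.1 ((Submodule.mem_orthogonal _ _).1 hg _ ⟨f, rfl⟩)
    have hpart : ∀ u w : M, (u, w) ∈ (part M B).graph ↔
        ∃ f : M, u = f - TM f ∧ w = Complex.I • (f + TM f) := by
      intro u w
      rw [mem_graph_part, hB]
      constructor
      · rintro ⟨f, h1, h2⟩
        have hf : f ∈ M := by
          have : f = (2 : ℂ)⁻¹ • ((u : E) - Complex.I • (w : E)) := by
            rw [h1, h2, smul_smul, Complex.I_mul_I]
            module
          rw [this]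
          exact M.smul_mem _ (M.sub_mem u.2 (M.smul_mem _ w.2))
        exact ⟨⟨f, hf⟩, Subtype.ext h1, Subtype.ext h2⟩
      · rintro ⟨f, rfl, rfl⟩
        exact ⟨f, rfl, rfl⟩
    have hdense := hsa.dense_domain
    have hadj := (LinearPMap.isSelfAdjoint_def).1 hsa
    have hform : (part M B).IsFormalAdjoint (part M B) := by
      have := LinearPMap.adjoint_isFormalAdjoint hdense
      rwa [hadj] at this
    have hval : ∀ x : (part M B).domain, inner ℂ ((-Complex.I) • g) (x : M)
        = inner ℂ g (part M B x) := by
      intro x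
      obtain ⟨f, h1, h2⟩ := (hpart _ _).1 (LinearPMap.mem_graph (part M B) x)
      rw [h1, h2, inner_smul_left, inner_smul_right, inner_sub_right, inner_add_right, horth]
      simp
    have hmem : g ∈ (part M B).adjoint.domain :=
      LinearPMap.mem_adjoint_domain_of_exists g ⟨_, hval⟩
    have happ : (part M B).adjoint ⟨g, hmem⟩ = (-Complex.I) • g :=
      LinearPMap.adjoint_apply_eq hdense _ hval
    have hgr : (g, (-Complex.I) • g) ∈ (part M B).graph := by
      rw [← hadj]
      exact (LinearPMap.mem_graph_iff _).2 ⟨⟨g, hmem⟩, rfl, happ⟩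
    refine eq_zero_of_eigenvalue hform ?_ hgr
    simp only [map_neg, Complex.conj_I]
    intro h0
    have := congrArg Complex.im h0
    norm_num at this
  refine hM0 ((Submodule.eq_bot_iff _).2 fun f hf => hT f fun n => ?_)
  have : ∃ g ∈ M, T^[n] g = f := by
    induction n with
    | zero => exact ⟨f, hf, rfl⟩
    | succ n ih =>
      obtain ⟨g, hg, h1⟩ := ih
      obtain ⟨k, hk, rfl⟩ := hsurj g hg
      exact ⟨k, hk, h1⟩
  obtain ⟨g, -, h⟩ := this
  exact ⟨g, h⟩

end IsInverseCayley

/-- If `N` is invariant under the isometry `T` and `(1 - T) g ∈ N`, then `g ∈ N`. -/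
theorem mem_of_sub_mem [CompleteSpace E] (hT : IsPureIsometry T) {N : Submodule ℂ E}
    [CompleteSpace N] (hN : ∀ f ∈ N, T f ∈ N) {g : E} (hg : g - T g ∈ N) : g ∈ N := by
  set p := g - N.starProjection g with hp
  have hpo : p ∈ Nᗮ := Submodule.sub_starProjection_mem_orthogonal g
  have hx : p - T p ∈ N := by
    have h1 : p - T p = (g - T g) - (N.starProjection g - T (N.starProjection g)) := by
      rw [hp, map_sub]
      abel
    have h2 : N.starProjection g ∈ N := Submodule.starProjection_apply_mem _ _
    rw [h1]
    exact N.sub_mem hg (N.sub_mem h2 (hN _ h2))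
  have h0 : p = 0 :=
    hT.eq_zero_of_fixed (T.eq_of_inner_sub_eq_zero
      (inner_eq_zero_symm.1 ((Submodule.mem_orthogonal _ _).1 hpo _ hx)))
  rw [sub_eq_zero.1 h0]
  exact Submodule.starProjection_apply_mem _ _

/-- The part of an isometry in an invariant subspace. -/
def _root_.LinearIsometry.restrictInvariant (T : E →ₗᵢ[ℂ] E) (N : Submodule ℂ E)
    (hN : ∀ f ∈ N, T f ∈ N) : N →ₗᵢ[ℂ] N :=
  ⟨T.toLinearMap.restrict hN, fun x => T.norm_map x⟩

theorem IsPureIsometry.restrictInvariant (hT : IsPureIsometry T) {N : Submodule ℂ E}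
    (hN : ∀ f ∈ N, T f ∈ N) : IsPureIsometry (T.restrictInvariant N hN) := by
  intro f hf
  refine Subtype.ext (hT f fun n => ?_)
  obtain ⟨g, hg⟩ := hf n
  have h1 : ∀ (n : ℕ) (g : N), (((T.restrictInvariant N hN)^[n] g : N) : E) = T^[n] g := by
    intro n
    induction n with
    | zero => exact fun g => rfl
    | succ n ih => exact fun g => ih _
  exact ⟨g, by rw [← h1, hg]⟩

theorem IsInverseCayley.part [CompleteSpace E] (hB : IsInverseCayley T B) (hT : IsPureIsometry T)
    {N : Submodule ℂ E} [CompleteSpace N] (hN : ∀ f ∈ N, T f ∈ N) :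
    IsInverseCayley (T.restrictInvariant N hN) (part N B) := by
  intro u w
  rw [mem_graph_part, hB]
  constructor
  · rintro ⟨g, h1, h2⟩
    have hg : g ∈ N := mem_of_sub_mem hT hN (h1 ▸ u.2)
    exact ⟨⟨g, hg⟩, Subtype.ext h1, Subtype.ext h2⟩
  · rintro ⟨g, rfl, rfl⟩
    exact ⟨g, rfl, rfl⟩

end UnboundedOp

/-! ### Wandering subspaces and boundary values of their symbols -/

namespace UnboundedOp

variable {E : Type*} [NormedAddCommGroup E] [InnerProductSpace ℂ E] {T : E →ₗᵢ[ℂ] E}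

/-- The wandering subspace `N ⊖ T N` of an isometry `T` in an invariant subspace `N`. -/
def wandering (T : E →ₗᵢ[ℂ] E) (N : Submodule ℂ E) : Submodule ℂ E :=
  N ⊓ (N.map T.toLinearMap)ᗮ

theorem mem_wandering {N : Submodule ℂ E} {e : E} :
    e ∈ wandering T N ↔ e ∈ N ∧ ∀ f ∈ N, inner ℂ e (T f) = 0 := by
  rw [wandering, Submodule.mem_inf, Submodule.mem_orthogonal']
  simp

theorem iterate_mem {N : Submodule ℂ E} (hN : ∀ f ∈ N, T f ∈ N) (n : ℕ) {f : E} (hf : f ∈ N) :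
    T^[n] f ∈ N := by
  induction n with
  | zero => exact hf
  | succ n ih =>
    rw [Function.iterate_succ_apply']
    exact hN _ ih

theorem inner_iterate_iterate (n : ℕ) (f g : E) : inner ℂ (T^[n] f) (T^[n] g) = inner ℂ f g := by
  induction n generalizing f g with
  | zero => rfl
  | succ n ih => rw [Function.iterate_succ_apply, Function.iterate_succ_apply, ih, T.inner_map_map]

theorem inner_iterate_wandering {N : Submodule ℂ E} (hN : ∀ f ∈ N, T f ∈ N) {e e' : E}
    (he : e ∈ wandering T N) (he' : e' ∈ wandering T N) {n m : ℕ} (hnm : n ≠ m) :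
    inner ℂ (T^[n] e) (T^[m] e') = 0 := by
  have key : ∀ {e e' : E} (_ : e ∈ wandering T N) (_ : e' ∈ wandering T N) {n m : ℕ} (_ : n < m),
      inner ℂ (T^[n] e) (T^[m] e') = 0 := by
    intro e e' he he' n m hlt
    obtain ⟨k, rfl⟩ := Nat.exists_eq_add_of_lt hlt
    rw [show n + k + 1 = n + (k + 1) by ring, Function.iterate_add_apply, inner_iterate_iterate,
      Function.iterate_succ_apply']
    exact (mem_wandering.1 he).2 _ (iterate_mem hN k (mem_wandering.1 he').1)
  rcases hnm.lt_or_gt with h | h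
  · exact key he he' h
  · exact inner_eq_zero_symm.1 (key he' he h)

/-- The **Wold decomposition** for a pure isometry: an invariant subspace is generated by its
wandering subspace. -/
theorem IsPureIsometry.eq_zero_of_orthogonal_wandering [CompleteSpace E] (hT : IsPureIsometry T)
    {N : Submodule ℂ E} [CompleteSpace N] {f : E} (hf : f ∈ N)
    (h : ∀ w ∈ wandering T N, ∀ n : ℕ, inner ℂ (T^[n] w) f = 0) (hN : ∀ f ∈ N, T f ∈ N) :
    f = 0 := by
  have hcompl : CompleteSpace (N.map T.toLinearMap) := by
    have h1 : IsComplete (N.map T.toLinearMap : Set E) := by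
      rw [Submodule.map_coe]
      exact (T.isometry.isUniformInducing.isComplete_iff).2
        (completeSpace_coe_iff_isComplete.1 inferInstance)
    exact h1.completeSpace_coe
  have hstep : ∀ n : ℕ, ∃ g ∈ N, T^[n] g = f := by
    intro n
    induction n with
    | zero => exact ⟨f, hf, rfl⟩
    | succ n ih =>
      obtain ⟨g, hg, rfl⟩ := ih
      have hgw : ∀ w ∈ wandering T N, inner ℂ w g = 0 := fun w hw => by
        rw [← h w hw n, inner_iterate_iterate]
      set p := (N.map T.toLinearMap).starProjection g with hp
      have hpm : p ∈ N.map T.toLinearMap := Submodule.starProjection_apply_mem _ _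
      obtain ⟨k, hk, hkp⟩ := hpm
      have hkp : T k = p := hkp
      have hr : g - p ∈ wandering T N := by
        refine ⟨N.sub_mem hg (hkp ▸ hN k hk), ?_⟩
        exact Submodule.sub_starProjection_mem_orthogonal g
      have h0 : g - p = 0 := by
        rw [← inner_self_eq_zero (𝕜 := ℂ), inner_sub_right, hgw _ hr, zero_sub, neg_eq_zero]
        have := (mem_wandering.1 hr).2 k hk
        rwa [hkp] at this
      refine ⟨k, hk, ?_⟩
      rw [Function.iterate_succ_apply, hkp, ← sub_eq_zero.1 h0]
  exact hT f fun n => (hstep n).imp fun g hg => hg.2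

theorem exists_eq_add_smul [CompleteSpace E] (T : E →ₗᵢ[ℂ] E) (e : E) {c : ℂ} (hc : ‖c‖ < 1) :
    ∃ g, g = e + c • T g := by
  set A : E →L[ℂ] E := c • T.toContinuousLinearMap with hA
  have hAn : ‖A‖ < 1 := by
    rw [hA, norm_smul]
    exact (mul_le_of_le_one_right (norm_nonneg _) T.norm_toContinuousLinearMap_le).trans_lt hc
  obtain ⟨u, hu⟩ := isUnit_one_sub_of_norm_lt_one hAn
  have h1 : (1 - A) ((↑u⁻¹ : E →L[ℂ] E) e) = e := by
    rw [← hu, ← mul_apply_eq_comp, Units.mul_inv, one_apply_eq_self]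
  exact ⟨_, sub_eq_iff_eq_add.1 h1⟩

theorem exists_mem_eq_add_smul {N : Submodule ℂ E} [CompleteSpace N] (hN : ∀ f ∈ N, T f ∈ N)
    {e : E} (he : e ∈ N) {c : ℂ} (hc : ‖c‖ < 1) : ∃ g ∈ N, g = e + c • T g := by
  obtain ⟨g, hg⟩ := exists_eq_add_smul (T.restrictInvariant N hN) ⟨e, he⟩ hc
  exact ⟨g, g.2, congrArg Subtype.val hg⟩

end UnboundedOp

namespace HalfLine
open UnboundedOp

variable {V : Type*} [NormedAddCommGroup V] [InnerProductSpace ℂ V] [CompleteSpace V]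

theorem hardyTransform_iterate_shift (n : ℕ) (f : L2 V) {z : ℂ} (hz : z ∈ upper) :
    hardyTransform ((shift V)^[n] f) z = shiftSymbol z ^ n • hardyTransform f z := by
  induction n with
  | zero => simp
  | succ n ih =>
    rw [Function.iterate_succ_apply', hardyTransform_shift _ hz, ih, smul_smul, pow_succ']

theorem norm_iterate_shift (n : ℕ) (f : L2 V) : ‖(shift V)^[n] f‖ = ‖f‖ := by
  induction n with
  | zero => rfl
  | succ n ih => rw [Function.iterate_succ_apply', (shift V).norm_map, ih]

/-- The symbol of the shift has modulus less than one, so `F f(z) = 0` for `f` in all ranges of `Tⁿ`. -/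
theorem isPureIsometry_shift : IsPureIsometry (shift V) := by
  intro f hf
  refine eq_zero_of_hardyTransform fun z hz => ?_
  have hb : ∀ n : ℕ, ‖hardyTransform f z‖ ≤ ‖shiftSymbol z‖ ^ n * (‖hardyEval V hz‖ * ‖f‖) := by
    intro n
    obtain ⟨g, rfl⟩ := hf n
    rw [hardyTransform_iterate_shift n g hz, norm_smul, norm_pow, norm_iterate_shift]
    gcongr
    exact (hardyEval V hz).le_opNorm g
  have h0 : Tendsto (fun n : ℕ => ‖shiftSymbol z‖ ^ n * (‖hardyEval V hz‖ * ‖f‖)) atTop (𝓝 0) := by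
    simpa using (tendsto_pow_atTop_nhds_zero_of_lt_one (norm_nonneg _)
      (norm_shiftSymbol_lt_one hz)).mul_const (‖hardyEval V hz‖ * ‖f‖)
  have := ge_of_tendsto' h0 hb
  exact norm_le_zero_iff.1 this

theorem isInverseCayley_momentum : IsInverseCayley (shift V) (momentum V) := fun _ _ =>
  mem_graph_momentum_iff_shift

/-- The quotient `F e / F φ`, where `φ` is the wandering unit vector of `L_2(ℝ₊)` with
`F φ(z) = π^{-1/2} (z + i)⁻¹`. -/
def wanderingSymbol (e : L2 V) (z : ℂ) : V :=
  ((Real.sqrt Real.pi : ℂ) * (z + Complex.I)) • hardyTransform e z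

theorem hardyTransform_eq_wanderingSymbol (e : L2 V) {z : ℂ} (hz : z ∈ upper) :
    hardyTransform e z = ((Real.sqrt Real.pi : ℂ) * (z + Complex.I))⁻¹ • wanderingSymbol e z := by
  have h : (Real.sqrt Real.pi : ℂ) * (z + Complex.I) ≠ 0 := by
    refine mul_ne_zero ?_ (add_I_ne_zero hz)
    exact_mod_cast (Real.sqrt_pos.2 Real.pi_pos).ne'
  rw [wanderingSymbol, smul_smul, inv_mul_cancel₀ h, one_smul]

theorem norm_sqrt_pi_mul_sq (w : ℂ) : ‖(Real.sqrt Real.pi : ℂ) * w‖ ^ 2 = Real.pi * ‖w‖ ^ 2 := by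
  rw [norm_mul, mul_pow, Complex.norm_real, Real.norm_eq_abs, sq_abs, Real.sq_sqrt Real.pi_pos.le]

theorem wanderingSymbol_add_smul (e e' : L2 V) (c : ℂ) {z : ℂ} (hz : z ∈ upper) :
    wanderingSymbol (e + c • e') z = wanderingSymbol e z + c • wanderingSymbol e' z := by
  simp only [wanderingSymbol]
  rw [hardyTransform_add _ _ hz, hardyTransform_smul]
  module

theorem differentiableOn_wanderingSymbol (e : L2 V) :
    DifferentiableOn ℂ (wanderingSymbol e) upper :=
  DifferentiableOn.smul (by fun_prop) (differentiableOn_hardyTransform e)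

/-- The symbol of a wandering vector is bounded. The bound is obtained by evaluating the transform
of `g = (1 - conj(b) T)⁻¹ e`, `b = (z - i) / (z + i)`, at `z`. -/
theorem norm_wanderingSymbol_le {N : Submodule ℂ (L2 V)} [CompleteSpace N]
    (hN : ∀ f ∈ N, shift V f ∈ N) {e : L2 V} (he : e ∈ wandering (shift V) N) {z : ℂ}
    (hz : z ∈ upper) : ‖wanderingSymbol e z‖ ≤ ‖e‖ := by
  have hy : 0 < z.im := hz
  obtain ⟨heN, heo⟩ := mem_wandering.1 he
  set b := shiftSymbol z with hb
  obtain ⟨g, hg, hge⟩ := exists_mem_eq_add_smul hN heN (c := starRingEnd ℂ b)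
    (by rw [RCLike.norm_conj]; exact norm_shiftSymbol_lt_one hz)
  have h1 : ‖g‖ ^ 2 = ‖e‖ ^ 2 + ‖b‖ ^ 2 * ‖g‖ ^ 2 := by
    have h2 : inner ℂ e (starRingEnd ℂ b • shift V g) = 0 := by
      rw [inner_smul_right, heo g hg, mul_zero]
    have h3 := norm_add_sq_eq_norm_sq_add_norm_sq_of_inner_eq_zero _ _ h2
    rw [← hge, norm_smul, (shift V).norm_map, RCLike.norm_conj] at h3
    nlinarith
  have h2 : hardyTransform e z = ((1 - ‖b‖ ^ 2 : ℝ) : ℂ) • hardyTransform g z := by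
    have h3 := congrArg (fun f => hardyTransform f z) hge
    rw [hardyTransform_add _ _ hz, hardyTransform_smul, hardyTransform_shift _ hz, smul_smul,
      ← hb, Complex.conj_mul'] at h3
    rw [← sub_eq_iff_eq_add] at h3
    rw [← h3]
    push_cast
    module
  have hd := one_sub_norm_shiftSymbol_sq hz
  rw [← hb] at hd
  have hw : 0 < ‖z + Complex.I‖ := norm_pos_iff.2 (add_I_ne_zero hz)
  have h3 := norm_hardyTransform_sq_le g hz
  rw [← sq_le_sq₀ (norm_nonneg _) (norm_nonneg _), wanderingSymbol, norm_smul, mul_pow,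
    norm_sqrt_pi_mul_sq, h2, norm_smul, mul_pow, Complex.norm_real, Real.norm_eq_abs, sq_abs]
  have h4 : ‖e‖ ^ 2 = (1 - ‖b‖ ^ 2) * ‖g‖ ^ 2 := by linarith
  rw [h4, hd]
  calc Real.pi * ‖z + Complex.I‖ ^ 2 * ((4 * z.im / ‖z + Complex.I‖ ^ 2) ^ 2
        * ‖hardyTransform g z‖ ^ 2)
      ≤ Real.pi * ‖z + Complex.I‖ ^ 2 * ((4 * z.im / ‖z + Complex.I‖ ^ 2) ^ 2
        * (‖g‖ ^ 2 / (4 * Real.pi * z.im))) := by gcongr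
    _ = _ := by field_simp

/-- The vertical limits of the symbol of a wandering vector `e` have norm `‖e‖` almost everywhere. -/
theorem ae_tendsto_wanderingSymbol [FiniteDimensional ℂ V] {N : Submodule ℂ (L2 V)}
    [CompleteSpace N] (hN : ∀ f ∈ N, shift V f ∈ N) {e : L2 V}
    (he : e ∈ wandering (shift V) N) :
    ∀ᵐ δ : ℝ, ∃ m, ‖m‖ = ‖e‖ ∧
      Tendsto (fun y : ℝ => wanderingSymbol e (δ + y * Complex.I)) (𝓝[>] 0) (𝓝 m) := by
  have hlim := ae_exists_tendsto (differentiableOn_wanderingSymbol e)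
    (C := ‖e‖) fun z hz => norm_wanderingSymbol_le hN he hz
  classical
  set M : ℝ → V := fun δ => if h : ∃ m, Tendsto
    (fun y : ℝ => wanderingSymbol e (δ + y * Complex.I)) (𝓝[>] 0) (𝓝 m) then h.choose else 0 with hM
  have hMlim : ∀ᵐ δ : ℝ, Tendsto (fun y : ℝ => wanderingSymbol e (δ + y * Complex.I)) (𝓝[>] 0)
      (𝓝 (M δ)) := by
    filter_upwards [hlim] with δ hδ
    simp only [hM, dif_pos hδ]
    exact hδ.choose_spec
  have hcont : ∀ y : ℝ, 0 < y →
      Continuous fun δ : ℝ => wanderingSymbol e (δ + y * Complex.I) := by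
    intro y hy
    refine (differentiableOn_wanderingSymbol e).continuousOn.comp_continuous (by fun_prop) ?_
    intro δ
    simpa [upper] using hy
  set y : ℕ → ℝ := fun n => 1 / ((n : ℝ) + 1) with hydef
  have hypos : ∀ n, 0 < y n := fun n => by positivity
  have hyt : Tendsto y atTop (𝓝[>] 0) :=
    tendsto_nhdsWithin_iff.2 ⟨tendsto_one_div_add_atTop_nhds_zero_nat, .of_forall hypos⟩
  have hMm : AEStronglyMeasurable M volume := by
    refine aestronglyMeasurable_of_tendsto_ae atTop
      (f := fun n (δ : ℝ) => wanderingSymbol e (δ + y n * Complex.I))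
      (fun n => (hcont _ (hypos n)).aestronglyMeasurable) ?_
    filter_upwards [hMlim] with δ hδ
    exact hδ.comp hyt
  have hMle : ∀ᵐ δ : ℝ, ‖M δ‖ ≤ ‖e‖ := by
    filter_upwards [hMlim] with δ hδ
    refine le_of_tendsto hδ.norm ?_
    filter_upwards [self_mem_nhdsWithin] with y hy
    exact norm_wanderingSymbol_le hN he (by simpa [upper] using hy)
  have hdom : Integrable fun δ : ℝ => ‖e‖ ^ 2 * (Real.pi⁻¹ * (1 + δ ^ 2)⁻¹) :=
    (integrable_inv_one_add_sq.const_mul _).const_mul _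
  have hdomv : ∫ δ : ℝ, ‖e‖ ^ 2 * (Real.pi⁻¹ * (1 + δ ^ 2)⁻¹) = ‖e‖ ^ 2 := by
    rw [integral_const_mul, integral_const_mul, integral_univ_inv_one_add_sq,
      inv_mul_cancel₀ Real.pi_ne_zero, mul_one]
  have hint : Tendsto (fun n => ∫ δ : ℝ, ‖hardyTransform e (δ + y n * Complex.I)‖ ^ 2) atTop
      (𝓝 (∫ δ : ℝ, ‖M δ‖ ^ 2 * (Real.pi⁻¹ * (1 + δ ^ 2)⁻¹))) := by
    have hform : ∀ n (δ : ℝ), ‖hardyTransform e (δ + y n * Complex.I)‖ ^ 2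
        = ‖wanderingSymbol e (δ + y n * Complex.I)‖ ^ 2
          * (Real.pi⁻¹ * ((1 + y n) ^ 2 + δ ^ 2)⁻¹) := by
      intro n δ
      rw [hardyTransform_eq_wanderingSymbol e (by simpa [upper] using hypos n), norm_smul,
        mul_pow, norm_inv, inv_pow, norm_sqrt_pi_mul_sq, Complex.sq_norm (_ + Complex.I),
        Complex.normSq_apply, mul_inv, mul_comm]
      simp
      left
      ring
    simp only [hform]
    refine tendsto_integral_of_dominated_convergence _ ?_ hdom ?_ ?_
    · intro n
      refine Continuous.aestronglyMeasurable ?_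
      have := hcont _ (hypos n)
      refine (this.norm.pow 2).mul (continuous_const.mul (Continuous.inv₀ (by fun_prop) ?_))
      intro δ
      have := hypos n
      positivity
    · intro n
      refine .of_forall fun δ => ?_
      have h1 := norm_wanderingSymbol_le hN he (z := δ + y n * Complex.I)
        (by simpa [upper] using hypos n)
      have h2 := hypos n
      rw [Real.norm_eq_abs, abs_of_nonneg (by positivity)]
      gcongr
      nlinarith
    · filter_upwards [hMlim] with δ hδ
      have h1 := (hδ.comp hyt).norm.pow 2
      have h2 : Tendsto (fun n => Real.pi⁻¹ * ((1 + y n) ^ 2 + δ ^ 2)⁻¹) atTop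
          (𝓝 (Real.pi⁻¹ * (1 + δ ^ 2)⁻¹)) := by
        refine Tendsto.const_mul _ (Tendsto.inv₀ ?_ (by positivity))
        have h3 : Tendsto (fun t : ℝ => (1 + t) ^ 2 + δ ^ 2) (𝓝 0) (𝓝 (1 + δ ^ 2)) :=
          Continuous.tendsto' (by fun_prop) _ _ (by simp)
        exact h3.comp (hyt.mono_right nhdsWithin_le_nhds)
      exact h1.mul h2
  have hval : ∫ δ : ℝ, ‖M δ‖ ^ 2 * (Real.pi⁻¹ * (1 + δ ^ 2)⁻¹) = ‖e‖ ^ 2 :=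
    tendsto_nhds_unique hint ((tendsto_integral_norm_sq_hardyTransform e).comp hyt)
  have hMi : Integrable fun δ : ℝ => ‖M δ‖ ^ 2 * (Real.pi⁻¹ * (1 + δ ^ 2)⁻¹) := by
    refine hdom.mono' ((hMm.norm.pow 2).mul ?_) ?_
    · exact (integrable_inv_one_add_sq.const_mul _).aestronglyMeasurable
    · filter_upwards [hMle] with δ hδ
      rw [Real.norm_eq_abs, abs_of_nonneg (by positivity)]
      gcongr
  -- the two nonnegative densities have the same integral and are ordered, so they agree
  have hdiff : ∫ δ : ℝ, (‖e‖ ^ 2 * (Real.pi⁻¹ * (1 + δ ^ 2)⁻¹)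
      - ‖M δ‖ ^ 2 * (Real.pi⁻¹ * (1 + δ ^ 2)⁻¹)) = 0 := by
    rw [integral_sub hdom hMi, hval, hdomv, sub_self]
  have hdiff := (integral_eq_zero_iff_of_nonneg_ae ?_ (hdom.sub hMi)).1 hdiff
  · filter_upwards [hdiff, hMlim] with δ h1 h2
    refine ⟨M δ, ?_, h2⟩
    simp only [Pi.sub_apply, ← sub_mul] at h1
    have h3 : Real.pi⁻¹ * (1 + δ ^ 2)⁻¹ ≠ 0 := by positivity
    have h4 := (mul_eq_zero.1 h1).resolve_right h3
    exact ((sq_eq_sq₀ (norm_nonneg _) (norm_nonneg _)).1 (sub_eq_zero.1 h4)).symm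
  · filter_upwards [hMle] with δ hδ
    simp only [Pi.sub_apply, ← sub_mul]
    refine mul_nonneg (sub_nonneg.2 ?_) (by positivity)
    gcongr

theorem eventually_mem_upper (δ : ℝ) : ∀ᶠ y : ℝ in 𝓝[>] 0, (δ + y * Complex.I : ℂ) ∈ upper := by
  filter_upwards [self_mem_nhdsWithin] with y hy
  simpa [upper] using hy

/-- The vertical limits of the symbols of wandering vectors have the same inner products as these
vectors, almost everywhere. -/
theorem ae_inner_wanderingSymbol [FiniteDimensional ℂ V] {N : Submodule ℂ (L2 V)}
    [CompleteSpace N] (hN : ∀ f ∈ N, shift V f ∈ N) {e e' : L2 V}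
    (he : e ∈ wandering (shift V) N) (he' : e' ∈ wandering (shift V) N) :
    ∀ᵐ δ : ℝ, ∀ m m' : V,
      Tendsto (fun y : ℝ => wanderingSymbol e (δ + y * Complex.I)) (𝓝[>] 0) (𝓝 m) →
      Tendsto (fun y : ℝ => wanderingSymbol e' (δ + y * Complex.I)) (𝓝[>] 0) (𝓝 m') →
      inner ℂ m m' = inner ℂ e e' := by
  have key : ∀ c : ℂ, ∀ᵐ δ : ℝ, ∀ m m' : V,
      Tendsto (fun y : ℝ => wanderingSymbol e (δ + y * Complex.I)) (𝓝[>] 0) (𝓝 m) →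
      Tendsto (fun y : ℝ => wanderingSymbol e' (δ + y * Complex.I)) (𝓝[>] 0) (𝓝 m') →
      ‖m + c • m'‖ = ‖e + c • e'‖ := by
    intro c
    filter_upwards [ae_tendsto_wanderingSymbol hN
      ((wandering (shift V) N).add_mem he ((wandering (shift V) N).smul_mem c he'))] with
      δ ⟨m₀, h1, h2⟩ m m' hm hm'
    have h3 : Tendsto (fun y : ℝ => wanderingSymbol (e + c • e') (δ + y * Complex.I)) (𝓝[>] 0)
        (𝓝 (m + c • m')) := by
      refine (hm.add (hm'.const_smul c)).congr' ?_
      filter_upwards [eventually_mem_upper δ] with y hy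
      exact (wanderingSymbol_add_smul e e' c hy).symm
    rw [tendsto_nhds_unique h3 h2, h1]
  filter_upwards [key 1, key (-1), key Complex.I, key (-Complex.I)] with δ h1 h2 h3 h4 m m' hm hm'
  have h1 := h1 m m' hm hm'
  have h2 := h2 m m' hm hm'
  have h3 := h3 m m' hm hm'
  have h4 := h4 m m' hm hm'
  simp only [one_smul, neg_smul, ← sub_eq_add_neg] at h1 h2 h3 h4
  rw [inner_eq_sum_norm_sq_div_four, inner_eq_sum_norm_sq_div_four]
  simp only [RCLike.I_to_complex] at *
  rw [h1, h2, h3, h4]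

/-- The number of orthonormal wandering vectors is at most the dimension of the value space. -/
theorem card_le_finrank_of_orthonormal [FiniteDimensional ℂ V] {N : Submodule ℂ (L2 V)}
    [CompleteSpace N] (hN : ∀ f ∈ N, shift V f ∈ N) {ι : Type*} [Fintype ι] {e : ι → L2 V}
    (he : ∀ i, e i ∈ wandering (shift V) N) (ho : Orthonormal ℂ e) :
    Fintype.card ι ≤ Module.finrank ℂ V := by
  have h1 : ∀ᵐ δ : ℝ, ∀ i, ∃ m, ‖m‖ = ‖e i‖ ∧
      Tendsto (fun y : ℝ => wanderingSymbol (e i) (δ + y * Complex.I)) (𝓝[>] 0) (𝓝 m) :=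
    ae_all_iff.2 fun i => ae_tendsto_wanderingSymbol hN (he i)
  have h2 := ae_all_iff.2 fun i => ae_all_iff.2 fun j =>
    ae_inner_wanderingSymbol hN (he i) (he j)
  obtain ⟨δ, h3, h4⟩ := (h1.and h2).exists
  choose m hmn hm using h3
  have hmo : Orthonormal ℂ m := by
    refine ⟨fun i => by rw [hmn, ho.1], fun i j hij => ?_⟩
    exact (h4 i j _ _ (hm i) (hm j)).trans (ho.2 hij)
  exact hmo.linearIndependent.fintype_card_le_finrank

end HalfLine

/-! ### The dimension of the wandering subspace -/

namespace HalfLine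
open UnboundedOp

variable {V : Type*} [NormedAddCommGroup V] [InnerProductSpace ℂ V] [CompleteSpace V]

/-- The wandering subspace has at most the dimension of the value space. -/
theorem rank_wandering_le [FiniteDimensional ℂ V] {N : Submodule ℂ (L2 V)} [CompleteSpace N]
    (hN : ∀ f ∈ N, shift V f ∈ N) :
    Module.rank ℂ (wandering (shift V) N) ≤ Module.finrank ℂ V := by
  refine rank_le fun s hs => ?_
  set b := stdOrthonormalBasis ℂ (Submodule.span ℂ (s : Set (wandering (shift V) N))) with hb
  have h1 : Module.finrank ℂ (Submodule.span ℂ (s : Set (wandering (shift V) N))) = s.card :=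
    finrank_span_finset_eq_card hs
  have h2 := card_le_finrank_of_orthonormal hN
    (e := fun i => ((b i : wandering (shift V) N) : L2 V)) (fun i => (b i).1.2)
    ((b.orthonormal.comp_linearIsometry (Submodule.subtypeₗᵢ _)).comp_linearIsometry
      (Submodule.subtypeₗᵢ _))
  rwa [Fintype.card_fin, h1] at h2

theorem exists_eq_smul_of_rank_le_one {E : Type*} [AddCommGroup E] [Module ℂ E]
    {W : Submodule ℂ E} (hW : Module.rank ℂ W ≤ 1) {e w : E} (he : e ∈ W) (h0 : e ≠ 0)
    (hw : w ∈ W) : ∃ c : ℂ, w = c • e := by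
  obtain ⟨v, hv⟩ := rank_le_one_iff.1 hW
  obtain ⟨c, hc⟩ := hv ⟨e, he⟩
  obtain ⟨d, hd⟩ := hv ⟨w, hw⟩
  have hc' : c • (v : E) = e := congrArg Subtype.val hc
  have hd' : d • (v : E) = w := congrArg Subtype.val hd
  have hc0 : c ≠ 0 := by
    rintro rfl
    rw [zero_smul] at hc'
    exact h0 hc'.symm
  exact ⟨d * c⁻¹, by rw [← hc', ← hd', smul_smul, mul_assoc, inv_mul_cancel₀ hc0, mul_one]⟩

theorem orthonormal_iterate_shift {N : Submodule ℂ (L2 V)} (hN : ∀ f ∈ N, shift V f ∈ N)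
    {e : L2 V} (he : e ∈ wandering (shift V) N) (h1 : ‖e‖ = 1) :
    Orthonormal ℂ fun n : ℕ => (shift V)^[n] e :=
  ⟨fun n => by rw [norm_iterate_shift, h1], fun _ _ hnm => inner_iterate_wandering hN he he hnm⟩

/-! ### The model shift basis of `L_2(ℝ₊)` -/

theorem memLp_exp_neg :
    MemLp (fun s : ℝ => (Real.exp (-s) : ℂ)) 2 (volume.restrict (Ioi (0 : ℝ))) := by
  rw [memLp_two_iff_integrable_sq_norm (by fun_prop)]
  have h : (fun s : ℝ => ‖(Real.exp (-s) : ℂ)‖ ^ 2) = fun s => Real.exp (-2 * s) := by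
    funext s
    rw [Complex.norm_real, Real.norm_eq_abs, Real.abs_exp, ← Real.exp_nat_mul]
    congr 1
    push_cast
    ring
  rw [h]
  exact exp_neg_integrableOn_Ioi 0 two_pos

/-- The unit vector `-i √2 e^{-s}` of `L_2(ℝ₊)`, which spans the kernel of the backward shift. -/
def modelVector : L2 ℂ := (-Complex.I * (Real.sqrt 2 : ℂ)) • memLp_exp_neg.toLp _

theorem wanderingSymbol_modelVector {z : ℂ} (hz : z ∈ upper) :
    wanderingSymbol modelVector z = 1 := by
  have hy : 0 < z.im := hz
  have h1 : ∫ s in Ioi (0 : ℝ), Complex.exp (Complex.I * z * s) • (memLp_exp_neg.toLp _ : L2 ℂ) s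
      = (1 - Complex.I * z)⁻¹ := by
    have h2 : ∫ s in Ioi (0 : ℝ),
        Complex.exp (Complex.I * z * s) • (memLp_exp_neg.toLp _ : L2 ℂ) s
        = ∫ s in Ioi (0 : ℝ), Complex.exp ((Complex.I * z - 1) * s) := by
      refine integral_congr_ae ?_
      filter_upwards [memLp_exp_neg.coeFn_toLp] with s hs
      rw [hs, smul_eq_mul, Complex.ofReal_exp, ← Complex.exp_add]
      congr 1
      push_cast
      ring
    rw [h2, integral_exp_mul_complex_Ioi (by simp; linarith)]
    have h3 := one_sub_I_mul_ne_zero hz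
    have h4 : Complex.I * z - 1 ≠ 0 := by
      rw [← neg_sub]
      exact neg_ne_zero.2 h3
    simp only [Complex.ofReal_zero, mul_zero, Complex.exp_zero]
    field_simp
    ring
  rw [modelVector, wanderingSymbol, hardyTransform_smul, hardyTransform, h1]
  have h5 : (Real.sqrt (2 * Real.pi) : ℂ) = Real.sqrt 2 * Real.sqrt Real.pi := by
    rw [Real.sqrt_mul (by norm_num)]
    push_cast
    rfl
  have h6 : (Real.sqrt 2 : ℂ) ≠ 0 := by
    exact_mod_cast (Real.sqrt_pos.2 two_pos).ne'
  have h7 : (Real.sqrt Real.pi : ℂ) ≠ 0 := by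
    exact_mod_cast (Real.sqrt_pos.2 Real.pi_pos).ne'
  have h8 := one_sub_I_mul_ne_zero hz
  have h9 : z + Complex.I = Complex.I * (1 - Complex.I * z) := by
    linear_combination z * Complex.I_sq
  rw [h5, h9]
  generalize 1 - Complex.I * z = w at h8
  simp only [smul_eq_mul]
  field_simp
  linear_combination -Complex.I_sq

theorem norm_modelVector : ‖modelVector‖ = 1 := by
  have h1 : ‖(memLp_exp_neg.toLp _ : L2 ℂ)‖ ^ 2 = 2⁻¹ := by
    rw [L2_norm_sq]
    have h2 : ∫ s in Ioi (0 : ℝ), ‖(memLp_exp_neg.toLp _ : L2 ℂ) s‖ ^ 2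
        = ∫ s in Ioi (0 : ℝ), Real.exp (-2 * s) := by
      refine integral_congr_ae ?_
      filter_upwards [memLp_exp_neg.coeFn_toLp] with s hs
      rw [hs, Complex.norm_real, Real.norm_eq_abs, Real.abs_exp, ← Real.exp_nat_mul]
      congr 1
      push_cast
      ring
    rw [h2, integral_exp_mul_Ioi (by norm_num)]
    simp
  rw [← sq_eq_sq₀ (norm_nonneg _) zero_le_one, modelVector, norm_smul, mul_pow, h1, norm_mul,
    norm_neg, Complex.norm_I, one_mul, Complex.norm_real, Real.norm_eq_abs, sq_abs,
    Real.sq_sqrt two_pos.le]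
  norm_num

theorem modelVector_mem_wandering : modelVector ∈ wandering (shift ℂ) ⊤ := by
  refine mem_wandering.2 ⟨trivial, fun f _ => ?_⟩
  have hI : Complex.I ∈ upper := by simp [upper]
  -- the scalar product with `e^{-s}` is the value of the transform at `i`, a zero of the symbol
  have h1 : ∀ g : L2 ℂ, inner ℂ (memLp_exp_neg.toLp _ : L2 ℂ) g
      = (Real.sqrt (2 * Real.pi) : ℂ) • hardyTransform g Complex.I := by
    intro g
    have h2 : (Real.sqrt (2 * Real.pi) : ℂ) ≠ 0 := by
      exact_mod_cast (Real.sqrt_pos.2 (by positivity)).ne'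
    rw [hardyTransform, smul_smul, mul_inv_cancel₀ h2, one_smul, L2.inner_def]
    refine integral_congr_ae ?_
    filter_upwards [memLp_exp_neg.coeFn_toLp] with s hs
    rw [hs, RCLike.inner_apply, Complex.conj_ofReal, Complex.I_mul_I, smul_eq_mul, mul_comm,
      Complex.ofReal_exp]
    simp
  rw [modelVector, inner_smul_left, h1, hardyTransform_shift _ hI, shiftSymbol, sub_self, zero_div,
    zero_smul, smul_zero, mul_zero]

/-- The vectors `Tⁿ φ` form an orthonormal basis of `L_2(ℝ₊)`. -/
def modelBasis : HilbertBasis ℕ ℂ (L2 ℂ) :=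
  HilbertBasis.mkOfOrthogonalEqBot
    (orthonormal_iterate_shift (N := ⊤) (fun _ _ => Submodule.mem_top)
      modelVector_mem_wandering norm_modelVector) (by
      have hN : ∀ f ∈ (⊤ : Submodule ℂ (L2 ℂ)), shift ℂ f ∈ (⊤ : Submodule ℂ (L2 ℂ)) :=
        fun _ _ => trivial
      have : CompleteSpace (⊤ : Submodule ℂ (L2 ℂ)) :=
        (isClosed_univ : IsClosed ((⊤ : Submodule ℂ (L2 ℂ)) : Set (L2 ℂ))).completeSpace_coe
      have h1 := rank_wandering_le hN
      rw [Module.finrank_self, Nat.cast_one] at h1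
      have h2 : modelVector ≠ 0 := by
        rw [← norm_ne_zero_iff, norm_modelVector]
        exact one_ne_zero
      rw [Submodule.eq_bot_iff]
      intro f hf
      refine isPureIsometry_shift.eq_zero_of_orthogonal_wandering (N := ⊤) trivial ?_ hN
      intro w hw n
      obtain ⟨c, rfl⟩ := exists_eq_smul_of_rank_le_one h1 modelVector_mem_wandering h2 hw
      have hit : ∀ (n : ℕ) (a : ℂ) (g : L2 ℂ), (shift ℂ)^[n] (a • g) = a • (shift ℂ)^[n] g := by
        intro n a g
        induction n with
        | zero => rfl
        | succ n ih => simp only [Function.iterate_succ_apply', ih, map_smul]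
      rw [hit, inner_smul_left,
        (Submodule.mem_orthogonal _ _).1 hf _ (Submodule.subset_span ⟨n, rfl⟩), mul_zero])

@[simp] theorem modelBasis_apply (n : ℕ) : modelBasis n = (shift ℂ)^[n] modelVector := by
  rw [modelBasis, HilbertBasis.coe_mkOfOrthogonalEqBot]

theorem clm_ext_modelBasis {G : Type*} [NormedAddCommGroup G] [NormedSpace ℂ G]
    {A A' : L2 ℂ →L[ℂ] G}
    (h : ∀ n : ℕ, A ((shift ℂ)^[n] modelVector) = A' ((shift ℂ)^[n] modelVector)) : A = A' := by
  refine ContinuousLinearMap.ext_on (s := range modelBasis) ?_ ?_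
  · rw [Submodule.dense_iff_topologicalClosure_eq_top]
    exact modelBasis.dense_span
  · rintro _ ⟨n, rfl⟩
    rw [modelBasis_apply]
    exact h n

/-- A wandering unit vector `e` gives an isometry `Tⁿ φ ↦ Tⁿ e` of `L_2(ℝ₊)` into `L_2(ℝ₊, V)`. -/
theorem exists_isometry_of_wandering {N : Submodule ℂ (L2 V)} (hN : ∀ f ∈ N, shift V f ∈ N)
    {e : L2 V} (he : e ∈ wandering (shift V) N) (h1 : ‖e‖ = 1) :
    ∃ S : L2 ℂ →ₗᵢ[ℂ] L2 V, ∀ n : ℕ, S ((shift ℂ)^[n] modelVector) = (shift V)^[n] e := by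
  have ho := orthonormal_iterate_shift hN he h1
  refine ⟨ho.orthogonalFamily.linearIsometry.comp modelBasis.repr.toLinearIsometry, fun n => ?_⟩
  rw [← modelBasis_apply]
  change ho.orthogonalFamily.linearIsometry (modelBasis.repr (modelBasis n)) = _
  rw [HilbertBasis.repr_self, OrthogonalFamily.linearIsometry_apply_single,
    LinearIsometry.toSpanSingleton_apply, one_smul]

/-- An operator `Tⁿ φ ↦ Tⁿ e` acts on the Fourier side as multiplication by the symbol of `e`. -/
theorem hardyTransform_of_iterate {e : L2 V} {S : L2 ℂ →L[ℂ] L2 V}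
    (hS : ∀ n : ℕ, S ((shift ℂ)^[n] modelVector) = (shift V)^[n] e) (f : L2 ℂ) {z : ℂ}
    (hz : z ∈ upper) : hardyTransform (S f) z = hardyTransform f z • wanderingSymbol e z := by
  have h : (hardyEval V hz).comp S
      = (ContinuousLinearMap.toSpanSingleton ℂ (wanderingSymbol e z)).comp (hardyEval ℂ hz) := by
    refine clm_ext_modelBasis fun n => ?_
    simp only [ContinuousLinearMap.comp_apply, hardyEval_apply,
      ContinuousLinearMap.toSpanSingleton_apply]
    rw [hS, hardyTransform_iterate_shift _ _ hz, hardyTransform_iterate_shift _ _ hz,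
      hardyTransform_eq_wanderingSymbol e hz, hardyTransform_eq_wanderingSymbol modelVector hz,
      wanderingSymbol_modelVector hz, smul_smul, smul_eq_mul, smul_eq_mul, mul_one]
  exact DFunLike.congr_fun h f

theorem mem_of_iterate {N : Submodule ℂ (L2 V)} [CompleteSpace N] (hN : ∀ f ∈ N, shift V f ∈ N)
    {e : L2 V} (he : e ∈ N) {S : L2 ℂ →L[ℂ] L2 V}
    (hS : ∀ n : ℕ, S ((shift ℂ)^[n] modelVector) = (shift V)^[n] e) (f : L2 ℂ) : S f ∈ N := by
  have h : Nᗮ.starProjection.comp S = 0 := by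
    refine clm_ext_modelBasis fun n => ?_
    rw [ContinuousLinearMap.comp_apply, hS, zero_apply,
      Submodule.starProjection_apply_eq_zero_iff]
    exact Submodule.le_orthogonal_orthogonal _ (iterate_mem hN n he)
  have h2 := DFunLike.congr_fun h f
  rw [ContinuousLinearMap.comp_apply, zero_apply,
    Submodule.starProjection_apply_eq_zero_iff, Submodule.orthogonal_orthogonal] at h2
  exact h2

/-! ### The Beurling-Lax theorem -/

/-- The matrix function with columns `F e_j / F φ`. -/
def columnSymbol (e : Fin 2 → L2 C2) (z : ℂ) : Matrix (Fin 2) (Fin 2) ℂ :=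
  Matrix.of fun i j => wanderingSymbol (e j) z i

theorem columnSymbol_toEuclideanLin (e : Fin 2 → L2 C2) (z : ℂ) (v : C2) :
    (columnSymbol e z).toEuclideanLin v = ∑ j, v j • wanderingSymbol (e j) z := by
  ext i
  fin_cases i <;> simp [columnSymbol, Matrix.toLpLin_apply, mul_comm]

/-- The embedding of `L_2(ℝ₊)` into `L_2(ℝ₊, ℂ²)` as the `i`-th component. -/
def embed (i : Fin 2) : L2 ℂ →L[ℂ] L2 C2 :=
  (ContinuousLinearMap.toSpanSingleton ℂ (EuclideanSpace.single i (1 : ℂ) : C2)).compLpL 2 _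

theorem embed_apply (i : Fin 2) (f : L2 ℂ) : embed i f =
    (ContinuousLinearMap.toSpanSingleton ℂ (EuclideanSpace.single i (1 : ℂ) : C2)).compLp f := rfl

theorem hardyTransform_embed (i : Fin 2) (f : L2 ℂ) {z : ℂ} (hz : z ∈ upper) :
    hardyTransform (embed i f) z = hardyTransform f z • EuclideanSpace.single i (1 : ℂ) := by
  rw [embed_apply, hardyTransform_compLp _ _ hz]
  rfl

theorem hardyTransform_component (i : Fin 2) (f : L2 C2) {z : ℂ} (hz : z ∈ upper) :
    hardyTransform (component f i) z = hardyTransform f z i := by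
  rw [component, hardyTransform_compLp _ _ hz]
  rfl

/-- The projection `P` of the matrix inner function is the Gram matrix of the columns. -/
theorem isMatrixInner_columnSymbol {N : Submodule ℂ (L2 C2)} [CompleteSpace N]
    (hN : ∀ f ∈ N, shift C2 f ∈ N) {e : Fin 2 → L2 C2}
    (he : ∀ j, e j ∈ wandering (shift C2) N) (hnorm : ∀ j, e j = 0 ∨ ‖e j‖ = 1)
    (horth : ∀ i j, i ≠ j → inner ℂ (e i) (e j) = 0) : IsMatrixInner (columnSymbol e) := by
  have hnorm' : ∀ j, ‖e j‖ ≤ 1 := fun j => by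
    rcases hnorm j with h | h
    · simp [h]
    · exact h.le
  refine ⟨fun i j => ?_, ⟨1, fun z hz i j => ?_⟩, Matrix.diagonal fun j => inner ℂ (e j) (e j),
    ?_, ?_, ?_⟩
  · exact (EuclideanSpace.proj i : C2 →L[ℂ] ℂ).differentiable.comp_differentiableOn
      (differentiableOn_wanderingSymbol (e j))
  · exact ((PiLp.norm_apply_le _ i).trans (norm_wanderingSymbol_le hN (he j) hz)).trans (hnorm' j)
  · rw [Matrix.IsHermitian, Matrix.diagonal_conjTranspose]
    congr 1
    funext j
    exact inner_conj_symm _ _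
  · rw [Matrix.diagonal_mul_diagonal]
    congr 1
    funext j
    rw [inner_self_eq_norm_sq_to_K]
    rcases hnorm j with h | h <;> simp [h]
  · have h1 : ∀ᵐ δ : ℝ, ∀ j, ∃ m, ‖m‖ = ‖e j‖ ∧
        Tendsto (fun y : ℝ => wanderingSymbol (e j) (δ + y * Complex.I)) (𝓝[>] 0) (𝓝 m) :=
      ae_all_iff.2 fun i => ae_tendsto_wanderingSymbol hN (he i)
    have h2 := ae_all_iff.2 fun i => ae_all_iff.2 fun j =>
      ae_inner_wanderingSymbol hN (he i) (he j)
    filter_upwards [h1, h2] with δ h3 h4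
    choose m hmn hm using h3
    refine ⟨Matrix.of fun i j => m j i, ?_, ?_⟩
    · ext i j
      have h5 := h4 i j _ _ (hm i) (hm j)
      rw [PiLp.inner_apply] at h5
      simp only [RCLike.inner_apply] at h5
      rw [Matrix.mul_apply]
      simp only [Matrix.conjTranspose_apply, Matrix.of_apply]
      rw [Matrix.diagonal_apply]
      have h6 : ∑ k, star (m i k) * m j k = inner ℂ (e i) (e j) := by
        rw [← h5]
        exact Finset.sum_congr rfl fun k _ => mul_comm _ _
      rw [h6]
      split_ifs with hij
      · rw [hij]
      · exact horth i j hij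
    · refine tendsto_pi_nhds.2 fun i => tendsto_pi_nhds.2 fun j => ?_
      exact ((EuclideanSpace.proj i : C2 →L[ℂ] ℂ).continuous.tendsto _).comp (hm j)

/-- **Beurling-Lax theorem**: the invariant subspace `N` is the range of the multiplication by the
matrix function whose columns are the symbols of a basis of the wandering subspace. -/
theorem multiplierRange_columnSymbol {N : Submodule ℂ (L2 C2)} [CompleteSpace N]
    (hN : ∀ f ∈ N, shift C2 f ∈ N) {e : Fin 2 → L2 C2}
    (he : ∀ j, e j ∈ wandering (shift C2) N) (hnorm : ∀ j, e j = 0 ∨ ‖e j‖ = 1)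
    (horth : ∀ i j, i ≠ j → inner ℂ (e i) (e j) = 0)
    (hspan : wandering (shift C2) N ≤ Submodule.span ℂ (range e)) :
    multiplierRange (columnSymbol e) = N := by
  have hex : ∀ j, ∃ S : L2 ℂ →L[ℂ] L2 C2,
      (∀ n : ℕ, S ((shift ℂ)^[n] modelVector) = (shift C2)^[n] (e j)) ∧
      (e j ≠ 0 → ∀ f g, inner ℂ (S f) (S g) = inner ℂ f g) := by
    intro j
    rcases hnorm j with h | h
    · refine ⟨0, fun n => ?_, fun h' => (h' h).elim⟩
      rw [h, iterate_map_zero, zero_apply]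
    · obtain ⟨S, hS⟩ := exists_isometry_of_wandering hN (he j) h
      exact ⟨S.toContinuousLinearMap, hS, fun _ f g => S.inner_map_map f g⟩
  choose S hS hSi using hex
  have hsum : ∀ (f : Fin 2 → L2 ℂ) {z : ℂ}, z ∈ upper → hardyTransform (∑ j, S j (f j)) z
      = ∑ j, hardyTransform (f j) z • wanderingSymbol (e j) z := by
    intro f z hz
    rw [← hardyEval_apply hz, map_sum]
    exact Finset.sum_congr rfl fun j _ => hardyTransform_of_iterate (hS j) (f j) hz
  refine le_antisymm ?_ fun g hg => ?_
  · rintro g ⟨⟨f, g'⟩, hfg, rfl⟩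
    have h1 : g' = ∑ j, S j (component f j) := by
      refine hardyTransform_injective fun z hz => ?_
      rw [hsum _ hz, hfg z hz, columnSymbol_toEuclideanLin]
      exact Finset.sum_congr rfl fun j _ => by rw [hardyTransform_component _ _ hz]
    simp only [LinearMap.snd_apply]
    rw [h1]
    exact N.sum_mem fun j _ => mem_of_iterate hN (mem_wandering.1 (he j)).1 (hS j) _
  · set f : Fin 2 → L2 ℂ := fun j => (S j).adjoint g with hf
    -- `∑ S_j S_j* g` is the projection of `g` on the span of the vectors `Tⁿ e_j`
    have hcross : ∀ j k, j ≠ k → ∀ n h, inner ℂ ((shift C2)^[n] (e k)) (S j h) = 0 := by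
      intro j k hjk n h
      have h1 : (innerSL ℂ ((shift C2)^[n] (e k))).comp (S j) = 0 := by
        refine clm_ext_modelBasis fun m => ?_
        rw [ContinuousLinearMap.comp_apply, hS, innerSL_apply_apply, zero_apply]
        by_cases hnm : n = m
        · rw [hnm, inner_iterate_iterate, horth k j hjk.symm]
        · exact inner_iterate_wandering hN (he k) (he j) hnm
      exact DFunLike.congr_fun h1 h
    have hself : ∀ k n, inner ℂ ((shift C2)^[n] (e k)) (S k (f k))
        = inner ℂ ((shift C2)^[n] (e k)) g := by
      intro k n
      by_cases h0 : e k = 0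
      · rw [h0, iterate_map_zero, inner_zero_left, inner_zero_left]
      · rw [← hS k n, hSi k h0, hf, ContinuousLinearMap.adjoint_inner_right]
    have hgsum : g = ∑ j, S j (f j) := by
      rw [← sub_eq_zero]
      refine isPureIsometry_shift.eq_zero_of_orthogonal_wandering (N := N)
        (N.sub_mem hg (N.sum_mem fun j _ =>
          mem_of_iterate hN (mem_wandering.1 (he j)).1 (hS j) _)) (fun w hw n => ?_) hN
      have hlin : ∀ w, ((shift C2).toLinearMap ^ n) w = (shift C2)^[n] w := fun w =>
        Module.End.pow_apply _ _ _
      have hker : Submodule.span ℂ (range e) ≤ (LinearMap.ker ((innerₛₗ ℂ (g - ∑ j, S j (f j))).comp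
          ((shift C2).toLinearMap ^ n))) := by
        rw [Submodule.span_le]
        rintro _ ⟨k, rfl⟩
        rw [SetLike.mem_coe, LinearMap.mem_ker, LinearMap.comp_apply, hlin, innerₛₗ_apply_apply,
          inner_eq_zero_symm, inner_sub_right, inner_sum, Finset.sum_eq_single k, hself, sub_self]
        · intro j _ hjk
          exact hcross j k hjk n _
        · intro h
          exact (h (Finset.mem_univ k)).elim
      have h3 := hker (hspan hw)
      rw [LinearMap.mem_ker, LinearMap.comp_apply, hlin, innerₛₗ_apply_apply] at h3
      exact inner_eq_zero_symm.1 h3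
    refine ⟨(∑ j, embed j (f j), g), fun z hz => ?_, rfl⟩
    simp only
    rw [columnSymbol_toEuclideanLin, hgsum, hsum _ hz]
    refine Finset.sum_congr rfl fun j _ => ?_
    congr 1
    rw [← hardyEval_apply hz (∑ j, embed j (f j)), map_sum]
    simp only [hardyEval_apply, hardyTransform_embed _ _ hz]
    fin_cases j <;> simp

end HalfLine

/-! ### Components and invariant subspaces orthogonal to `q` -/

namespace HalfLine
open UnboundedOp

variable {V : Type*} [NormedAddCommGroup V] [InnerProductSpace ℂ V] [CompleteSpace V]

theorem component_embed_self (i : Fin 2) (f : L2 ℂ) : component (embed i f) i = f := by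
  refine hardyTransform_injective fun z hz => ?_
  rw [hardyTransform_component _ _ hz, hardyTransform_embed _ _ hz]
  simp

theorem component_embed_of_ne {i j : Fin 2} (hij : j ≠ i) (f : L2 ℂ) :
    component (embed i f) j = 0 := by
  refine hardyTransform_injective fun z hz => ?_
  rw [hardyTransform_component _ _ hz, hardyTransform_embed _ _ hz, hardyTransform_zero]
  simp [hij]

theorem sum_embed_component (f : L2 C2) : ∑ i, embed i (component f i) = f := by
  refine hardyTransform_injective fun z hz => ?_
  rw [← hardyEval_apply hz, map_sum]
  simp only [hardyEval_apply, hardyTransform_embed _ _ hz, hardyTransform_component _ _ hz]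
  ext i
  fin_cases i <;> simp

theorem shift_embed (i : Fin 2) (f : L2 ℂ) : shift C2 (embed i f) = embed i (shift ℂ f) := by
  refine hardyTransform_injective fun z hz => ?_
  rw [hardyTransform_shift _ hz, hardyTransform_embed _ _ hz, hardyTransform_embed _ _ hz,
    hardyTransform_shift _ hz, smul_assoc]

theorem component_shift (i : Fin 2) (f : L2 C2) :
    component (shift C2 f) i = shift ℂ (component f i) := by
  refine hardyTransform_injective fun z hz => ?_
  rw [hardyTransform_component _ _ hz, hardyTransform_shift _ hz, hardyTransform_shift _ hz,
    hardyTransform_component _ _ hz]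
  rfl

theorem inner_embed (i : Fin 2) (f : L2 ℂ) (g : L2 C2) :
    inner ℂ (embed i f) g = inner ℂ f (component g i) := by
  rw [L2.inner_def, L2.inner_def]
  refine integral_congr_ae ?_
  filter_upwards [ContinuousLinearMap.coeFn_compLp
    (ContinuousLinearMap.toSpanSingleton ℂ (EuclideanSpace.single i (1 : ℂ) : C2)) f,
    ContinuousLinearMap.coeFn_compLp (EuclideanSpace.proj i : C2 →L[ℂ] ℂ) g] with s h1 h2
  rw [component, h2, embed_apply, h1, ContinuousLinearMap.toSpanSingleton_apply, inner_smul_left,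
    EuclideanSpace.inner_single_left]
  simp [mul_comm]

theorem norm_embed (i : Fin 2) (f : L2 ℂ) : ‖embed i f‖ = ‖f‖ := by
  have h := inner_embed i f (embed i f)
  rw [component_embed_self, inner_self_eq_norm_sq_to_K, inner_self_eq_norm_sq_to_K] at h
  have h' : ‖embed i f‖ ^ 2 = ‖f‖ ^ 2 := by exact_mod_cast h
  exact (sq_eq_sq₀ (norm_nonneg _) (norm_nonneg _)).1 h'

theorem wanderingSymbol_embed (i : Fin 2) (f : L2 ℂ) {z : ℂ} (hz : z ∈ upper) :
    wanderingSymbol (embed i f) z = wanderingSymbol f z • EuclideanSpace.single i (1 : ℂ) := by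
  rw [wanderingSymbol, hardyTransform_embed _ _ hz, wanderingSymbol, smul_assoc]

theorem cyclicSubspace_orthogonal_ne_bot_iff {q : L2 V} :
    (cyclicSubspace q)ᗮ ≠ ⊥ ↔ IsNonCyclic q := by
  have : CompleteSpace (cyclicSubspace q) :=
    (Submodule.isClosed_topologicalClosure _).completeSpace_coe
  rw [IsNonCyclic, Ne, Submodule.orthogonal_eq_bot_iff]

theorem exists_unit_wandering {N : Submodule ℂ (L2 V)} [CompleteSpace N]
    (hN : ∀ f ∈ N, shift V f ∈ N) (h0 : N ≠ ⊥) : ∃ w ∈ wandering (shift V) N, ‖w‖ = 1 := by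
  have h1 : ∃ w ∈ wandering (shift V) N, w ≠ 0 := by
    by_contra! h
    refine h0 ((Submodule.eq_bot_iff _).2 fun f hf => ?_)
    refine isPureIsometry_shift.eq_zero_of_orthogonal_wandering hf (fun w hw n => ?_) hN
    rw [h w hw, iterate_map_zero, inner_zero_left]
  obtain ⟨w, hw, hw0⟩ := h1
  refine ⟨((‖w‖ : ℂ)⁻¹) • w, Submodule.smul_mem _ _ hw, ?_⟩
  rw [norm_smul, norm_inv, Complex.norm_real, norm_norm, inv_mul_cancel₀ (norm_ne_zero_iff.2 hw0)]

/-- The wandering subspace of an invariant subspace of `L_2(ℝ₊, ℂ²)` is spanned by two orthogonal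
vectors, each of which is zero or normalized. -/
theorem exists_wandering_basis {N : Submodule ℂ (L2 C2)} [CompleteSpace N]
    (hN : ∀ f ∈ N, shift C2 f ∈ N) :
    ∃ e : Fin 2 → L2 C2, (∀ j, e j ∈ wandering (shift C2) N) ∧ (∀ j, e j = 0 ∨ ‖e j‖ = 1) ∧
      (∀ i j, i ≠ j → inner ℂ (e i) (e j) = 0) ∧
      wandering (shift C2) N ≤ Submodule.span ℂ (range e) := by
  have hr := rank_wandering_le hN
  rw [finrank_euclideanSpace_fin] at hr
  have hfin : FiniteDimensional ℂ (wandering (shift C2) N) :=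
    Module.rank_lt_aleph0_iff.1 (hr.trans_lt Cardinal.natCast_lt_aleph0)
  have hk : Module.finrank ℂ (wandering (shift C2) N) ≤ 2 := Module.finrank_le_of_rank_le hr
  set b := stdOrthonormalBasis ℂ (wandering (shift C2) N) with hb
  set k := Module.finrank ℂ (wandering (shift C2) N) with hkdef
  have hbo : Orthonormal ℂ fun i => ((b i : wandering (shift C2) N) : L2 C2) :=
    b.orthonormal.comp_linearIsometry (Submodule.subtypeₗᵢ _)
  refine ⟨fun j => if h : (j : ℕ) < k then b ⟨j, h⟩ else 0, fun j => ?_, fun j => ?_,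
    fun i j hij => ?_, fun w hw => ?_⟩
  · dsimp only
    split_ifs
    · exact (b _).2
    · exact Submodule.zero_mem _
  · dsimp only
    split_ifs
    · exact Or.inr (hbo.1 _)
    · exact Or.inl rfl
  · dsimp only
    split_ifs with h1 h2 h2
    · exact hbo.2 fun h => hij (Fin.ext (Fin.mk.inj_iff.1 h))
    · exact inner_zero_right _
    · exact inner_zero_left _
    · exact inner_zero_left _
  · have h1 := congrArg Subtype.val (b.sum_repr ⟨w, hw⟩)
    simp only [Submodule.coe_sum, Submodule.coe_smul] at h1
    rw [← h1]
    refine Submodule.sum_mem _ fun i _ => Submodule.smul_mem _ _ (Submodule.subset_span ?_)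
    exact ⟨⟨i, i.2.trans_le hk⟩, dif_pos i.2⟩

/-- The direct sum of two subspaces of `L_2(ℝ₊)` as a subspace of `L_2(ℝ₊, ℂ²)`. -/
def directSum (M : Fin 2 → Submodule ℂ (L2 ℂ)) : Submodule ℂ (L2 C2) :=
  ⨅ i, (M i).comap ((EuclideanSpace.proj i : C2 →L[ℂ] ℂ).compLpL 2
    (volume.restrict (Ioi (0 : ℝ)))).toLinearMap

theorem mem_directSum {M : Fin 2 → Submodule ℂ (L2 ℂ)} {f : L2 C2} :
    f ∈ directSum M ↔ ∀ i, component f i ∈ M i := by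
  rw [directSum, Submodule.mem_iInf]
  rfl

theorem completeSpace_directSum {M : Fin 2 → Submodule ℂ (L2 ℂ)}
    (hM : ∀ i, IsClosed (M i : Set (L2 ℂ))) : CompleteSpace (directSum M) := by
  have h : IsClosed (directSum M : Set (L2 C2)) := by
    rw [directSum, Submodule.coe_iInf]
    exact isClosed_iInter fun i => (hM i).preimage (ContinuousLinearMap.continuous _)
  exact h.completeSpace_coe

theorem embed_mem_directSum {M : Fin 2 → Submodule ℂ (L2 ℂ)} {i : Fin 2} {f : L2 ℂ}
    (hf : f ∈ M i) : embed i f ∈ directSum M := by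
  refine mem_directSum.2 fun j => ?_
  by_cases h : j = i
  · rw [h, component_embed_self]
    exact hf
  · rw [component_embed_of_ne h]
    exact Submodule.zero_mem _

theorem shift_mem_directSum {M : Fin 2 → Submodule ℂ (L2 ℂ)}
    (hM : ∀ i, ∀ f ∈ M i, shift ℂ f ∈ M i) : ∀ f ∈ directSum M, shift C2 f ∈ directSum M := by
  intro f hf
  rw [mem_directSum] at hf ⊢
  intro i
  rw [component_shift]
  exact hM i _ (hf i)

theorem embed_mem_wandering {M : Fin 2 → Submodule ℂ (L2 ℂ)} {i : Fin 2} {w : L2 ℂ}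
    (hw : w ∈ wandering (shift ℂ) (M i)) :
    embed i w ∈ wandering (shift C2) (directSum M) := by
  obtain ⟨h1, h2⟩ := mem_wandering.1 hw
  refine mem_wandering.2 ⟨embed_mem_directSum h1, fun f hf => ?_⟩
  rw [inner_embed, component_shift]
  exact h2 _ (mem_directSum.1 hf i)

theorem component_mem_wandering {M : Fin 2 → Submodule ℂ (L2 ℂ)} {w : L2 C2}
    (hw : w ∈ wandering (shift C2) (directSum M)) (i : Fin 2) :
    component w i ∈ wandering (shift ℂ) (M i) := by
  obtain ⟨h1, h2⟩ := mem_wandering.1 hw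
  refine mem_wandering.2 ⟨mem_directSum.1 h1 i, fun f hf => ?_⟩
  rw [inner_eq_zero_symm, ← inner_embed, ← shift_embed, inner_eq_zero_symm]
  exact h2 _ (embed_mem_directSum hf)

theorem isInner_wanderingSymbol {N : Submodule ℂ (L2 ℂ)} [CompleteSpace N]
    (hN : ∀ f ∈ N, shift ℂ f ∈ N) {w : L2 ℂ} (hw : w ∈ wandering (shift ℂ) N) (h1 : ‖w‖ = 1) :
    IsInner (wanderingSymbol w) := by
  refine ⟨differentiableOn_wanderingSymbol w,
    ⟨‖w‖, fun z hz => norm_wanderingSymbol_le hN hw hz⟩, ?_⟩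
  simpa only [h1] using ae_tendsto_wanderingSymbol hN hw

theorem isInner_congr {φ χ : ℂ → ℂ} (h : ∀ z ∈ upper, φ z = χ z) (hφ : IsInner φ) : IsInner χ := by
  obtain ⟨h1, ⟨C, h2⟩, h3⟩ := hφ
  refine ⟨h1.congr fun z hz => (h z hz).symm, ⟨C, fun z hz => h z hz ▸ h2 z hz⟩, ?_⟩
  filter_upwards [h3] with δ ⟨m, hm, ht⟩
  refine ⟨m, hm, ht.congr' ?_⟩
  filter_upwards [eventually_mem_upper δ] with y hy using h _ hy

/-- If a component of `q` is non-cyclic, there are an invariant subspace orthogonal to `q` and a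
basis of its wandering subspace for which the matrix function is diagonal. -/
theorem exists_diagonal {q : L2 C2} (hq : ∃ i, IsNonCyclic (component q i)) :
    ∃ (N : Submodule ℂ (L2 C2)) (_ : CompleteSpace N) (e : Fin 2 → L2 C2),
      (∀ f ∈ N, shift C2 f ∈ N) ∧ N ≠ ⊥ ∧ (∀ f ∈ N, inner ℂ q f = 0) ∧
      ((∀ j, e j ∈ wandering (shift C2) N) ∧ (∀ j, e j = 0 ∨ ‖e j‖ = 1) ∧
      (∀ i j, i ≠ j → inner ℂ (e i) (e j) = 0) ∧
      wandering (shift C2) N ≤ Submodule.span ℂ (range e)) ∧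
      (∀ z ∈ upper, ∀ i j, i ≠ j → columnSymbol e z i j = 0) ∧
      ∀ i, (IsNonCyclic (component q i) → IsInner fun z => columnSymbol e z i i) ∧
        (¬ IsNonCyclic (component q i) → ∀ z ∈ upper, columnSymbol e z i i = 0) := by
  set M : Fin 2 → Submodule ℂ (L2 ℂ) := fun i => (cyclicSubspace (component q i))ᗮ with hM
  have hMcl : ∀ i, IsClosed (M i : Set (L2 ℂ)) := fun i => Submodule.isClosed_orthogonal _
  have hMc : ∀ i, CompleteSpace (M i) := fun i => (hMcl i).completeSpace_coe
  have hMs : ∀ i, ∀ f ∈ M i, shift ℂ f ∈ M i := fun i f hf => shift_mem_cyclicSubspace_orthogonal hf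
  have hex : ∀ i, ∃ w ∈ wandering (shift ℂ) (M i),
      (IsNonCyclic (component q i) → ‖w‖ = 1) ∧ (¬ IsNonCyclic (component q i) → w = 0) := by
    intro i
    by_cases h : IsNonCyclic (component q i)
    · obtain ⟨w, h1, h2⟩ := exists_unit_wandering (hMs i)
        (cyclicSubspace_orthogonal_ne_bot_iff.2 h)
      exact ⟨w, h1, fun _ => h2, fun h' => (h' h).elim⟩
    · exact ⟨0, Submodule.zero_mem _, fun h' => (h h').elim, fun _ => rfl⟩
  choose w hw hw1 hw0 using hex
  refine ⟨directSum M, completeSpace_directSum hMcl, fun i => embed i (w i),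
    shift_mem_directSum hMs, ?_, fun f hf => ?_,
    ⟨fun j => embed_mem_wandering (hw j), fun j => ?_, fun i j hij => ?_, fun v hv => ?_⟩,
    fun z hz i j hij => ?_, fun i => ⟨fun h => ?_, fun h z hz => ?_⟩⟩
  · obtain ⟨i, hi⟩ := hq
    intro h0
    have h1 := embed_mem_directSum (mem_wandering.1 (hw i)).1
    rw [h0, Submodule.mem_bot, ← norm_eq_zero, norm_embed, hw1 i hi] at h1
    exact one_ne_zero h1
  · rw [← sum_embed_component f, inner_sum]
    refine Finset.sum_eq_zero fun i _ => ?_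
    rw [inner_eq_zero_symm, inner_embed, inner_eq_zero_symm]
    exact (Submodule.mem_orthogonal _ _).1 (mem_directSum.1 hf i) _ (mem_cyclicSubspace_self _)
  · by_cases h : IsNonCyclic (component q j)
    · exact Or.inr (by rw [norm_embed, hw1 j h])
    · exact Or.inl (by simp only [hw0 j h, map_zero])
  · rw [inner_embed, component_embed_of_ne hij, inner_zero_right]
  · rw [← sum_embed_component v]
    refine Submodule.sum_mem _ fun i _ => ?_
    have h1 := component_mem_wandering hv i
    by_cases h : IsNonCyclic (component q i)
    · have hr := rank_wandering_le (hMs i)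
      rw [Module.finrank_self, Nat.cast_one] at hr
      have hwne : w i ≠ 0 := by
        rw [← norm_ne_zero_iff, hw1 i h]
        exact one_ne_zero
      obtain ⟨c, hc⟩ := exists_eq_smul_of_rank_le_one hr (hw i) hwne h1
      rw [hc, map_smul]
      exact Submodule.smul_mem _ _ (Submodule.subset_span ⟨i, rfl⟩)
    · have h2 : M i = ⊥ := not_ne_iff.1 fun h' => h (cyclicSubspace_orthogonal_ne_bot_iff.1 h')
      have h3 := (mem_wandering.1 h1).1
      rw [h2, Submodule.mem_bot] at h3
      rw [h3, map_zero]
      exact Submodule.zero_mem _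
  · simp only [columnSymbol, Matrix.of_apply, wanderingSymbol_embed _ _ hz]
    simp [hij]
  · refine isInner_congr (fun z hz => ?_) (isInner_wanderingSymbol (hMs i) (hw i) (hw1 i h))
    simp only [columnSymbol, Matrix.of_apply, wanderingSymbol_embed _ _ hz]
    simp
  · simp only [columnSymbol, Matrix.of_apply, hw0 i h, map_zero]
    simp [wanderingSymbol, hardyTransform_zero]

/-- A non-cyclic `q` is orthogonal to a nonzero invariant subspace, with a basis of the wandering
subspace that gives a diagonal matrix function as soon as a component of `q` is non-cyclic. -/
theorem exists_invariant_orthogonal {q : L2 C2} (hq : IsNonCyclic q) :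
    ∃ (N : Submodule ℂ (L2 C2)) (_ : CompleteSpace N) (e : Fin 2 → L2 C2),
      (∀ f ∈ N, shift C2 f ∈ N) ∧ N ≠ ⊥ ∧ (∀ f ∈ N, inner ℂ q f = 0) ∧
      ((∀ j, e j ∈ wandering (shift C2) N) ∧ (∀ j, e j = 0 ∨ ‖e j‖ = 1) ∧
      (∀ i j, i ≠ j → inner ℂ (e i) (e j) = 0) ∧
      wandering (shift C2) N ≤ Submodule.span ℂ (range e)) ∧
      ((∃ i, IsNonCyclic (component q i)) →
        (∀ z ∈ upper, ∀ i j, i ≠ j → columnSymbol e z i j = 0) ∧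
        ∀ i, (IsNonCyclic (component q i) → IsInner fun z => columnSymbol e z i i) ∧
          (¬ IsNonCyclic (component q i) → ∀ z ∈ upper, columnSymbol e z i i = 0)) := by
  by_cases h : ∃ i, IsNonCyclic (component q i)
  · obtain ⟨N, hNc, e, h1, h2, h3, h4, h5⟩ := exists_diagonal h
    exact ⟨N, hNc, e, h1, h2, h3, h4, fun _ => h5⟩
  · have hN : ∀ f ∈ (cyclicSubspace q)ᗮ, shift C2 f ∈ (cyclicSubspace q)ᗮ := fun f hf =>
      shift_mem_cyclicSubspace_orthogonal hf
    obtain ⟨e, he⟩ := exists_wandering_basis hN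
    exact ⟨_, inferInstance, e, hN, cyclicSubspace_orthogonal_ne_bot_iff.2 hq,
      fun f hf => (Submodule.mem_orthogonal _ _).1 hf _ (mem_cyclicSubspace_self q), he,
      fun h' => (h h').elim⟩

/-- On functions of an invariant subspace orthogonal to `q`, the operator `H_{a q}` acts like the
square of the momentum operator: the boundary values vanish, and so does the nonlocal term. -/
theorem mem_graph_nonlocalOp_of_momentum {q u y w : L2 C2} (hu : inner ℂ q u = 0)
    (h1 : (u, y) ∈ (momentum C2).graph) (h2 : (y, w) ∈ (momentum C2).graph) (a : ℂ) :
    (u, w) ∈ (nonlocalOp a q).graph := by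
  obtain ⟨v, hv, rfl⟩ := mem_graph_momentum.1 h1
  obtain ⟨v', hv', rfl⟩ := mem_graph_momentum.1 h2
  rw [graph_nonlocalOp]
  have hv2 : HasDeriv v ((-Complex.I) • v') 0 := by
    have h3 := hv'.smul (-Complex.I)
    rw [smul_smul, smul_zero] at h3
    simpa using h3
  refine ⟨v, (-Complex.I) • v', 0, 0, hv, hv2, by simp, by simp [hu], by simp⟩

end HalfLine

end

theorem theorem3p3 (q : HalfLine.L2 HalfLine.C2) (hq : HalfLine.IsNonCyclic q) :
    ∃ (ψ : ℂ → Matrix (Fin 2) (Fin 2) ℂ) (H₀ : Submodule ℂ (HalfLine.L2 HalfLine.C2))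
      (_ : CompleteSpace H₀) (B : H₀ →ₗ.[ℂ] H₀),
      -- the subspace
      HalfLine.IsMatrixInner ψ ∧ H₀ = HalfLine.multiplierRange ψ ∧ H₀ ≠ ⊥ ∧
      -- if a component is non-cyclic, the matrix function is diagonal
      ((∃ i, HalfLine.IsNonCyclic (HalfLine.component q i)) →
        (∀ z ∈ HalfLine.upper, ∀ i j, i ≠ j → ψ z i j = 0) ∧
        ∀ i, (HalfLine.IsNonCyclic (HalfLine.component q i) →
            HalfLine.IsInner fun z => ψ z i i) ∧
          (¬ HalfLine.IsNonCyclic (HalfLine.component q i) →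
            ∀ z ∈ HalfLine.upper, ψ z i i = 0)) ∧
      -- the operator is the restriction of `i d/dx` to the subspace
      (∀ u : H₀, u ∈ B.domain ↔
        (u : HalfLine.L2 HalfLine.C2) ∈ (HalfLine.momentum HalfLine.C2).domain) ∧
      (∀ u w : H₀, (u, w) ∈ B.graph →
        ((u : HalfLine.L2 HalfLine.C2), (w : HalfLine.L2 HalfLine.C2)) ∈
          (HalfLine.momentum HalfLine.C2).graph) ∧
      -- it is simple maximal symmetric, with zero defect number in the upper half-plane
      UnboundedOp.IsSimple B ∧ UnboundedOp.IsMaximalSymmetric B ∧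
      UnboundedOp.ZeroUpperDefect B ∧
      -- its square is a symmetric operator, and every `H_{a q}` extends it
      UnboundedOp.IsSymmetric (UnboundedOp.comp B B) ∧
      ∀ a : ℂ, ∀ u w : H₀, (u, w) ∈ (UnboundedOp.comp B B).graph →
        ((u : HalfLine.L2 HalfLine.C2), (w : HalfLine.L2 HalfLine.C2)) ∈
          (HalfLine.nonlocalOp a q).graph := by
  obtain ⟨N, hNc, e, hN, hN0, hqN, ⟨he, hnorm, horth, hspan⟩, hdiag⟩ :=
    HalfLine.exists_invariant_orthogonal hq
  have hT : UnboundedOp.IsPureIsometry (HalfLine.shift HalfLine.C2) := HalfLine.isPureIsometry_shift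
  have hB := HalfLine.isInverseCayley_momentum.part hT hN
  have hTN := hT.restrictInvariant hN
  refine ⟨HalfLine.columnSymbol e, N, hNc, UnboundedOp.part N (HalfLine.momentum HalfLine.C2),
    HalfLine.isMatrixInner_columnSymbol hN he hnorm horth,
    (HalfLine.multiplierRange_columnSymbol hN he hnorm horth hspan).symm, hN0, hdiag, fun u => ?_,
    fun u w h => UnboundedOp.mem_graph_part.1 h, hB.isSimple hTN, hB.isMaximalSymmetric hTN,
    hB.zeroUpperDefect hTN, hB.isSymmetric_comp_self hTN, fun a u w h => ?_⟩
  · rw [hB.mem_domain_iff, HalfLine.isInverseCayley_momentum.mem_domain_iff]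
    constructor
    · rintro ⟨g, rfl⟩
      exact ⟨g, rfl⟩
    · rintro ⟨g, hg⟩
      exact ⟨⟨g, UnboundedOp.mem_of_sub_mem hT hN (hg ▸ u.2)⟩, Subtype.ext hg⟩
  · obtain ⟨y, h1, h2⟩ := UnboundedOp.mem_graph_comp.1 h
    exact HalfLine.mem_graph_nonlocalOp_of_momentum (hqN u u.2)
      (UnboundedOp.mem_graph_part.1 h1) (UnboundedOp.mem_graph_part.1 h2) a
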